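/- Let $K$ be a field, let $X$ be a finite set, and let $\Gamma$ be the free group on $X$, with length function $\ell$ (length of the reduced word). Fix a total order $<$ on $\Gamma$ that is compatible with left and right multiplication. A series is a function $a\colon\Gamma\to K$, $\omega\mapsto(a,\omega)$. It is a Malcev--Neumann series if its support is well-ordered by $<$. The Cauchy product $ab$ is well-defined if for every $\omega\in\Gamma$ only finitely many pairs $(\alpha,\beta)$ with $\alpha\beta=\omega$ satisfy $(a,\alpha)(b,\beta)\neq0$. The star $a^*=1+a+a^2+\cdots$ is well-defined if for every $\omega\in\Gamma$ only finitely many tuples $(\omega_1,\dots,\omega_n)$, $n\ge0$, with $\omega_1\cdots\omega_n=\omega$ satisfy $(a,\omega_1)\cdots(a,\omega_n)\neq0$. A $*$-rational expression is built from monomials $c\,w$ ($c\in K$, $w$ a not necessarily reduced word in the letters $x,\bar x=x^{-1}$, $x\in X$) by means of $+$, $\times$ and $(\cdot)^*$. It is a $*$-rational Malcev--Neumann expression if all its products and stars are well-defined and every subexpression represents a Malcev--Neumann series. A series is a $*$-rational Malcev--Neumann series if it is represented by such an expression. Two expressions are equivalent if they represent the same series. Expressions without simplification are defined recursively. A monomial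 $c\,w$ is one if the word $w$ is reduced. A sum $E+F$ is one if $E$ and $F$ are. A product $E\cdot F$ is one if $E$ and $F$ are and $\ell(\alpha\beta)=\ell(\alpha)+\ell(\beta)$ for all $\alpha,\beta$ in the supports of the series represented by $E$ and $F$, respectively. A star $E^*$ is one if $E\cdot E$ is. Then every $*$-rational Malcev--Neumann series over $\Gamma$ is represented by a $*$-rational Malcev--Neumann expression without simplification. Moreover, such an expression is effectively computable: if $K$ is a computable field (its elements are coded by natural numbers, with computable addition and multiplication), then there is an algorithm (a partial recursive function on strings of symbols) which, given any $*$-rational Malcev--Neumann expression, halts and returns an equivalent $*$-rational Malcev--Neumann expression without simplification. -/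

import Mathlib

namespace MalcevNeumann

noncomputable section

/-- Formal series over the free group `Γ` on `X` with coefficients in `K`: all functions `Γ → K`. -/
abbrev Ser (K X : Type*) := FreeGroup X → K

namespace Ser

variable {K X : Type*} [Field K]

/-- The monomial `c • w`. -/
def monomial [DecidableEq X] (c : K) (w : FreeGroup X) : Ser K X :=
  fun ω => if ω = w then c else 0

/-- The Cauchy product `a b` is well-defined: for each `ω`, only finitely many pairs `(α, β)` with
`α β = ω` contribute a nonzero term `(a, α) (b, β)`. -/
def MulDefined (a b : Ser K X) : Prop :=
  ∀ ω : FreeGroup X, {p : FreeGroup X × FreeGroup X | p.1 * p.2 = ω ∧ a p.1 * b p.2 ≠ 0}.Finite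

/-- The Cauchy product (meaningful when `MulDefined a b`). -/
def cauchy (a b : Ser K X) : Ser K X :=
  fun ω => ∑ᶠ p ∈ {p : FreeGroup X × FreeGroup X | p.1 * p.2 = ω}, a p.1 * b p.2

/-- The star `a* = 1 + a + a² + ⋯` is well-defined: for each `ω`, there are only finitely many
tuples `(ω₁, …, ωₙ)`, `n ≥ 0`, with `ω = ω₁ ⋯ ωₙ` and `(a, ω₁) ⋯ (a, ωₙ) ≠ 0`. -/
def StarDefined (a : Ser K X) : Prop :=
  ∀ ω : FreeGroup X, {l : List (FreeGroup X) | l.prod = ω ∧ (l.map a).prod ≠ 0}.Finite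

/-- The star `a* = 1 + a + a² + ⋯` (meaningful when `StarDefined a`). -/
def kstar (a : Ser K X) : Ser K X :=
  fun ω => ∑ᶠ l ∈ {l : List (FreeGroup X) | l.prod = ω}, (l.map a).prod

/-- Malcev–Neumann series with respect to a given order on the free group: every nonempty subset
of the support has a minimum. -/
def IsMN [LinearOrder (FreeGroup X)] (a : Ser K X) : Prop :=
  ∀ A : Set (FreeGroup X), A ⊆ Function.support a → A.Nonempty → ∃ m, IsLeast A m

/-- No multiplicative simplification occurs in the product `a b`: for all monomials `α` in the
support of `a` and `β` in the support of `b`, `ℓ(α β) = ℓ(α) + ℓ(β)`. -/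
def NoCancel [DecidableEq X] (a b : Ser K X) : Prop :=
  ∀ α ∈ Function.support a, ∀ β ∈ Function.support b, (α * β).norm = α.norm + β.norm

end Ser

/-- `*`-rational expressions. The atoms are monomials `c • w`, with `c` a scalar and `w` a word, not
necessarily reduced, in the letters `x = (x, true)` and `x̄ = (x, false)`; so every polynomial over
the free group is given by a sum of atoms. -/
inductive RatExpr (K X : Type*) where
  | mono (c : K) (w : List (X × Bool)) : RatExpr K X
  | add (E F : RatExpr K X) : RatExpr K X
  | mul (E F : RatExpr K X) : RatExpr K X
  | star (E : RatExpr K X) : RatExpr K X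

/-- The symbols in which expressions are written down: atoms, and three operation symbols
`0` for `+`, `1` for `×`, `2` for `*`. -/
abbrev Token (K X : Type*) := (K × List (X × Bool)) ⊕ Fin 3

namespace RatExpr

variable {K X : Type*}

/-- The expression as a string of symbols, in prefix (Polish) notation. -/
def code : RatExpr K X → List (Token K X)
  | mono c w => [Sum.inl (c, w)]
  | add E F => Sum.inr 0 :: (code E ++ code F)
  | mul E F => Sum.inr 1 :: (code E ++ code F)
  | star E => Sum.inr 2 :: code E

theorem code_append_inj (E : RatExpr K X) : ∀ (F : RatExpr K X) (s t : List (Token K X)),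
    code E ++ s = code F ++ t → E = F ∧ s = t := by
  induction E with
  | mono c w =>
    intro F s t h
    cases F <;> simp_all [code]
  | add E₁ E₂ ih₁ ih₂ =>
    intro F s t h
    cases F with
    | add F₁ F₂ =>
      simp only [code, List.cons_append, List.append_assoc, List.cons.injEq, true_and] at h
      obtain ⟨rfl, h'⟩ := ih₁ _ _ _ h
      obtain ⟨rfl, h''⟩ := ih₂ _ _ _ h'
      exact ⟨rfl, h''⟩
    | _ => simp [code] at h
  | mul E₁ E₂ ih₁ ih₂ =>
    intro F s t h
    cases F with
    | mul F₁ F₂ =>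
      simp only [code, List.cons_append, List.append_assoc, List.cons.injEq, true_and] at h
      obtain ⟨rfl, h'⟩ := ih₁ _ _ _ h
      obtain ⟨rfl, h''⟩ := ih₂ _ _ _ h'
      exact ⟨rfl, h''⟩
    | _ => simp [code] at h
  | star E ih =>
    intro F s t h
    cases F with
    | star F =>
      simp only [code, List.cons_append, List.cons.injEq, true_and] at h
      obtain ⟨rfl, h'⟩ := ih _ _ _ h
      exact ⟨rfl, h'⟩
    | _ => simp [code] at h

/-- An expression is determined by its string of symbols. -/
theorem code_injective : Function.Injective (code : RatExpr K X → List (Token K X)) :=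
  fun E F h => (code_append_inj E F [] [] (by simpa using h)).1

variable [Field K] [DecidableEq X]

/-- The series over the free group represented by an expression. -/
def value : RatExpr K X → Ser K X
  | mono c w => Ser.monomial c (FreeGroup.mk w)
  | add E F => value E + value F
  | mul E F => Ser.cauchy (value E) (value F)
  | star E => Ser.kstar (value E)

/-- `E` is a `*`-rational expression in the Malcev–Neumann series: all products and stars in it are
well-defined, and every subexpression represents a Malcev–Neumann series. -/
def IsMN [LinearOrder (FreeGroup X)] : RatExpr K X → Prop
  | mono c w => Ser.IsMN (value (mono c w))
  | add E F => IsMN E ∧ IsMN F ∧ Ser.IsMN (value (add E F))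
  | mul E F => IsMN E ∧ IsMN F ∧ Ser.MulDefined (value E) (value F) ∧ Ser.IsMN (value (mul E F))
  | star E => IsMN E ∧ Ser.StarDefined (value E) ∧ Ser.IsMN (value (star E))

/-- `E` is an expression without simplification. -/
def WithoutSimplification : RatExpr K X → Prop
  | mono _ w => FreeGroup.IsReduced w
  | add E F => WithoutSimplification E ∧ WithoutSimplification F
  | mul E F => WithoutSimplification E ∧ WithoutSimplification F ∧ Ser.NoCancel (value E) (value F)
  | star E => WithoutSimplification E ∧ Ser.NoCancel (value E) (value E)

end RatExpr

/-- `a` is a `*`-rational Malcev–Neumann series. -/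
def Ser.IsRationalMN {K X : Type*} [Field K] [DecidableEq X] [LinearOrder (FreeGroup X)]
    (a : Ser K X) : Prop :=
  ∃ E : RatExpr K X, E.IsMN ∧ E.value = a

/-- A computable field: the elements are coded by natural numbers (so that equality is decidable)
and the operations are computable. Negation and inversion are then computable, by search. -/
structure IsComputableField (K : Type*) [Field K] [Primcodable K] : Prop where
  add : Computable₂ (fun x y : K => x + y)
  mul : Computable₂ (fun x y : K => x * y)

end

end MalcevNeumann

/-!
Malcev–Neumann series form a ring, in which a well-defined star `a*` is the inverse of `1 - a`,
because well-definedness forces the support of `a` to be positive (`pos_of_starDefined`).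

*Existence.* Call a series `c` good if right multiplication by `c` commutes up to finite rank with
the projections onto the series supported by the reduced words not beginning with a given letter
(`FinComm`). Monomials are good, and good series are closed under sums, products and inverses, so
all rational series are good. The derivatives of `c` along reduced words are values of these
commutators, so a good series has a finite-dimensional space of derivatives (`finite_span_deriv`).
Such a space gives an automaton with weights in `K` that reads reduced words, together with a
system of potentials: elements `m i` of the group, one for each state `i`, with `m i ≤ y m j` for
each transition from `i` to `j` reading `y` (`exists_aut_of_finite`). For this the states have to
record how far up the supports are, and Higman's lemma shows that finitely many states suffice.
By the potentials, the label of each loop is `> 1`; hence all stars that arise in the elimination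
of states are well-defined, and the resulting expression is a Malcev–Neumann expression. It is
without simplification because the automaton reads reduced words only (`outExpr_spec`,
`outExpr_value`).

*Computability.* The order is not assumed to be computable, and which potentials are correct
depends on it. The algorithm therefore enumerates the derivations of an inference system (`rules`)
whose judgements say that a word is positive, that an automaton has potentials, or that a state of
an automaton represents the value of an expression. The rules are sound for every expression that
is Malcev–Neumann (`preserves_rules`): the words known to be positive are those in the supports of
the bodies of its stars and the elements of the normal submonoid generated by them. That an
automaton represents a sum, a product or a star is checked by finite certificates in linear
algebra: a matrix for the part of a product that cancels (`Aut.CancelEq`) gives an automaton for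
the product (`prodAut_ser_inl`), and linear relations between the states of an automaton are
certified by `Aut.ZeroCert`; a star is recognized as the solution of `s = 1 + a s`. The system is
complete (`pwo_and_hasAut`) since the existence part works for the preorder given by the normal
submonoid of provably positive elements instead of the order of the group: partial well-orders are
all it needs. Once a derivation is found, state elimination computes the result.
-/

namespace MalcevNeumann

set_option linter.unusedSectionVars false

noncomputable section

open Function

/-! ### Reduced words and cancellation-free products -/

section Words

variable {X : Type*}

/-- The group element represented by a letter. -/
def letter (y : X × Bool) : FreeGroup X := FreeGroup.mk [y]

/-- The formal inverse of a letter. -/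
def bar (y : X × Bool) : X × Bool := (y.1, !y.2)

@[simp] theorem bar_bar (y : X × Bool) : bar (bar y) = y := by simp [bar]

theorem letter_bar (y : X × Bool) : letter (bar y) = (letter y)⁻¹ := by
  simp [letter, bar, FreeGroup.inv_mk, FreeGroup.invRev]

theorem mk_cons (y : X × Bool) (w : List (X × Bool)) :
    FreeGroup.mk (y :: w) = letter y * FreeGroup.mk w := by
  simp [letter, FreeGroup.mul_mk]

variable [DecidableEq X]

/-- The product `α β` is free of cancellation. -/
def NC (α β : FreeGroup X) : Prop := (α * β).norm = α.norm + β.norm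

instance (α β : FreeGroup X) : Decidable (NC α β) := inferInstanceAs (Decidable (_ = _))

theorem norm_letter (y : X × Bool) : (letter y).norm = 1 := by
  simp [letter, FreeGroup.norm]

theorem toWord_letter (y : X × Bool) : (letter y).toWord = [y] := by
  simp [letter]

theorem toWord_mul_of_nc {α β : FreeGroup X} (h : NC α β) :
    (α * β).toWord = α.toWord ++ β.toWord := by
  refine (FreeGroup.toWord_mul_sublist α β).eq_of_length ?_
  simpa [FreeGroup.norm, NC] using h

theorem nc_iff_isReduced {α β : FreeGroup X} :
    NC α β ↔ FreeGroup.IsReduced (α.toWord ++ β.toWord) := by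
  constructor
  · intro h
    rw [← toWord_mul_of_nc h]
    exact FreeGroup.isReduced_toWord
  · intro h
    rw [NC, FreeGroup.norm, FreeGroup.toWord_mul, h.reduce_eq]
    simp [FreeGroup.norm]

/-- Cancellation is a local phenomenon: if `α β` and `β γ` are free of cancellation and `β ≠ 1`,
then so is `α β γ`. -/
theorem nc_overlap {α β γ : FreeGroup X} (h₁ : NC α β) (h₂ : NC β γ) (hβ : β ≠ 1) :
    (α * β * γ).norm = α.norm + β.norm + γ.norm := by
  have h : NC (α * β) γ := by
    rw [nc_iff_isReduced] at *
    rw [toWord_mul_of_nc (nc_iff_isReduced.2 h₁)]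
    exact List.IsChain.append_overlap h₁ h₂ (by simpa using hβ)
  rw [h, h₁]

theorem nc_one_right (α : FreeGroup X) : NC α 1 := by simp [NC]

theorem nc_one_left (α : FreeGroup X) : NC 1 α := by simp [NC]

theorem NC.of_mul_left {α β γ : FreeGroup X} (h : NC (α * β) γ) (h' : NC α β) : NC β γ := by
  have h1 := FreeGroup.norm_mul_le α (β * γ)
  have h2 := FreeGroup.norm_mul_le β γ
  simp only [NC] at *
  rw [mul_assoc] at h
  omega

theorem NC.of_mul_right {α β γ : FreeGroup X} (h : NC α (β * γ)) (h' : NC β γ) : NC α β := by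
  have h1 := FreeGroup.norm_mul_le (α * β) γ
  have h2 := FreeGroup.norm_mul_le α β
  simp only [NC] at *
  rw [mul_assoc] at h1
  omega

theorem NC.assoc {α β γ : FreeGroup X} (h : NC (α * β) γ) (h' : NC α β) : NC α (β * γ) := by
  have h1 := NC.of_mul_left h h'
  simp only [NC] at *
  rw [mul_assoc] at h
  omega

theorem NC.assoc' {α β γ : FreeGroup X} (h : NC α (β * γ)) (h' : NC β γ) : NC (α * β) γ := by
  have h1 := NC.of_mul_right h h'
  simp only [NC] at *
  rw [mul_assoc]
  omega

theorem NC.inv {α β : FreeGroup X} (h : NC α β) : NC β⁻¹ α⁻¹ := by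
  simp only [NC, ← mul_inv_rev, FreeGroup.norm_inv_eq] at *
  omega

/-- If the letter `y` cancels in `y g`, then the reduced word of `g` begins with its inverse. -/
theorem isReduced_cons_of_not_nc {y : X × Bool} {g : FreeGroup X} (h : ¬ NC (letter y) g) :
    ∃ g', g = letter (bar y) * g' ∧ NC (letter (bar y)) g' := by
  have hr := FreeGroup.isReduced_toWord (x := g)
  have hg : FreeGroup.mk g.toWord = g := FreeGroup.mk_toWord
  rw [nc_iff_isReduced, toWord_letter] at h
  match hw : g.toWord with
  | [] => simp [hw] at h
  | z :: w =>
    rw [hw] at h hr hg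
    have hw' : FreeGroup.IsReduced w := hr.tail
    have hz : z = bar y := by
      by_contra hz
      apply h
      simp only [List.singleton_append, FreeGroup.isReduced_cons_cons]
      refine ⟨fun hyz => ?_, hr⟩
      by_contra hb
      exact hz (Prod.ext hyz.symm (by
        simp only [bar]; cases hy : y.2 <;> cases hz : z.2 <;> simp_all))
    subst hz
    refine ⟨FreeGroup.mk w, by rw [← hg, mk_cons], ?_⟩
    rw [nc_iff_isReduced, toWord_letter, FreeGroup.toWord_mk, hw'.reduce_eq]
    exact hr

theorem not_nc_iff {y : X × Bool} {g : FreeGroup X} :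
    ¬ NC (letter y) g ↔ NC (letter (bar y)) (letter y * g) := by
  constructor
  · intro h
    obtain ⟨g', rfl, h'⟩ := isReduced_cons_of_not_nc h
    simpa [letter_bar] using h'
  · intro h h'
    simp only [NC, letter_bar, FreeGroup.norm_inv_eq, norm_letter, inv_mul_cancel_left] at h h'
    omega

theorem exists_first {g : FreeGroup X} (h : g ≠ 1) :
    ∃ y g', g = letter y * g' ∧ NC (letter y) g' := by
  have hr := FreeGroup.isReduced_toWord (x := g)
  have hg : FreeGroup.mk g.toWord = g := FreeGroup.mk_toWord
  match hw : g.toWord with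
  | [] => simp at hw; exact absurd hw h
  | z :: w =>
    rw [hw] at hr hg
    have hw' : FreeGroup.IsReduced w := hr.tail
    refine ⟨z, FreeGroup.mk w, by rw [← hg, mk_cons], ?_⟩
    rw [nc_iff_isReduced, toWord_letter, FreeGroup.toWord_mk, hw'.reduce_eq]
    exact hr

theorem first_unique {y z : X × Bool} {g h : FreeGroup X} (e : letter y * g = letter z * h)
    (hy : NC (letter y) g) (hz : NC (letter z) h) : y = z ∧ g = h := by
  have h1 := toWord_mul_of_nc hy
  rw [e, toWord_mul_of_nc hz, toWord_letter, toWord_letter] at h1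
  have : z = y := by simpa using congrArg List.head? h1
  subst this
  exact ⟨rfl, mul_left_cancel e⟩

theorem letter_ne_one (y : X × Bool) : letter y ≠ 1 := by
  intro h
  have := norm_letter y
  simp [h] at this

/-- Induction on the reduced word from the left. -/
theorem letter_induction {p : FreeGroup X → Prop} (one : p 1)
    (mul : ∀ y g, NC (letter y) g → p g → p (letter y * g)) (g : FreeGroup X) : p g := by
  induction hn : g.norm using Nat.strong_induction_on generalizing g with
  | _ n ih =>
    by_cases hg : g = 1
    · exact hg ▸ one
    · obtain ⟨y, g', rfl, h⟩ := exists_first hg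
      refine mul y g' h (ih _ ?_ g' rfl)
      rw [← hn, h, norm_letter]
      omega

/-- A product `α β` is free of cancellation if `α` ends in the letter `z` and `z β` is free of
cancellation. -/
theorem nc_of_letter {α β : FreeGroup X} {z : X × Bool}
    (h : NC (α * (letter z)⁻¹) (letter z)) (h' : NC (letter z) β) : NC α β := by
  have := nc_overlap h h' (letter_ne_one z)
  have h2 := h
  simp only [NC, inv_mul_cancel_right] at *
  omega

theorem finite_norm_le [Finite X] (n : ℕ) : {g : FreeGroup X | g.norm ≤ n}.Finite := by
  have := List.finite_length_le (X × Bool) n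
  exact Set.Finite.of_finite_image (f := FreeGroup.toWord)
    (this.subset (by rintro _ ⟨g, hg, rfl⟩; exact hg)) FreeGroup.toWord_injective.injOn

end Words

/-! ### Partial well-orders relative to a normal submonoid -/

section Rel

variable {G : Type*} [Group G]

/-- The invariant preorder on a group whose positive elements are those of `N`. -/
def rel (N : Submonoid G) (u v : G) : Prop := u⁻¹ * v ∈ N

/-- Invariance of a submonoid under conjugation. -/
def IsNormal (N : Submonoid G) : Prop := ∀ g, ∀ n ∈ N, g * n * g⁻¹ ∈ N

/-- The set `s` is partially well-ordered by the preorder `rel N`. -/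
abbrev PWO (N : Submonoid G) (s : Set G) : Prop := s.PartiallyWellOrderedOn (rel N)

variable {N : Submonoid G}

theorem rel_refl (u : G) : rel N u u := by simp [rel, N.one_mem]

theorem rel_trans {u v w : G} (h : rel N u v) (h' : rel N v w) : rel N u w := by
  have := N.mul_mem h h'
  simpa [rel, mul_assoc] using this

instance : IsPreorder G (rel N) where
  refl := rel_refl
  trans _ _ _ := rel_trans

theorem rel_mul_left (g : G) {u v : G} : rel N (g * u) (g * v) ↔ rel N u v := by
  simp [rel, mul_assoc]

theorem rel_mul_right (hN : IsNormal N) (g : G) {u v : G} (h : rel N u v) :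
    rel N (u * g) (v * g) := by
  have := hN g⁻¹ _ h
  simpa [rel, mul_assoc] using this

theorem rel_mul (hN : IsNormal N) {u v u' v' : G} (h : rel N u v) (h' : rel N u' v') :
    rel N (u * u') (v * v') :=
  rel_trans (rel_mul_right hN u' h) ((rel_mul_left v).2 h')

theorem PWO.mono_rel {N' : Submonoid G} {s : Set G} (h : PWO N s) (hN : N ≤ N') : PWO N' s := by
  refine Set.partiallyWellOrderedOn_iff_exists_lt.2 fun f hf => ?_
  obtain ⟨m, n, hmn, hr⟩ := h.exists_lt hf
  exact ⟨m, n, hmn, hN hr⟩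

theorem PWO.image2_mul (hN : IsNormal N) {s t : Set G} (hs : PWO N s) (ht : PWO N t) :
    PWO N (Set.image2 (· * ·) s t) := by
  rw [← Set.image_prod]
  exact (hs.prod ht).image_of_monotone_on fun p _ q _ h => rel_mul hN h.1 h.2

theorem PWO.image_mul_left {s : Set G} (hs : PWO N s) (g : G) : PWO N ((g * ·) '' s) :=
  hs.image_of_monotone_on fun _ _ _ _ h => (rel_mul_left g).2 h

theorem rel_prod_of_sublistForall₂ (hN : IsNormal N) {l l' : List G}
    (h : List.SublistForall₂ (rel N) l l') (hl : ∀ x ∈ l', x ∈ N) : rel N l.prod l'.prod := by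
  induction h with
  | nil =>
    simp only [List.prod_nil, rel, inv_one, one_mul]
    exact N.list_prod_mem hl
  | cons h _ ih =>
    simp only [List.prod_cons]
    exact rel_mul hN h (ih fun x hx => hl x (List.mem_cons_of_mem _ hx))
  | @cons_right a l₁ l₂ _ ih =>
    have h1 : rel N 1 a := by
      have := hl a List.mem_cons_self
      simpa [rel] using this
    have h2 := rel_mul hN h1 (ih fun x hx => hl x (List.mem_cons_of_mem _ hx))
    simpa using h2

/-- By Higman's lemma, the products of elements of a partially well-ordered set of positive
elements form a partially well-ordered set. -/
theorem PWO.list_prod (hN : IsNormal N) {s : Set G} (hs : PWO N s) (hpos : s ⊆ N) :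
    PWO N {g | ∃ l : List G, (∀ x ∈ l, x ∈ s) ∧ l.prod = g} := by
  have h := Set.PartiallyWellOrderedOn.partiallyWellOrderedOn_sublistForall₂ (rel N) hs
  refine Set.partiallyWellOrderedOn_iff_exists_lt.2 fun f hf => ?_
  choose l hl hlf using hf
  obtain ⟨m, n, hmn, hr⟩ := h.exists_lt (f := l) hl
  refine ⟨m, n, hmn, ?_⟩
  rw [← hlf, ← hlf]
  exact rel_prod_of_sublistForall₂ hN hr fun x hx => hpos (hl n x hx)

/-- A partially well-ordered set has a finite subset below all of its elements. -/
theorem PWO.exists_finite {s : Set G} (hs : PWO N s) :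
    ∃ t : Finset G, ↑t ⊆ s ∧ ∀ g ∈ s, ∃ p ∈ t, rel N p g := by
  by_contra hcon
  push Not at hcon
  have hF : ∀ t : Finset G, ∃ g, ↑t ⊆ s → g ∈ s ∧ ∀ p ∈ t, ¬ rel N p g := by
    intro t
    by_cases ht : (↑t : Set G) ⊆ s
    · obtain ⟨g, hg⟩ := hcon t ht
      exact ⟨g, fun _ => hg⟩
    · exact ⟨1, fun h => absurd h ht⟩
  choose F hF using hF
  -- otherwise, adding elements greedily gives a sequence without an increasing pair
  classical
  let S : ℕ → Finset G := fun n => Nat.rec (∅ : Finset G) (fun _ t => insert (F t) t) n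
  have hS0 : S 0 = ∅ := rfl
  have hS : ∀ n, S (n + 1) = insert (F (S n)) (S n) := fun n => rfl
  have hSs : ∀ n, SetLike.coe (S n) ⊆ s := by
    intro n
    induction n with
    | zero => simp [hS0]
    | succ n ih =>
      rw [hS, Finset.coe_insert]
      exact Set.insert_subset (hF _ ih).1 ih
  have hmono : Monotone S := monotone_nat_of_le_succ fun n => by
    rw [hS]; exact Finset.subset_insert _ _
  obtain ⟨m, n, hmn, hr⟩ := hs.exists_lt (f := fun n => F (S n)) fun n => (hF _ (hSs n)).1
  refine (hF _ (hSs n)).2 _ ?_ hr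
  exact hmono hmn (by rw [hS]; exact Finset.mem_insert_self _ _)

end Rel

section Order

variable {G : Type*} [Group G] [LinearOrder G] [MulLeftMono G] [MulRightMono G]

/-- The elements `≥ 1` of an ordered group. -/
def posMonoid (G : Type*) [Group G] [LinearOrder G] [MulLeftMono G] [MulRightMono G] :
    Submonoid G where
  carrier := {g | 1 ≤ g}
  one_mem' := le_rfl
  mul_mem' := fun ha hb => one_le_mul ha hb

theorem mem_posMonoid {g : G} : g ∈ posMonoid G ↔ 1 ≤ g := Iff.rfl

theorem rel_posMonoid {u v : G} : rel (posMonoid G) u v ↔ u ≤ v := by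
  rw [rel, mem_posMonoid, le_inv_mul_iff_mul_le, mul_one]

theorem isNormal_posMonoid : IsNormal (posMonoid G) := by
  intro g n hn
  rw [mem_posMonoid] at *
  calc (1 : G) = g * 1 * g⁻¹ := by group
    _ ≤ g * n * g⁻¹ := by gcongr

theorem pwo_posMonoid {s : Set G} : PWO (posMonoid G) s ↔ s.IsPWO := by
  have : rel (posMonoid G) = fun u v : G => u ≤ v := by
    ext u v; exact rel_posMonoid
  rw [PWO, this]
  rfl

theorem finite_antidiagonal {s t : Set G} (hs : s.IsPWO) (ht : t.IsPWO) (ω : G) :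
    {u | u ∈ s ∧ u⁻¹ * ω ∈ t}.Finite := by
  by_contra h
  have h : {u | u ∈ s ∧ u⁻¹ * ω ∈ t}.Infinite := h
  let f := h.natEmbedding
  obtain ⟨g, hg⟩ := hs.exists_monotone_subseq (f := fun n => (f n : G)) fun n => (f n).2.1
  obtain ⟨m, n, hmn, hr⟩ := ht.exists_lt (f := fun n => (f (g n) : G)⁻¹ * ω) fun n => (f (g n)).2.2
  have h1 : (f (g m) : G) ≤ f (g n) := hg hmn.le
  have h2 : (f (g n) : G) ≤ f (g m) :=
    inv_le_inv_iff.1 (le_of_mul_le_mul_right' hr)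
  have : f (g m) = f (g n) := Subtype.ext (le_antisymm h1 h2)
  exact hmn.ne (g.injective (f.injective this))

theorem prod_lt_of_sublistForall₂ {l l' : List G} (h : List.SublistForall₂ (· ≤ ·) l l')
    (hl : ∀ x ∈ l', 1 < x) : l.prod < l'.prod ∨ l = l' := by
  induction h with
  | @nil l =>
    cases l with
    | nil => simp
    | cons a l =>
      left
      simp only [List.prod_nil, List.prod_cons]
      refine one_lt_mul_of_lt_of_le' (hl a List.mem_cons_self) ?_
      exact List.one_le_prod_of_one_le fun x hx => (hl x (List.mem_cons_of_mem _ hx)).le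
  | @cons a b l₁ l₂ h _ ih =>
    have ih := ih fun x hx => hl x (List.mem_cons_of_mem _ hx)
    simp only [List.prod_cons]
    rcases ih with ih | rfl
    · exact Or.inl (mul_lt_mul_of_le_of_lt h ih)
    · rcases h.eq_or_lt with rfl | h
      · exact Or.inr rfl
      · exact Or.inl (mul_lt_mul_of_lt_of_le h le_rfl)
  | @cons_right a l₁ l₂ _ ih =>
    left
    have ih := ih fun x hx => hl x (List.mem_cons_of_mem _ hx)
    have h1 : l₁.prod ≤ l₂.prod := by
      rcases ih with ih | rfl
      · exact ih.le
      · exact le_rfl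
    simp only [List.prod_cons]
    calc l₁.prod ≤ l₂.prod := h1
      _ = 1 * l₂.prod := (one_mul _).symm
      _ < a * l₂.prod := by
        exact mul_lt_mul_of_lt_of_le (hl a List.mem_cons_self) le_rfl

/-- B. H. Neumann's finiteness theorem: an element has only finitely many factorizations into
elements of a well-ordered set of elements `> 1`. -/
theorem finite_list_prod {s : Set G} (hs : s.IsPWO) (hpos : ∀ x ∈ s, 1 < x) (ω : G) :
    {l : List G | l.prod = ω ∧ ∀ x ∈ l, x ∈ s}.Finite := by
  by_contra h
  have h : {l : List G | l.prod = ω ∧ ∀ x ∈ l, x ∈ s}.Infinite := h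
  let f := h.natEmbedding
  have hH := Set.PartiallyWellOrderedOn.partiallyWellOrderedOn_sublistForall₂ (· ≤ ·) hs
  obtain ⟨m, n, hmn, hr⟩ := hH.exists_lt (f := fun n => (f n : List G)) fun n => (f n).2.2
  rcases prod_lt_of_sublistForall₂ hr fun x hx => hpos x ((f n).2.2 x hx) with h | h
  · rw [(f m).2.1, (f n).2.1] at h
    exact lt_irrefl _ h
  · exact hmn.ne (f.injective (Subtype.ext h))

end Order

/-! ### The ring of Malcev–Neumann series -/

section Ring

variable {K X : Type*} [Field K]

theorem exists_ne_zero_of_finsum {α : Type*} {f : α → K} (h : ∑ᶠ i, f i ≠ 0) : ∃ i, f i ≠ 0 := by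
  by_contra hcon
  push Not at hcon
  exact h (finsum_eq_zero_of_forall_eq_zero hcon)

theorem cauchy_apply (a b : Ser K X) (ω : FreeGroup X) :
    a.cauchy b ω = ∑ᶠ u, a u * b (u⁻¹ * ω) := by
  have h : {p : FreeGroup X × FreeGroup X | p.1 * p.2 = ω} = Set.range fun u => (u, u⁻¹ * ω) := by
    ext ⟨u, v⟩
    simp only [Set.mem_ofPred_eq, Set.mem_range, Prod.mk.injEq]
    constructor
    · rintro rfl
      exact ⟨u, rfl, by group⟩
    · rintro ⟨_, rfl, rfl⟩
      group
  rw [Ser.cauchy, h, finsum_mem_range fun u v huv => congrArg Prod.fst huv]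

theorem support_cauchy_subset (a b : Ser K X) :
    support (a.cauchy b) ⊆ Set.image2 (· * ·) (support a) (support b) := by
  intro ω hω
  rw [mem_support, cauchy_apply] at hω
  obtain ⟨u, hu⟩ := exists_ne_zero_of_finsum hω
  exact ⟨u, left_ne_zero_of_mul hu, u⁻¹ * ω, right_ne_zero_of_mul hu, by simp⟩

theorem support_kstar_subset (a : Ser K X) :
    support a.kstar ⊆ {g | ∃ l : List (FreeGroup X), (∀ x ∈ l, x ∈ support a) ∧ l.prod = g} := by
  intro ω hω
  obtain ⟨l, hl, h⟩ := exists_ne_zero_of_finsum_mem_ne_zero hω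
  refine ⟨l, fun x hx h0 => h ?_, hl⟩
  exact List.prod_eq_zero (List.mem_map.2 ⟨x, hx, h0⟩)

variable [LinearOrder (FreeGroup X)]

theorem isMN_iff {a : Ser K X} : a.IsMN ↔ (support a).IsPWO := by
  rw [Set.isPWO_iff_isWF, Set.IsWF, Set.wellFoundedOn_iff, WellFounded.wellFounded_iff_has_min]
  constructor
  · intro h A hA
    by_cases hne : (A ∩ support a).Nonempty
    · obtain ⟨m, hm, hle⟩ := h _ Set.inter_subset_right hne
      refine ⟨m, hm.1, fun x hx hlt => ?_⟩
      exact absurd (hle ⟨hx, hlt.2.1⟩) (not_le.2 hlt.1)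
    · obtain ⟨m, hm⟩ := hA
      exact ⟨m, hm, fun x hx hlt => hne ⟨x, hx, hlt.2.1⟩⟩
  · intro h A hA hne
    obtain ⟨m, hm, hlt⟩ := h A hne
    exact ⟨m, hm, fun x hx => not_lt.1 fun hxm => hlt x hx ⟨hxm, hA hx, hA hm⟩⟩

theorem isMN_mono {a : Ser K X} {s : Set (FreeGroup X)} (hs : s.IsPWO) (h : support a ⊆ s) :
    a.IsMN := isMN_iff.2 (hs.mono h)

variable [DecidableEq X]

theorem support_monomial_subset (c : K) (w : FreeGroup X) :
    support (Ser.monomial c w) ⊆ {w} := by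
  intro g hg
  by_contra h
  exact hg (if_neg h)

theorem isMN_monomial (c : K) (w : FreeGroup X) : (Ser.monomial c w).IsMN :=
  isMN_mono (Set.isPWO_singleton w) (support_monomial_subset c w)

variable (K X) in
/-- The space of Malcev–Neumann series. -/
def mn : Submodule K (Ser K X) where
  carrier := {a | a.IsMN}
  zero_mem' := by simp [isMN_iff]
  add_mem' {a b} ha hb := by
    simp only [Set.mem_ofPred_eq, isMN_iff] at *
    exact (ha.union hb).mono (support_add a b)
  smul_mem' c a ha := by
    simp only [Set.mem_ofPred_eq, isMN_iff] at *
    exact ha.mono (support_const_smul_subset c a)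

variable [MulLeftMono (FreeGroup X)] [MulRightMono (FreeGroup X)]

theorem finite_support_conv {a b : Ser K X} (ha : a.IsMN) (hb : b.IsMN) (ω : FreeGroup X) :
    (support fun u => a u * b (u⁻¹ * ω)).Finite :=
  (finite_antidiagonal (isMN_iff.1 ha) (isMN_iff.1 hb) ω).subset fun _ hu =>
    ⟨left_ne_zero_of_mul hu, right_ne_zero_of_mul hu⟩

theorem mulDefined {a b : Ser K X} (ha : a.IsMN) (hb : b.IsMN) : a.MulDefined b := by
  intro ω
  refine ((finite_support_conv ha hb ω).image fun u => (u, u⁻¹ * ω)).subset ?_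
  rintro ⟨u, v⟩ ⟨rfl, h⟩
  exact ⟨u, by simpa using h, by simp⟩

theorem pwo_of_isMN {a : Ser K X} (ha : a.IsMN) : PWO (posMonoid (FreeGroup X)) (support a) :=
  pwo_posMonoid.2 (isMN_iff.1 ha)

theorem isMN_cauchy {a b : Ser K X} (ha : a.IsMN) (hb : b.IsMN) : (a.cauchy b).IsMN :=
  isMN_mono (pwo_posMonoid.1 ((pwo_of_isMN ha).image2_mul isNormal_posMonoid (pwo_of_isMN hb)))
    (support_cauchy_subset a b)

theorem cauchy_assoc {a b c : Ser K X} (ha : a.IsMN) (hb : b.IsMN) (hc : c.IsMN) :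
    (a.cauchy b).cauchy c = a.cauchy (b.cauchy c) := by
  funext ω
  have hfin : (support fun p : FreeGroup X × FreeGroup X =>
      a p.2 * b (p.2⁻¹ * p.1) * c (p.1⁻¹ * ω)).Finite := by
    have h1 := finite_antidiagonal (pwo_posMonoid.1 ((pwo_of_isMN ha).image2_mul
      isNormal_posMonoid (pwo_of_isMN hb))) (isMN_iff.1 hc) ω
    refine (h1.biUnion fun w _ => ((finite_support_conv ha hb w).image fun u => (w, u))).subset ?_
    rintro ⟨w, u⟩ h
    have h' := left_ne_zero_of_mul h
    simp only [Set.mem_iUnion]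
    refine ⟨w, ⟨⟨u, left_ne_zero_of_mul h', _, right_ne_zero_of_mul h', by simp⟩,
      right_ne_zero_of_mul h⟩, u, h', rfl⟩
  have hfin' := hfin.preimage (Prod.swap_injective.injOn (s := Prod.swap ⁻¹' _))
  have e1 : (a.cauchy b).cauchy c ω =
      ∑ᶠ w, ∑ᶠ u, a u * b (u⁻¹ * w) * c (w⁻¹ * ω) := by
    rw [cauchy_apply]
    refine finsum_congr fun w => ?_
    rw [cauchy_apply, finsum_mul' _ _ (finite_support_conv ha hb w)]
  have e2 : a.cauchy (b.cauchy c) ω =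
      ∑ᶠ u, ∑ᶠ w, a u * b (u⁻¹ * w) * c (w⁻¹ * ω) := by
    rw [cauchy_apply]
    refine finsum_congr fun u => ?_
    rw [cauchy_apply, mul_finsum' _ _ (finite_support_conv hb hc _),
      ← finsum_comp_equiv (Equiv.mulLeft u⁻¹)]
    refine finsum_congr fun w => ?_
    simp [mul_assoc]
  rw [e1, e2, ← finsum_curry (fun p : FreeGroup X × FreeGroup X =>
      a p.2 * b (p.2⁻¹ * p.1) * c (p.1⁻¹ * ω)) hfin,
    ← finsum_curry (fun p : FreeGroup X × FreeGroup X =>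
      a p.1 * b (p.1⁻¹ * p.2) * c (p.2⁻¹ * ω)) hfin',
    ← finsum_comp_equiv (Equiv.prodComm _ _)]
  rfl

theorem monomial_cauchy (c : K) (w : FreeGroup X) (b : Ser K X) (ω : FreeGroup X) :
    (Ser.monomial c w).cauchy b ω = c * b (w⁻¹ * ω) := by
  rw [cauchy_apply, finsum_eq_single _ w]
  · simp [Ser.monomial]
  · intro u hu
    simp [Ser.monomial, hu]

theorem cauchy_monomial (a : Ser K X) (c : K) (w : FreeGroup X) (ω : FreeGroup X) :
    a.cauchy (Ser.monomial c w) ω = a (ω * w⁻¹) * c := by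
  rw [cauchy_apply, finsum_eq_single _ (ω * w⁻¹)]
  · simp [Ser.monomial]
  · intro u hu
    have : u⁻¹ * ω ≠ w := by
      rintro rfl
      apply hu
      group
    simp [Ser.monomial, this]

instance : Mul (mn K X) := ⟨fun a b => ⟨a.1.cauchy b.1, isMN_cauchy a.2 b.2⟩⟩

instance : One (mn K X) := ⟨⟨Ser.monomial 1 1, isMN_monomial 1 1⟩⟩

theorem coe_mul (a b : mn K X) : ((a * b : mn K X) : Ser K X) = a.1.cauchy b.1 := rfl

theorem coe_one : ((1 : mn K X) : Ser K X) = Ser.monomial 1 1 := rfl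

theorem mul_apply (a b : mn K X) (ω : FreeGroup X) :
    (a * b).1 ω = ∑ᶠ u, a.1 u * b.1 (u⁻¹ * ω) := cauchy_apply _ _ _

instance : Ring (mn K X) :=
  { (inferInstance : AddCommGroup (mn K X)), (inferInstance : Mul (mn K X)),
    (inferInstance : One (mn K X)) with
    left_distrib := fun a b c => by
      ext ω
      change (a * (b + c)).1 ω = (a * b).1 ω + (a * c).1 ω
      rw [mul_apply, mul_apply, mul_apply, ← finsum_add_distrib
        (finite_support_conv a.2 b.2 ω) (finite_support_conv a.2 c.2 ω)]
      exact finsum_congr fun u => mul_add _ _ _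
    right_distrib := fun a b c => by
      ext ω
      change ((a + b) * c).1 ω = (a * c).1 ω + (b * c).1 ω
      rw [mul_apply, mul_apply, mul_apply, ← finsum_add_distrib
        (finite_support_conv a.2 c.2 ω) (finite_support_conv b.2 c.2 ω)]
      exact finsum_congr fun u => add_mul _ _ _
    zero_mul := fun a => by
      ext ω
      rw [mul_apply]
      simp
    mul_zero := fun a => by
      ext ω
      rw [mul_apply]
      simp
    mul_assoc := fun a b c => Subtype.ext (cauchy_assoc a.2 b.2 c.2)
    one_mul := fun a => by
      ext ω
      rw [coe_mul, coe_one, monomial_cauchy]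
      simp
    mul_one := fun a => by
      ext ω
      rw [coe_mul, coe_one, cauchy_monomial]
      simp }

instance : Algebra K (mn K X) :=
  Algebra.ofModule
    (fun r a b => by
      ext ω
      change ((r • a) * b).1 ω = r * (a * b).1 ω
      rw [mul_apply, mul_apply, mul_finsum' _ _ (finite_support_conv a.2 b.2 ω)]
      exact finsum_congr fun u => mul_assoc _ _ _)
    (fun r a b => by
      ext ω
      change (a * (r • b)).1 ω = r * (a * b).1 ω
      rw [mul_apply, mul_apply, mul_finsum' _ _ (finite_support_conv a.2 b.2 ω)]
      exact finsum_congr fun u => mul_left_comm _ _ _)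

/-- The monomial `c • w` as a Malcev–Neumann series. -/
def mono (c : K) (w : FreeGroup X) : mn K X := ⟨Ser.monomial c w, isMN_monomial c w⟩

/-! ### Stars of Malcev–Neumann series -/

theorem starDefined_of_pos {a : Ser K X} (ha : a.IsMN) (hpos : ∀ g ∈ support a, 1 < g) :
    a.StarDefined := by
  intro ω
  refine (finite_list_prod (isMN_iff.1 ha) hpos ω).subset ?_
  rintro l ⟨hl, h⟩
  exact ⟨hl, fun x hx h0 => h (List.prod_eq_zero (List.mem_map.2 ⟨x, hx, h0⟩))⟩

theorem isMN_kstar {a : Ser K X} (ha : a.IsMN) (hpos : ∀ g ∈ support a, 1 < g) :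
    a.kstar.IsMN :=
  isMN_mono (pwo_posMonoid.1 ((pwo_of_isMN ha).list_prod isNormal_posMonoid
    fun g hg => (hpos g hg).le)) (support_kstar_subset a)

/-- The equation `a* = 1 + a a*`, obtained by splitting off the empty tuple and the first members of
the others. -/
theorem kstar_apply {a : Ser K X} (ha : a.StarDefined) (ω : FreeGroup X) :
    a.kstar ω = Ser.monomial 1 1 ω + ∑ᶠ u, a u * a.kstar (u⁻¹ * ω) := by
  let g : List (FreeGroup X) → K := fun l => if l.prod = ω then (l.map a).prod else 0
  have hg : (support g).Finite := (ha ω).subset fun l hl => by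
    simp only [g, mem_support, ne_eq, ite_eq_right_iff, Classical.not_imp] at hl
    exact hl
  have hk : ∀ ω, a.kstar ω =
      ∑ᶠ l : List (FreeGroup X), if l.prod = ω then (l.map a).prod else 0 := by
    intro ω
    rw [Ser.kstar]
    refine finsum_congr fun l => ?_
    by_cases h : l.prod = ω <;> simp [h]
  have hfin : (support fun p : FreeGroup X × List (FreeGroup X) => g (p.1 :: p.2)).Finite :=
    Set.Finite.preimage (f := fun p : FreeGroup X × List (FreeGroup X) => p.1 :: p.2)
      (fun p _ q _ h => by
        obtain ⟨h1, h2⟩ := List.cons.inj h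
        exact Prod.ext h1 h2) hg
  have hcompl : ({[]} : Set (List (FreeGroup X)))ᶜ =
      Set.range fun p : FreeGroup X × List (FreeGroup X) => p.1 :: p.2 := by
    ext l
    cases l <;> simp
  have h1 : ∑ᶠ l, g l = g [] + ∑ᶠ p : FreeGroup X × List (FreeGroup X), g (p.1 :: p.2) := by
    rw [← finsum_mem_univ, ← Set.union_compl_self {([] : List (FreeGroup X))},
      finsum_mem_union' disjoint_compl_right (hg.inter_of_right _) (hg.inter_of_right _),
      finsum_mem_singleton, hcompl, finsum_mem_range]
    intro p q h
    obtain ⟨h1, h2⟩ := List.cons.inj h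
    exact Prod.ext h1 h2
  rw [hk ω, show (∑ᶠ l : List (FreeGroup X), if l.prod = ω then (l.map a).prod else 0) = ∑ᶠ l, g l
    from rfl, h1, finsum_curry _ hfin]
  congr 1
  · simp [g, Ser.monomial, eq_comm]
  · refine finsum_congr fun u => ?_
    rw [hk, mul_finsum']
    · refine finsum_congr fun l => ?_
      simp only [g, List.prod_cons, List.map_cons, mul_ite, mul_zero]
      refine if_congr ?_ rfl rfl
      rw [eq_inv_mul_iff_mul_eq]
    · refine (ha (u⁻¹ * ω)).subset fun l hl => ?_
      simp only [mem_support, ne_eq, ite_eq_right_iff, Classical.not_imp] at hl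
      exact hl

/-- If the star of a Malcev–Neumann series is well-defined and a Malcev–Neumann series, then the
support of the series is positive: otherwise its leading term times the leading term of the star
would be a term of the star below the leading one. -/
theorem pos_of_starDefined {a : Ser K X} (ha : a.IsMN) (hs : a.StarDefined) (hk : a.kstar.IsMN) :
    ∀ g ∈ support a, 1 < g := by
  -- repeating a nonempty factorization of `1` would give infinitely many
  have hnil : ∀ l : List (FreeGroup X), l.prod = 1 → (l.map a).prod ≠ 0 → l = [] := by
    intro l hl h
    by_contra hne
    refine Set.infinite_of_injective_forall_mem (f := fun n : ℕ => (List.replicate n l).flatten)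
      (fun m n hmn => ?_) (fun n => ?_) (hs 1)
    · have := congrArg List.length hmn
      have hpos := List.length_pos_of_ne_nil hne
      simpa [hpos.ne'] using this
    · constructor
      · simp [List.prod_flatten, hl]
      · rw [List.map_flatten, List.prod_flatten, List.map_replicate, List.map_replicate,
          List.prod_replicate]
        exact pow_ne_zero _ h
  have hk1 : a.kstar 1 = 1 := by
    rw [Ser.kstar, finsum_mem_inter_support_eq _ _ {[]}]
    · simp
    · ext l
      simp only [Set.mem_inter_iff, Set.mem_ofPred_eq, mem_support, Set.mem_singleton_iff]
      exact ⟨fun h => ⟨hnil l h.1 h.2, h.2⟩, fun h => ⟨by simp [h.1], h.2⟩⟩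
  intro g hg
  by_contra hg1
  rw [not_lt] at hg1
  obtain ⟨m, hm, hmle⟩ := ha (support a) subset_rfl ⟨g, hg⟩
  have hm1 : m ≤ 1 := (hmle hg).trans hg1
  have hm1' : m < 1 := by
    refine lt_of_le_of_ne hm1 ?_
    rintro rfl
    have := hnil [1] (by simp) (by simpa using hm)
    simp at this
  obtain ⟨p, hp, hple⟩ := hk (support a.kstar) subset_rfl ⟨1, by simp [hk1]⟩
  have hp1 : p ≤ 1 := hple (by simp [hk1])
  have hmp : m * p < p := by
    calc m * p < 1 * p := mul_lt_mul_of_lt_of_le hm1' le_rfl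
      _ = p := one_mul p
  -- evaluate `a* = 1 + a a*` at `m p`, where `m` and `p` are the leading elements of `a` and `a*`
  have h0 : a.kstar (m * p) = 0 := by
    by_contra h
    exact absurd (hple h) (not_le.2 hmp)
  have h := kstar_apply hs (m * p)
  rw [h0, finsum_eq_single _ m, inv_mul_cancel_left] at h
  · have : m * p ≠ 1 := (hmp.trans_le hp1).ne
    simp only [Ser.monomial, this, if_false, zero_add] at h
    exact mul_ne_zero hm hp h.symm
  · intro u hu
    by_contra hne
    have h1 : m < u := lt_of_le_of_ne (hmle (left_ne_zero_of_mul hne)) (Ne.symm hu)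
    have h2 : p ≤ u⁻¹ * (m * p) := hple (right_ne_zero_of_mul hne)
    rw [le_inv_mul_iff_mul_le] at h2
    exact absurd (le_of_mul_le_mul_right' h2) (not_le.2 h1)

/-- The equation `e = a e` has only the solution `0` if the support of `a` is positive. -/
theorem eq_zero_of_eq_mul {a e : mn K X} (hpos : ∀ g ∈ support a.1, 1 < g) (h : e = a * e) :
    e = 0 := by
  by_contra hne
  have hne' : (support e.1).Nonempty := by
    rw [support_nonempty_iff]
    exact fun h0 => hne (Subtype.ext h0)
  obtain ⟨m, hm, hmle⟩ := e.2 (support e.1) subset_rfl hne'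
  have h1 : e.1 m = (a * e).1 m := by rw [← h]
  rw [mul_apply] at h1
  rw [mem_support, h1] at hm
  obtain ⟨u, hu⟩ := exists_ne_zero_of_finsum hm
  have h2 : m ≤ u⁻¹ * m := hmle (right_ne_zero_of_mul hu)
  rw [le_inv_mul_iff_mul_le] at h2
  have h3 : u * m > 1 * m := mul_lt_mul_of_lt_of_le (hpos u (left_ne_zero_of_mul hu)) le_rfl
  rw [one_mul] at h3
  exact absurd h2 (not_le.2 h3)

/-- The star of a Malcev–Neumann series with positive support. -/
def starMN (a : mn K X) (hpos : ∀ g ∈ support a.1, 1 < g) : mn K X :=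
  ⟨a.1.kstar, isMN_kstar a.2 hpos⟩

theorem starMN_eq (a : mn K X) (hpos : ∀ g ∈ support a.1, 1 < g) :
    starMN a hpos = 1 + a * starMN a hpos := by
  ext ω
  change a.1.kstar ω = Ser.monomial 1 1 ω + (a * starMN a hpos).1 ω
  rw [mul_apply]
  exact kstar_apply (starDefined_of_pos a.2 hpos) ω

theorem one_sub_mul_starMN (a : mn K X) (hpos : ∀ g ∈ support a.1, 1 < g) :
    (1 - a) * starMN a hpos = 1 := by
  rw [sub_mul, one_mul, sub_eq_iff_eq_add]
  exact starMN_eq a hpos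

theorem starMN_mul_one_sub (a : mn K X) (hpos : ∀ g ∈ support a.1, 1 < g) :
    starMN a hpos * (1 - a) = 1 := by
  rw [← sub_eq_zero]
  refine eq_zero_of_eq_mul hpos ?_
  rw [← sub_eq_zero]
  have := one_sub_mul_starMN a hpos
  calc starMN a hpos * (1 - a) - 1 - a * (starMN a hpos * (1 - a) - 1)
      = ((1 - a) * starMN a hpos) * (1 - a) - (1 - a) := by noncomm_ring
    _ = 0 := by rw [this]; simp

end Ring

/-! ### Finite rank commutators -/

section Words

variable {X : Type*} [DecidableEq X]

theorem nc_letter_letter {y z : X × Bool} : NC (letter z) (letter y) ↔ z ≠ bar y := by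
  constructor
  · rintro h rfl
    simp [NC, letter_bar, norm_letter] at h
  · intro h
    by_contra hn
    obtain ⟨g, hg, h'⟩ := isReduced_cons_of_not_nc hn
    have h2 : NC (letter y) 1 := nc_one_right _
    have := (first_unique (by simpa using hg) h2 h').1
    exact h (by rw [this, bar_bar])

theorem nc_letter_mul_iff {y z : X × Bool} {g : FreeGroup X} (h : NC (letter y) g) :
    NC (letter z) (letter y * g) ↔ z ≠ bar y := by
  rw [← nc_letter_letter]
  refine ⟨fun h' => h'.of_mul_right h, fun h' => NC.assoc ?_ h'⟩
  have := nc_overlap h' h (letter_ne_one y)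
  rw [NC, this, h']

/-- A factor on the right which is not longer than `g` leaves the first letter of `y g`
untouched. -/
theorem nc_letter_mul_of_norm_le {y : X × Bool} {g : FreeGroup X} (h : NC (letter y) g)
    (k : FreeGroup X) (hk : k.norm ≤ g.norm) : NC (letter y) (g * k) := by
  obtain ⟨k, rfl⟩ : ∃ k', k = k'⁻¹ := ⟨k⁻¹, by simp⟩
  rw [FreeGroup.norm_inv_eq] at hk
  induction k using letter_induction with
  | one => simpa using h
  | mul z k hz ih =>
    rw [hz, norm_letter] at hk
    have ih := ih (by omega)
    have hne : g * k⁻¹ ≠ 1 := by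
      intro h1
      have h2 : g = k := by rwa [mul_inv_eq_one] at h1
      rw [h2] at hk
      omega
    rw [mul_inv_rev, ← mul_assoc]
    by_cases hc : NC (letter z) (g * k⁻¹)⁻¹
    · have h2 := nc_overlap ih (by simpa using hc.inv) hne
      have h3 := ih
      have h4 : NC (letter y * (g * k⁻¹)) (letter z)⁻¹ := by rw [NC, h2, ih]
      exact h4.assoc ih
    · have h2 := not_nc_iff.1 hc
      have h3 := h2.inv
      rw [letter_bar] at h3
      simp only [mul_inv_rev, inv_inv] at h3
      refine NC.of_mul_right (γ := letter z) ?_ h3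
      simpa [mul_assoc] using ih

theorem nc_letter_mul_right_iff {z : X × Bool} {g : FreeGroup X} (k : FreeGroup X)
    (hk : k.norm < g.norm) : NC (letter z) (g * k) ↔ NC (letter z) g := by
  have hg : g ≠ 1 := by
    rintro rfl
    simp at hk
  obtain ⟨y, g', rfl, h⟩ := exists_first hg
  rw [h, norm_letter] at hk
  rw [mul_assoc, nc_letter_mul_iff h,
    nc_letter_mul_iff (nc_letter_mul_of_norm_le h k (by omega))]

theorem nc_mul_letter_iff {g w : FreeGroup X} {z : X × Bool} (h : NC g (letter z)) :
    NC (g * letter z) w ↔ NC (letter z) w := by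
  refine ⟨fun h' => h'.of_mul_left h, fun h' => ?_⟩
  have := nc_overlap h h' (letter_ne_one z)
  rw [NC, this, h]

theorem exists_last {g : FreeGroup X} (h : g ≠ 1) :
    ∃ g' y, g = g' * letter y ∧ NC g' (letter y) := by
  obtain ⟨y, g', e, h'⟩ := exists_first (inv_ne_one.2 h)
  refine ⟨g'⁻¹, bar y, ?_, ?_⟩
  · rw [letter_bar, ← mul_inv_rev, ← e, inv_inv]
  · rw [letter_bar]
    exact h'.inv

end Words

section FinRank

variable {K V : Type*} [Field K] [AddCommGroup V] [Module K V]

/-- The endomorphism `T` has finite rank. -/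
def FinRank (T : Module.End K V) : Prop := Module.Finite K (LinearMap.range T)

theorem FinRank.add {S T : Module.End K V} (hS : FinRank S) (hT : FinRank T) :
    FinRank (S + T) := by
  have : Module.Finite K ↥(LinearMap.range S ⊔ LinearMap.range T) := by
    unfold FinRank at hS hT
    infer_instance
  refine Submodule.finiteDimensional_of_le (S₂ := LinearMap.range S ⊔ LinearMap.range T) ?_
  rintro _ ⟨x, rfl⟩
  exact Submodule.add_mem_sup ⟨x, rfl⟩ ⟨x, rfl⟩

theorem FinRank.mul_right {S : Module.End K V} (hS : FinRank S) (T : Module.End K V) :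
    FinRank (S * T) := by
  have : Module.Finite K ↥(LinearMap.range S) := hS
  refine Submodule.finiteDimensional_of_le (S₂ := LinearMap.range S) ?_
  rintro _ ⟨x, rfl⟩
  exact ⟨T x, rfl⟩

theorem FinRank.mul_left {S : Module.End K V} (hS : FinRank S) (T : Module.End K V) :
    FinRank (T * S) := by
  have : Module.Finite K ↥(LinearMap.range S) := hS
  refine Submodule.finiteDimensional_of_le (S₂ := (LinearMap.range S).map T) ?_
  rintro _ ⟨x, rfl⟩
  exact ⟨S x, ⟨x, rfl⟩, rfl⟩

theorem FinRank.sub_swap {S T : Module.End K V} (h : FinRank (S - T)) : FinRank (T - S) := by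
  unfold FinRank at *
  rwa [← neg_sub, LinearMap.range_neg]

end FinRank

section Commutator

variable {K X : Type*} [Field K] [DecidableEq X]

/-- The reduced left derivative of a series with respect to a group element: the coefficient at
`w` is that of `g w` if this product is free of cancellation, and `0` otherwise. -/
def deriv (g : FreeGroup X) (f : Ser K X) : Ser K X :=
  fun w => if NC g w then f (g * w) else 0

variable [LinearOrder (FreeGroup X)] [MulLeftMono (FreeGroup X)] [MulRightMono (FreeGroup X)]

/-- The projection onto the series supported by the elements whose reduced word does not begin
with the inverse of the letter `z`. -/
def proj (z : X × Bool) : Module.End K (mn K X) :=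
  { toFun := fun f => ⟨fun g => if NC (letter z) g then f.1 g else 0,
      isMN_mono (isMN_iff.1 f.2) fun g hg h0 => hg (by simp [h0])⟩
    map_add' := fun f f' => by
      ext g
      change (if NC (letter z) g then f.1 g + f'.1 g else 0) = ite _ _ _ + ite _ _ _
      split_ifs <;> simp
    map_smul' := fun c f => by
      ext g
      change (if NC (letter z) g then c * f.1 g else 0) = c * ite _ _ _
      split_ifs <;> simp }

theorem proj_apply_of_nc {z : X × Bool} (f : mn K X) {g : FreeGroup X} (h : NC (letter z) g) :
    (proj z f).1 g = f.1 g := if_pos h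

theorem proj_apply_of_not_nc {z : X × Bool} (f : mn K X) {g : FreeGroup X}
    (h : ¬ NC (letter z) g) : (proj z f).1 g = 0 := if_neg h

/-- Right multiplication as an endomorphism. -/
abbrev rmul (c : mn K X) : Module.End K (mn K X) := LinearMap.mulRight K c

/-- All commutators of right multiplication by `c` with the projections `proj z` have finite
rank. This algebraic form of the finite dimension of the space of derivatives is visibly stable
under the ring operations and under inversion. -/
def FinComm (c : mn K X) : Prop :=
  ∀ z, FinRank (proj z * rmul c - rmul c * proj z)

theorem rmul_mul (a b : mn K X) : rmul (a * b) = rmul b * rmul a := by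
  ext1 f
  exact (mul_assoc f a b).symm

theorem FinComm.add {a b : mn K X} (ha : FinComm a) (hb : FinComm b) : FinComm (a + b) := by
  intro z
  have : rmul (a + b) = rmul a + rmul b := by
    ext1 f
    exact mul_add f a b
  rw [this]
  convert (ha z).add (hb z) using 1
  noncomm_ring

theorem FinComm.mul {a b : mn K X} (ha : FinComm a) (hb : FinComm b) : FinComm (a * b) := by
  intro z
  rw [rmul_mul]
  convert ((hb z).mul_right (rmul a)).add ((ha z).mul_left (rmul b)) using 1
  simp only [mul_sub, sub_mul, mul_assoc]
  abel

theorem FinComm.inv {a b : mn K X} (ha : FinComm a) (hab : a * b = 1) (hba : b * a = 1) :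
    FinComm b := by
  intro z
  have h1 : rmul a * rmul b = 1 := by
    rw [← rmul_mul, hba]
    ext1 f
    exact mul_one f
  have h2 : rmul b * rmul a = 1 := by
    rw [← rmul_mul, hab]
    ext1 f
    exact mul_one f
  convert ((ha z).sub_swap.mul_left (rmul b)).mul_right (rmul b) using 1
  calc proj z * rmul b - rmul b * proj z
      = (rmul b * rmul a) * proj z * rmul b - rmul b * proj z * (rmul a * rmul b) := by
        rw [h1, h2, one_mul, mul_one]
    _ = _ := by
      simp only [mul_sub, sub_mul, mul_assoc]

theorem finRank_of_support {T : Module.End K (mn K X)} {S : Set (FreeGroup X)} (hS : S.Finite)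
    (h : ∀ f, support (T f).1 ⊆ S) : FinRank T := by
  have : Finite S := hS
  let φ : LinearMap.range T →ₗ[K] (S → K) :=
    { toFun := fun f s => f.1.1 s
      map_add' := fun _ _ => rfl
      map_smul' := fun _ _ => rfl }
  refine Module.Finite.of_injective φ ?_
  rintro ⟨_, f, rfl⟩ ⟨_, f', rfl⟩ he
  refine Subtype.ext (Subtype.ext (funext fun g => ?_))
  by_cases hg : g ∈ S
  · exact congrFun he ⟨g, hg⟩
  · rw [notMem_support.1 fun hh => hg (h f hh), notMem_support.1 fun hh => hg (h f' hh)]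

/-- Right multiplication by an element `w` preserves the first letter of a word unless the resulting
word is at most as long as `w`; so the values of the commutators have support in a finite set. -/
theorem finComm_mono [Finite X] (c : K) (w : FreeGroup X) : FinComm (mono c w) := by
  intro z
  refine finRank_of_support (finite_norm_le w.norm) fun f g hg => ?_
  by_contra hn
  simp only [Set.mem_ofPred_eq, not_le] at hn
  apply hg
  have e : ∀ f : mn K X, (f * mono c w).1 g = f.1 (g * w⁻¹) * c := fun f => by
    rw [coe_mul]
    exact cauchy_monomial f.1 c w g
  change (proj z (f * mono c w)).1 g - (proj z f * mono c w).1 g = 0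
  have hiff := nc_letter_mul_right_iff (z := z) w⁻¹ (by simpa using hn)
  rw [e]
  by_cases h : NC (letter z) g
  · rw [proj_apply_of_nc _ h, proj_apply_of_nc _ (hiff.2 h), e, sub_self]
  · rw [proj_apply_of_not_nc _ h, proj_apply_of_not_nc _ (fun h' => h (hiff.1 h')), zero_mul,
      sub_self]

theorem finComm_starMN [Finite X] {a : mn K X} (hpos : ∀ g ∈ support a.1, 1 < g)
    (ha : FinComm a) : FinComm (starMN a hpos) := by
  have h1 : FinComm (1 - a) := by
    have : (1 : mn K X) - a = mono 1 1 + mono (-1) 1 * a := by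
      have : mono (-1) 1 = (-1 : mn K X) := by
        ext g
        change Ser.monomial (-1 : K) 1 g = -(Ser.monomial 1 1 g)
        simp only [Ser.monomial]
        split_ifs <;> simp
      rw [this, neg_one_mul, sub_eq_add_neg]
      rfl
    rw [this]
    exact (finComm_mono 1 1).add ((finComm_mono (-1) 1).mul ha)
  exact h1.inv (one_sub_mul_starMN a hpos) (starMN_mul_one_sub a hpos)

/-- A derivative of `c` with respect to a nontrivial element is a value of a commutator: the
monomial `(g z)⁻¹` begins with the inverse of `z` and is therefore annihilated by the projection. -/
theorem deriv_eq_commutator (c : mn K X) {g : FreeGroup X} {z : X × Bool}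
    (h : NC g (letter z)) :
    deriv (g * letter z) c.1 =
      ((proj z * rmul c - rmul c * proj z : Module.End K (mn K X))
        (mono 1 (g * letter z)⁻¹)).1 := by
  have h1 : proj z (mono (K := K) 1 (g * letter z)⁻¹) = 0 := by
    ext w
    by_cases hw : NC (letter z) w
    · rw [proj_apply_of_nc _ hw]
      refine if_neg ?_
      rintro rfl
      have h3 : (letter z * (g * letter z)⁻¹).norm = g.norm := by simp
      have h4 : (g * letter z).norm = g.norm + (letter z).norm := h
      rw [NC, h3, FreeGroup.norm_inv_eq, h4, norm_letter] at hw
      omega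
    · rw [proj_apply_of_not_nc _ hw]
      rfl
  funext w
  change _ = (proj z (mono 1 (g * letter z)⁻¹ * c)).1 w -
    (proj z (mono 1 (g * letter z)⁻¹) * c).1 w
  rw [h1, zero_mul]
  change _ = _ - (0 : K)
  rw [sub_zero, deriv]
  by_cases hw : NC (letter z) w
  · rw [if_pos ((nc_mul_letter_iff h).2 hw), proj_apply_of_nc _ hw, coe_mul]
    have := monomial_cauchy (1 : K) (g * letter z)⁻¹ c.1 w
    rw [inv_inv, one_mul] at this
    exact this.symm
  · rw [if_neg fun h' => hw ((nc_mul_letter_iff h).1 h'), proj_apply_of_not_nc _ hw]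

theorem finite_span_deriv [Finite X] {c : mn K X} (hc : FinComm c) :
    Module.Finite K (Submodule.span K (Set.range fun g => deriv g c.1)) := by
  let W : Submodule K (Ser K X) := Submodule.span K {c.1} ⊔
    ⨆ z, (LinearMap.range (proj z * rmul c - rmul c * proj z : Module.End K (mn K X))).map
      (mn K X).subtype
  have hW : Module.Finite K W := by
    have : ∀ z, Module.Finite K ((LinearMap.range
        (proj z * rmul c - rmul c * proj z : Module.End K (mn K X))).map
        (mn K X).subtype) := fun z => by
      have := hc z
      unfold FinRank at this
      infer_instance
    infer_instance
  refine Submodule.finiteDimensional_of_le (S₂ := W) (Submodule.span_le.2 ?_)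
  rintro _ ⟨g, rfl⟩
  by_cases hg : g = 1
  · refine Submodule.mem_sup_left ?_
    subst hg
    have : deriv 1 c.1 = c.1 := by
      funext w
      rw [deriv, if_pos (nc_one_left w), one_mul]
    dsimp only
    rw [this]
    exact Submodule.mem_span_singleton_self _
  · obtain ⟨g', z, rfl, h⟩ := exists_last hg
    refine Submodule.mem_sup_right (Submodule.mem_iSup_of_mem z ?_)
    dsimp only
    rw [deriv_eq_commutator c h]
    exact ⟨_, ⟨_, rfl⟩, rfl⟩

end Commutator

/-! ### Automata on reduced words -/

/-- A weighted automaton whose states are labelled by letters: a transition from `i` to `j` reads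
the label of `j` and has weight `M i j`. A state labelled `none` cannot be entered. The weight for
stopping in the state `i` is `γ i`. -/
structure Aut (K X S : Type*) where
  /-- The letter read when entering a state. -/
  lab : S → Option (X × Bool)
  /-- The transition weights. -/
  M : S → S → K
  /-- The final weights. -/
  γ : S → K

namespace Aut

variable {K X S : Type*} [Field K] [DecidableEq X] [Fintype S]

/-- The weight of a word read from the state `i`. -/
def ev (A : Aut K X S) : List (X × Bool) → S → K
  | [], i => A.γ i
  | y :: w, i => ∑ j, if A.lab j = some y then A.M i j * ev A w j else 0

/-- The series of a state: the weights of the reduced words read from it. -/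
def ser (A : Aut K X S) (i : S) : Ser K X := fun g => A.ev g.toWord i

/-- All words along the paths of the automaton are reduced. -/
def Typed (A : Aut K X S) : Prop :=
  ∀ i j, A.M i j ≠ 0 → ∃ y, A.lab j = some y ∧ A.lab i ≠ some (bar y)

/-- A system of potentials for the automaton, relative to a submonoid of positive elements: a
nonempty finite set `P i` of group elements for each state `i`, such that each transition from `i`
to `j` with label `y` maps each element of `P j` above some element of `P i`. -/
def Pot (N : Submonoid (FreeGroup X)) (A : Aut K X S) (P : S → Finset (FreeGroup X)) : Prop :=
  (∀ i, (P i).Nonempty) ∧ ∀ i j y, A.M i j ≠ 0 → A.lab j = some y →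
    ∀ q ∈ P j, ∃ p ∈ P i, rel N p (letter y * q)

theorem ser_one (A : Aut K X S) (i : S) : A.ser i 1 = A.γ i := by
  simp [ser, ev]

theorem ser_letter_mul (A : Aut K X S) (i : S) {y : X × Bool} {g : FreeGroup X}
    (h : NC (letter y) g) :
    A.ser i (letter y * g) = ∑ j, if A.lab j = some y then A.M i j * A.ser j g else 0 := by
  rw [ser, toWord_mul_of_nc h, toWord_letter]
  rfl

theorem ser_unique (A : Aut K X S) {f : S → Ser K X} (h1 : ∀ i, f i 1 = A.γ i)
    (h2 : ∀ i y g, NC (letter y) g →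
      f i (letter y * g) = ∑ j, if A.lab j = some y then A.M i j * f j g else 0) :
    f = A.ser := by
  have : ∀ g i, f i g = A.ser i g := by
    intro g
    induction g using letter_induction with
    | one => intro i; rw [h1, ser_one]
    | mul y g h ih =>
      intro i
      rw [h2 i y g h, ser_letter_mul A i h]
      simp only [ih]
  funext i g
  exact this g i

theorem Pot.mono {N N' : Submonoid (FreeGroup X)} {A : Aut K X S}
    {P : S → Finset (FreeGroup X)} (h : Pot N A P) (hN : N ≤ N') : Pot N' A P :=
  ⟨h.1, fun i j y hM hy q hq => by
    obtain ⟨p, hp, hr⟩ := h.2 i j y hM hy q hq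
    exact ⟨p, hp, hN hr⟩⟩

/-- Renaming the states. -/
def reindex {S' : Type*} (A : Aut K X S) (e : S' ≃ S) : Aut K X S' where
  lab := A.lab ∘ e
  M i j := A.M (e i) (e j)
  γ := A.γ ∘ e

theorem ser_reindex {S' : Type*} [Fintype S'] (A : Aut K X S) (e : S' ≃ S) (i : S') :
    (A.reindex e).ser i = A.ser (e i) := by
  refine (congrFun (ser_unique (A.reindex e) (f := fun i => A.ser (e i)) (fun i => ?_)
    fun i y g h => ?_) i).symm
  · exact ser_one A (e i)
  · rw [ser_letter_mul A _ h, ← Equiv.sum_comp e]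
    rfl

end Aut

/-! ### Automata from finite-dimensional spaces of series -/

section Construction

variable {K X : Type*} [Field K] [DecidableEq X]

theorem deriv_letter_apply (y : X × Bool) (f : Ser K X) (g : FreeGroup X) :
    deriv (letter y) f g = if NC (letter y) g then f (letter y * g) else 0 := rfl

/-- Sets closed upwards for the preorder `rel N`. -/
def IsUp (N : Submonoid (FreeGroup X)) (T : Set (FreeGroup X)) : Prop :=
  ∀ u ∈ T, ∀ v, rel N u v → v ∈ T

variable {V : Submodule K (Ser K X)}

/-- The series in `V` which are supported in `T` and by elements that can be read after the
letter `y`. -/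
def subAt (V : Submodule K (Ser K X)) (y : X × Bool) (T : Set (FreeGroup X)) :
    Submodule K V where
  carrier := {f | ∀ g, f.1 g ≠ 0 → NC (letter y) g ∧ g ∈ T}
  zero_mem' := fun g hg => absurd rfl hg
  add_mem' {a b} ha hb g hg := by
    by_cases h : a.1 g = 0
    · refine hb g fun h' => hg ?_
      change a.1 g + b.1 g = 0
      rw [h, h', add_zero]
    · exact ha g h
  smul_mem' c a ha g hg := ha g fun h => hg (by
    change c * a.1 g = 0
    rw [h, mul_zero])

/-- The elements of the supports of the series in a space. -/
def supp (U : Submodule K V) : Set (FreeGroup X) := {u | ∃ f ∈ U, (f : V).1 u ≠ 0}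

/-- The upward closure of the supports of the series in a space. -/
def upper (N : Submonoid (FreeGroup X)) (U : Submodule K V) : Set (FreeGroup X) :=
  {v | ∃ u ∈ supp U, rel N u v}

theorem isUp_upper (N : Submonoid (FreeGroup X)) (U : Submodule K V) : IsUp N (upper N U) :=
  fun _ ⟨w, hw, hr⟩ _ h => ⟨w, hw, rel_trans hr h⟩

theorem coe_sum_apply {ι : Type*} (s : Finset ι) (f : ι → V) (u : FreeGroup X) :
    (∑ i ∈ s, f i : V).1 u = ∑ i ∈ s, (f i).1 u :=
  map_sum (⟨⟨fun f : V => f.1 u, rfl⟩, fun _ _ => rfl⟩ : V →+ K) f s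

theorem pwo_supp [Module.Finite K V] {N : Submonoid (FreeGroup X)}
    (hP : ∀ f ∈ V, PWO N (support f)) (U : Submodule K V) : PWO N (supp U) := by
  let b := Module.finBasis K V
  have h : PWO N (⋃ i ∈ (Finset.univ : Finset (Fin (Module.finrank K V))), support (b i).1) :=
    (Set.PartiallyWellOrderedOn.mono
      ((Finset.partiallyWellOrderedOn_bUnion Finset.univ).2 fun i _ => hP _ (b i).2) subset_rfl)
  refine h.mono ?_
  rintro u ⟨f, -, hf⟩
  by_contra hu
  apply hf
  have hu : ∀ i, (b i).1 u = 0 := by simpa using hu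
  have h1 := b.sum_repr f
  have h2 : f.1 u = ∑ i, b.repr f i * (b i).1 u := by
    conv_lhs => rw [← h1]
    rw [coe_sum_apply]
    rfl
  rw [h2]
  exact Finset.sum_eq_zero fun i _ => by rw [hu, mul_zero]

/-- The series in `V` which can be read after `y` and vanish below all members of a list. -/
def vanishing (N : Submonoid (FreeGroup X)) (V : Submodule K (Ser K X)) (y : X × Bool)
    (l : List (FreeGroup X)) : Submodule K V :=
  subAt V y {g | ∀ x ∈ l, ¬ rel N g x}

theorem vanishing_anti {N : Submonoid (FreeGroup X)} {y : X × Bool} {l l' : List (FreeGroup X)}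
    (h : List.SublistForall₂ (rel N) l l') : vanishing N V y l' ≤ vanishing N V y l := by
  intro f hf g hg
  refine ⟨(hf g hg).1, fun x hx hr => ?_⟩
  have : ∃ x' ∈ l', rel N x x' := by
    clear hf
    induction h with
    | nil => simp at hx
    | cons hab _ ih =>
      rcases List.mem_cons.1 hx with rfl | hx
      · exact ⟨_, List.mem_cons_self, hab⟩
      · obtain ⟨x', hx', h'⟩ := ih hx
        exact ⟨x', List.mem_cons_of_mem _ hx', h'⟩
    | cons_right _ ih =>
      obtain ⟨x', hx', h'⟩ := ih hx
      exact ⟨x', List.mem_cons_of_mem _ hx', h'⟩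
  obtain ⟨x', hx', h'⟩ := this
  exact (hf g hg).2 x' hx' (rel_trans hr h')

/-- Among the spaces of series vanishing below finitely many elements outside of `T`, a minimal one
is the space cut out by `T`. -/
theorem exists_list_vanishing [Module.Finite K V] {N : Submonoid (FreeGroup X)} {y : X × Bool}
    {T : Set (FreeGroup X)} (hT : IsUp N T) :
    ∃ l : List (FreeGroup X), (∀ x ∈ l, x ∈ supp (⊤ : Submodule K V)) ∧
      subAt V y T = vanishing N V y l := by
  let 𝒮 : Set (Submodule K V) := {U | ∃ l : List (FreeGroup X),
    (∀ x ∈ l, x ∈ supp (⊤ : Submodule K V) ∧ x ∉ T) ∧ U = vanishing N V y l}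
  have hne : 𝒮.Nonempty := ⟨_, [], by simp, rfl⟩
  obtain ⟨U, ⟨l, hl, rfl⟩, hmin⟩ := WellFounded.has_min
    (wellFounded_lt (α := Submodule K V)) 𝒮 hne
  refine ⟨l, fun x hx => (hl x hx).1, le_antisymm ?_ ?_⟩
  · intro f hf g hg
    exact ⟨(hf g hg).1, fun x hx hr => (hl x hx).2 (hT g (hf g hg).2 x hr)⟩
  · intro f hf g hg
    refine ⟨(hf g hg).1, ?_⟩
    by_contra hgT
    have hle : vanishing N V y (g :: l) ≤ vanishing N V y l := by
      intro f hf u hu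
      exact ⟨(hf u hu).1, fun x hx => (hf u hu).2 x (List.mem_cons_of_mem _ hx)⟩
    have hnlt := hmin (vanishing N V y (g :: l)) ⟨g :: l, by
      intro x hx
      rcases List.mem_cons.1 hx with rfl | hx
      · exact ⟨⟨f, trivial, hg⟩, hgT⟩
      · exact hl x hx, rfl⟩
    have heq := hle.eq_of_not_lt hnlt
    rw [← heq] at hf
    exact (hf g hg).2 g List.mem_cons_self (rel_refl g)

/-- Only finitely many subspaces of `V` are cut out by upward closed sets. Such a subspace is
determined by finitely many elements below which its members vanish, and by Higman's lemma
infinitely many of them would contain an infinite descending chain. -/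
theorem finite_subAt [Module.Finite K V] {N : Submonoid (FreeGroup X)}
    (hP : ∀ f ∈ V, PWO N (support f)) (y : X × Bool) :
    {U : Submodule K V | ∃ T, IsUp N T ∧ U = subAt V y T}.Finite := by
  by_contra hinf
  have hinf : {U : Submodule K V | ∃ T, IsUp N T ∧ U = subAt V y T}.Infinite := hinf
  let u := hinf.natEmbedding
  have hl : ∀ n, ∃ l : List (FreeGroup X), (∀ x ∈ l, x ∈ supp (⊤ : Submodule K V)) ∧
      (u n : Submodule K V) = vanishing N V y l := by
    intro n
    obtain ⟨T, hT, he⟩ := (u n).2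
    rw [he]
    exact exists_list_vanishing hT
  choose l hl hul using hl
  have hH := Set.PartiallyWellOrderedOn.partiallyWellOrderedOn_sublistForall₂ (rel N)
    (pwo_supp hP (⊤ : Submodule K V))
  have : IsPreorder (List (FreeGroup X)) (List.SublistForall₂ (rel N)) :=
    { refl := fun l => List.SublistForall₂.is_refl.refl l
      trans := fun _ _ _ h h' => List.SublistForall₂.is_trans.trans _ _ _ h h' }
  obtain ⟨g, hg⟩ := hH.exists_monotone_subseq (f := l) hl
  let F : ℕ →o (Submodule K V)ᵒᵈ :=
    ⟨fun n => OrderDual.toDual (u (g n) : Submodule K V), fun m n hmn => by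
      change (u (g n) : Submodule K V) ≤ u (g m)
      rw [hul, hul]
      exact vanishing_anti (hg m n hmn)⟩
  obtain ⟨n, hn⟩ := IsArtinian.monotone_stabilizes F
  have h1 : (u (g n) : Submodule K V) = u (g (n + 1)) := hn (n + 1) (Nat.le_succ n)
  have h2 := g.injective (u.injective (Subtype.ext h1))
  omega

/-- A finite-dimensional space of series that is stable under derivation and whose members have
supports partially well-ordered by `rel N` yields an automaton with potentials relative to `N` for
each of its members. The states are bases of the finitely many subspaces cut out by upward closed
sets, and the potentials of such a subspace are the minimal elements of its supports. -/
theorem exists_aut_of_finite [Finite X] [Module.Finite K V] {N : Submonoid (FreeGroup X)}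
    (hP : ∀ f ∈ V, PWO N (support f)) (hV : ∀ y, ∀ f ∈ V, deriv (letter y) f ∈ V)
    {c : Ser K X} (hc : c ∈ V) :
    ∃ (n : ℕ) (A : Aut K X (Fin n)) (P : Fin n → Finset (FreeGroup X)) (i : Fin n),
      A.Typed ∧ A.Pot N P ∧ A.lab i = none ∧ A.ser i = c := by
  classical
  let 𝒲 : Set ((X × Bool) × Submodule K V) := {p | ∃ T, IsUp N T ∧ p.2 = subAt V p.1 T}
  have h𝒲 : Finite 𝒲 := by
    have : 𝒲 = ⋃ y, (fun U => (y, U)) '' {U | ∃ T, IsUp N T ∧ U = subAt V y T} := by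
      ext ⟨y, U⟩
      simp [𝒲]
    rw [this]
    exact Set.finite_iUnion fun y => (finite_subAt hP y).image _
  have := Fintype.ofFinite 𝒲
  let B : ∀ U : Submodule K V, Module.Basis (Fin (Module.finrank K U)) K U :=
    fun U => by
      have : Module.Free K U := Module.Free.of_divisionRing K U
      exact Module.finBasis K U
  -- the state `none` is the initial one, with the series `c`; `sp s`, `el s` and `lab s` are the
  -- space, the series and the label of the state `s`
  let S := Option (Σ p : 𝒲, Fin (Module.finrank K p.1.2))
  let sp : S → Submodule K V := fun s => s.elim (Submodule.span K {⟨c, hc⟩}) fun s => s.1.1.2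
  let el : S → V := fun s => s.elim ⟨c, hc⟩ fun s => (B s.1.1.2 s.2 : V)
  let lab : S → Option (X × Bool) := fun s => s.elim none fun s => some s.1.1.1
  have hel : ∀ s, el s ∈ sp s := by
    rintro (_ | s)
    · exact Submodule.mem_span_singleton_self _
    · exact (B s.1.1.2 s.2).2
  have helT : ∀ s g, (el s).1 g ≠ 0 → g ∈ upper N (sp s) := fun s g hg =>
    ⟨g, ⟨el s, hel s, hg⟩, rel_refl g⟩
  -- the subspace cut out by the places where the upward closure of the supports of the series in
  -- `sp s` allows nonzero coefficients of the derivatives of these series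
  let target : S → X × Bool → 𝒲 := fun s z =>
    ⟨(z, subAt V z {g | letter z * g ∈ upper N (sp s)}), {g | letter z * g ∈ upper N (sp s)},
      fun u hu v hr => isUp_upper N _ _ hu _ ((rel_mul_left _).2 hr), rfl⟩
  let dv : S → X × Bool → V := fun s z => ⟨deriv (letter z) (el s).1, hV z _ (el s).2⟩
  have hdv : ∀ s z, dv s z ∈ (target s z).1.2 := by
    intro s z g hg
    change deriv (letter z) (el s).1 g ≠ 0 at hg
    rw [deriv_letter_apply] at hg
    by_cases h : NC (letter z) g
    · rw [if_pos h] at hg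
      exact ⟨h, helT s _ hg⟩
    · rw [if_neg h] at hg
      exact absurd rfl hg
  let M : S → S → K := fun s t => t.elim 0 fun t =>
    if h : t.1 = target s t.1.1.1 ∧ dv s t.1.1.1 ∈ t.1.1.2 then
      (B t.1.1.2).repr ⟨dv s t.1.1.1, h.2⟩ t.2 else 0
  let A : Aut K X S := ⟨lab, M, fun s => (el s).1 1⟩
  have hser : (fun s => (el s).1) = A.ser := by
    refine A.ser_unique (fun _ => rfl) fun s z g hzg => ?_
    rw [Fintype.sum_option, Fintype.sum_sigma]
    have h0 : (if A.lab none = some z then A.M s none * (el none).1 g else 0) = 0 := if_neg (by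
      change ¬ (none = some z)
      simp)
    rw [h0, zero_add, Finset.sum_eq_single (target s z)]
    · have h1 : (el s).1 (letter z * g) = (dv s z).1 g := by
        change _ = deriv (letter z) (el s).1 g
        rw [deriv_letter_apply, if_pos hzg]
      have h2 := (B (target s z).1.2).sum_repr ⟨dv s z, hdv s z⟩
      have h3 : (dv s z).1 g = ∑ k, (B (target s z).1.2).repr ⟨dv s z, hdv s z⟩ k *
          ((B (target s z).1.2 k : V) : Ser K X) g := by
        have := congrArg (fun f : (target s z).1.2 => (f : V).1 g) h2
        dsimp only at this
        rw [← this, AddSubmonoidClass.coe_finsetSum, coe_sum_apply]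
        rfl
      rw [h1, h3]
      refine Finset.sum_congr rfl fun k _ => ?_
      rw [if_pos (show A.lab (some ⟨target s z, k⟩) = some z from rfl)]
      congr 1
      change _ = dite _ _ _
      rw [dif_pos ⟨rfl, hdv s z⟩]
    · intro p _ hp
      refine Finset.sum_eq_zero fun k _ => ?_
      split_ifs with h
      · have hz : p.1.1 = z := by simpa [A, lab] using h
        have : A.M s (some ⟨p, k⟩) = 0 := by
          change dite _ _ _ = _
          rw [dif_neg]
          rintro ⟨h1, -⟩
          exact hp (by rw [← hz]; exact h1)
        rw [this, zero_mul]
      · rfl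
    · intro h
      exact absurd (Finset.mem_univ _) h
  have hMne : ∀ s t, A.M s t ≠ 0 → ∃ p : 𝒲, ∃ k, t = some ⟨p, k⟩ ∧ p = target s p.1.1 ∧
      dv s p.1.1 ≠ 0 := by
    rintro s (_ | ⟨p, k⟩) h
    · exact absurd rfl h
    · refine ⟨p, k, rfl, ?_⟩
      change dite _ _ _ ≠ _ at h
      split_ifs at h with h'
      refine ⟨h'.1, fun h0 => h ?_⟩
      have : (⟨dv s p.1.1, h'.2⟩ : p.1.2) = 0 := Subtype.ext h0
      rw [this]
      simp
      exact absurd rfl h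
  have htyped : A.Typed := by
    intro s t h
    obtain ⟨p, k, rfl, hp, hd⟩ := hMne s t h
    refine ⟨p.1.1, rfl, fun hs => hd ?_⟩
    rcases s with _ | s
    · exact absurd hs (by
        change ¬ (none = some _)
        simp)
    · have hs : s.1.1.1 = bar p.1.1 := by simpa [A, lab] using hs
      refine Subtype.ext (funext fun g => ?_)
      change deriv (letter p.1.1) (el (some s)).1 g = 0
      rw [deriv_letter_apply]
      split_ifs with hn
      · by_contra hne
        obtain ⟨T, -, hT⟩ := s.1.2
        have h1 : el (some s) ∈ subAt V s.1.1.1 T := hT ▸ hel (some s)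
        have h2 := (h1 _ hne).1
        rw [hs] at h2
        exact not_nc_iff.2 h2 hn
      · rfl
  have hgen : ∀ s, ∃ t : Finset (FreeGroup X), ↑t ⊆ supp (sp s) ∧
      ∀ g ∈ supp (sp s), ∃ p ∈ t, rel N p g := fun s => (pwo_supp hP (sp s)).exists_finite
  choose Q hQs hQ using hgen
  -- `Q s` is empty only if the space of `s` is zero; then no transition leads to `s`
  let P : S → Finset (FreeGroup X) := fun s => if (Q s).Nonempty then Q s else {1}
  have hPot : A.Pot N P := by
    refine ⟨fun s => ?_, fun s t y hM hy q hq => ?_⟩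
    · by_cases h : (Q s).Nonempty
      · simp [P, h]
      · simp [P, h]
    · obtain ⟨p, k, rfl, hp, hd⟩ := hMne s t hM
      have hy : p.1.1 = y := by simpa [A, lab] using hy
      have hne : (Q (some ⟨p, k⟩)).Nonempty := by
        have : el (some ⟨p, k⟩) ≠ 0 := fun h0 =>
          (B p.1.2).ne_zero k (Subtype.ext h0)
        have : ∃ g, (el (some ⟨p, k⟩)).1 g ≠ 0 := by
          by_contra hcon
          push Not at hcon
          exact this (Subtype.ext (funext hcon))
        obtain ⟨g, hg⟩ := this
        obtain ⟨r, hr, -⟩ := hQ (some ⟨p, k⟩) g ⟨_, hel _, hg⟩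
        exact ⟨r, hr⟩
      simp only [P, if_pos hne] at hq
      obtain ⟨f, hf, hfq⟩ := hQs _ hq
      have hf : f ∈ p.1.2 := hf
      rw [hp] at hf
      obtain ⟨u, hu, hr⟩ := (hf q hfq).2
      obtain ⟨r, hr', hru⟩ := hQ s u hu
      rw [hy] at hr
      refine ⟨r, ?_, rel_trans hru hr⟩
      have : (Q s).Nonempty := ⟨r, hr'⟩
      simpa only [P, if_pos this] using hr'
  let e := (Fintype.equivFin S).symm
  refine ⟨_, A.reindex e, P ∘ e, e.symm none, ?_, ⟨fun i => hPot.1 _, ?_⟩, ?_, ?_⟩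
  · intro i j h
    exact htyped _ _ h
  · intro i j y h hy
    exact hPot.2 _ _ y h hy
  · simp [Aut.reindex, A, lab]
  · rw [Aut.ser_reindex, Equiv.apply_symm_apply, ← hser]
    rfl

end Construction

/-! ### The linear system of an automaton -/

section System

variable {K X S : Type*} [Field K] [DecidableEq X] [Fintype S]

theorem ne_one_of_nc_mul_inv {g : FreeGroup X} {z : X × Bool}
    (h : NC (g * (letter z)⁻¹) (letter z)) : g ≠ 1 := by
  rintro rfl
  simp [NC, norm_letter] at h

theorem nc_inv_letter_of_ne {y z : X × Bool} {g : FreeGroup X} (h : NC (letter y) g)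
    (hyz : z ≠ y) : ¬ NC (letter z) ((letter z)⁻¹ * (letter y * g)) := by
  intro h'
  have e : letter z * ((letter z)⁻¹ * (letter y * g)) = letter y * g := by group
  exact hyz (first_unique e h' h).1

namespace Aut

/-- The series obtained from the series `f` by multiplying it on the left by the label of the
state `j`. -/
def shift (A : Aut K X S) (j : S) (f : Ser K X) : Ser K X :=
  fun g => (A.lab j).elim 0 fun y => f ((letter y)⁻¹ * g)

theorem shift_of_lab {A : Aut K X S} {j : S} {y : X × Bool} (h : A.lab j = some y) (f : Ser K X)
    (g : FreeGroup X) : A.shift j f g = f ((letter y)⁻¹ * g) := by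
  rw [shift, h]
  rfl

/-- The support of `f i` consists of elements that can be read from the state `i`. -/
def Compat (A : Aut K X S) (f : S → Ser K X) : Prop :=
  ∀ i y, A.lab i = some y → ∀ g, f i g ≠ 0 → NC (letter y) g

theorem compat_ser {A : Aut K X S} (hA : A.Typed) : A.Compat A.ser := by
  intro i y hy g hg
  by_cases h1 : g = 1
  · rw [h1]; exact nc_one_right _
  · obtain ⟨z, g, rfl, hz⟩ := exists_first h1
    rw [ser_letter_mul A i hz] at hg
    obtain ⟨j, -, hj⟩ := Finset.exists_ne_zero_of_sum_ne_zero hg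
    split_ifs at hj with hl
    · obtain ⟨z', hz', hi⟩ := hA i j (left_ne_zero_of_mul hj)
      rw [hl] at hz'
      cases hz'
      rw [nc_letter_mul_iff hz]
      rintro rfl
      exact hi hy
    · exact absurd rfl hj

theorem shift_one {A : Aut K X S} {f : S → Ser K X} (hf : A.Compat f) (j : S) :
    A.shift j (f j) 1 = 0 := by
  match h : A.lab j with
  | none => rw [shift, h]; rfl
  | some y =>
    rw [shift_of_lab h]
    by_contra hne
    have := hf j y h _ hne
    simp [NC, norm_letter] at this

theorem shift_letter_mul {A : Aut K X S} {f : S → Ser K X} (hf : A.Compat f) (j : S)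
    {y : X × Bool} {g : FreeGroup X} (hg : NC (letter y) g) :
    A.shift j (f j) (letter y * g) = if A.lab j = some y then f j g else 0 := by
  match h : A.lab j with
  | none => rw [shift, h]; simp
  | some z =>
    rw [shift_of_lab h]
    by_cases hzy : z = y
    · subst hzy
      simp
    · rw [if_neg (by simpa using hzy)]
      by_contra hne
      exact nc_inv_letter_of_ne hg hzy (hf j z h _ hne)

/-- The series of the states satisfy a linear system. -/
theorem ser_system {A : Aut K X S} (hA : A.Typed) (i : S) (g : FreeGroup X) :
    A.ser i g = (if g = 1 then A.γ i else 0) + ∑ j, A.M i j * A.shift j (A.ser j) g := by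
  have hc := compat_ser hA
  by_cases h1 : g = 1
  · subst h1
    rw [ser_one, if_pos rfl, Finset.sum_eq_zero fun j _ => by rw [shift_one hc, mul_zero], add_zero]
  · rw [if_neg h1, zero_add]
    obtain ⟨z, g, rfl, hz⟩ := exists_first h1
    rw [ser_letter_mul A i hz]
    refine Finset.sum_congr rfl fun j _ => ?_
    rw [shift_letter_mul hc j hz, mul_ite, mul_zero]

/-- The linear system has no other solution among the families compatible with the labels. -/
theorem eq_ser_of_system {A : Aut K X S} {f : S → Ser K X} (hc : A.Compat f)
    (h : ∀ i g, f i g = (if g = 1 then A.γ i else 0) + ∑ j, A.M i j * A.shift j (f j) g) :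
    f = A.ser := by
  refine A.ser_unique (fun i => ?_) fun i y g hg => ?_
  · rw [h, if_pos rfl, Finset.sum_eq_zero fun j _ => by rw [shift_one hc, mul_zero], add_zero]
  · rw [h, if_neg, zero_add]
    · refine Finset.sum_congr rfl fun j _ => ?_
      rw [shift_letter_mul hc j hg, mul_ite, mul_zero]
    · intro h1
      have : (letter y * g).norm = (letter y).norm + g.norm := hg
      rw [h1, norm_letter, FreeGroup.norm_one] at this
      omega

end Aut

end System

/-! ### State elimination -/

section Kleene

variable {K X S : Type*}

/-- The expression obtained by state elimination for the nonempty paths from `i` to `j` all of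
whose intermediate states belong to the list `l`. If `j` has no label, then the weight `M i j` of a
typed automaton is `0`, so the choice of the word does not matter. -/
def kleene [Zero K] (M : S → S → K) (lab : S → Option (X × Bool)) : List S → S → S → RatExpr K X
  | [], i, j => .mono (M i j) (lab j).toList
  | k :: l, i, j => .add (kleene M lab l i j)
      (.mul (kleene M lab l i k) (.mul (.star (kleene M lab l k k)) (kleene M lab l k j)))

/-- The expression for the paths from `i` which stop in a state of `l`, or in `i` at once; the
intermediate states may be any states of the list `full`. -/
def outExpr [Zero K] (M : S → S → K) (lab : S → Option (X × Bool)) (γ : S → K) (full : List S) :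
    List S → S → RatExpr K X
  | [], i => .mono (γ i) []
  | j :: l, i => .add (outExpr M lab γ full l i) (.mul (kleene M lab full i j) (.mono (γ j) []))

variable [Field K] [DecidableEq X]
  [LinearOrder (FreeGroup X)] [MulLeftMono (FreeGroup X)] [MulRightMono (FreeGroup X)]

theorem RatExpr.IsMN.isMN_value {E : RatExpr K X} (h : E.IsMN) : E.value.IsMN := by
  cases E with
  | mono c w => exact h
  | add E F => exact h.2.2
  | mul E F => exact h.2.2.2
  | star E => exact h.2.2

/-- The body of a star in a Malcev–Neumann expression has positive support. -/
theorem RatExpr.IsMN.pos {E : RatExpr K X} (h : E.star.IsMN) :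
    ∀ g ∈ support E.value, 1 < g :=
  pos_of_starDefined h.1.isMN_value h.2.1 h.2.2

/-- A system of potentials for an automaton in the order of the free group. -/
def Aut.OrdPot (A : Aut K X S) (m : S → FreeGroup X) : Prop :=
  ∀ i j y, A.M i j ≠ 0 → A.lab j = some y → m i ≤ letter y * m j

theorem Aut.Pot.exists_ordPot {N : Submonoid (FreeGroup X)} (hN : N ≤ posMonoid _)
    {A : Aut K X S} {P : S → Finset (FreeGroup X)} (h : A.Pot N P) : ∃ m, A.OrdPot m := by
  refine ⟨fun i => (P i).min' (h.1 i), fun i j y hM hy => ?_⟩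
  obtain ⟨p, hp, hr⟩ := h.2 i j y hM hy _ ((P j).min'_mem (h.1 j))
  exact ((P i).min'_le p hp).trans (rel_posMonoid.1 (hN hr))

/-- The properties of the elements in the support of the paths from `i` to `j`. -/
def IsPath (A : Aut K X S) (m : S → FreeGroup X) (i j : S) (g : FreeGroup X) : Prop :=
  (∀ y, A.lab i = some y → NC (letter y) g) ∧
    (∃ z, A.lab j = some z ∧ NC (g * (letter z)⁻¹) (letter z)) ∧ m i ≤ g * m j

variable {A : Aut K X S} {m : S → FreeGroup X}

theorem IsPath.ne_one {i j : S} {g : FreeGroup X} (h : IsPath A m i j g) : g ≠ 1 := by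
  obtain ⟨z, -, hz⟩ := h.2.1
  exact ne_one_of_nc_mul_inv hz

theorem IsPath.nc {i k j : S} {α β : FreeGroup X} (hα : IsPath A m i k α)
    (hβ : IsPath A m k j β) : NC α β := by
  obtain ⟨z, hz, h⟩ := hα.2.1
  exact nc_of_letter h (hβ.1 z hz)

theorem IsPath.mul {i k j : S} {α β : FreeGroup X} (hα : IsPath A m i k α)
    (hβ : IsPath A m k j β) : IsPath A m i j (α * β) := by
  have hnc := hα.nc hβ
  refine ⟨fun y hy => ?_, ?_, ?_⟩
  · have h1 := hα.1 y hy
    have h2 := nc_overlap h1 hnc hα.ne_one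
    refine NC.assoc (β := α) ?_ h1
    rw [NC, h2, h1]
  · obtain ⟨z, hz, h⟩ := hβ.2.1
    refine ⟨z, hz, ?_⟩
    rw [mul_assoc]
    refine NC.assoc' ?_ h
    rwa [inv_mul_cancel_right]
  · calc m i ≤ α * m k := hα.2.2
      _ ≤ α * (β * m j) := mul_le_mul_right hβ.2.2 α
      _ = α * β * m j := (mul_assoc _ _ _).symm

theorem IsPath.one_lt {k : S} {g : FreeGroup X} (h : IsPath A m k k g) : 1 < g := by
  refine lt_of_le_of_ne ?_ h.ne_one.symm
  have := h.2.2
  nth_rw 1 [← one_mul (m k)] at this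
  exact le_of_mul_le_mul_right' this

theorem isPath_list_prod {k : S} {l : List (FreeGroup X)} (h : ∀ g ∈ l, IsPath A m k k g) :
    l.prod = 1 ∨ IsPath A m k k l.prod := by
  induction l with
  | nil => exact Or.inl rfl
  | cons a l ih =>
    right
    have ha := h a List.mem_cons_self
    rw [List.prod_cons]
    rcases ih fun g hg => h g (List.mem_cons_of_mem _ hg) with h1 | h1
    · rwa [h1, mul_one]
    · exact ha.mul h1

/-- An expression in Malcev–Neumann series which is without simplification and whose support
consists of paths from `i` to `j`. -/
def IsPathExpr (A : Aut K X S) (m : S → FreeGroup X) (i j : S) (E : RatExpr K X) : Prop :=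
  E.IsMN ∧ E.WithoutSimplification ∧ ∀ g ∈ support E.value, IsPath A m i j g

theorem IsPathExpr.step {i j k : S} {E₁ E₂ E₃ E₄ : RatExpr K X} (h₁ : IsPathExpr A m i j E₁)
    (h₂ : IsPathExpr A m i k E₂) (h₃ : IsPathExpr A m k k E₃) (h₄ : IsPathExpr A m k j E₄) :
    IsPathExpr A m i j (.add E₁ (.mul E₂ (.mul (.star E₃) E₄))) := by
  have hpos : ∀ g ∈ support E₃.value, 1 < g := fun g hg => (h₃.2.2 g hg).one_lt
  have hS : E₃.star.IsMN := ⟨h₃.1, starDefined_of_pos h₃.1.isMN_value hpos,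
    isMN_kstar h₃.1.isMN_value hpos⟩
  have hSp : ∀ g ∈ support E₃.star.value, g = 1 ∨ IsPath A m k k g := by
    intro g hg
    obtain ⟨l, hl, rfl⟩ := support_kstar_subset _ hg
    exact isPath_list_prod fun g hg => h₃.2.2 g (hl g hg)
  have hSE : (RatExpr.mul E₃.star E₄).IsMN := ⟨hS, h₄.1,
    mulDefined hS.isMN_value h₄.1.isMN_value, isMN_cauchy hS.isMN_value h₄.1.isMN_value⟩
  have hSEp : ∀ g ∈ support (RatExpr.mul E₃.star E₄).value, IsPath A m k j g := by
    intro g hg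
    obtain ⟨α, hα, β, hβ, rfl⟩ := support_cauchy_subset _ _ hg
    have hβ := h₄.2.2 β hβ
    rcases hSp α hα with rfl | hα
    · simpa using hβ
    · exact hα.mul hβ
  have hP : (RatExpr.mul E₂ (.mul E₃.star E₄)).IsMN := ⟨h₂.1, hSE,
    mulDefined h₂.1.isMN_value hSE.isMN_value, isMN_cauchy h₂.1.isMN_value hSE.isMN_value⟩
  refine ⟨⟨h₁.1, hP, (mn K X).add_mem h₁.1.isMN_value hP.isMN_value⟩, ⟨h₁.2.1, h₂.2.1,
    ⟨⟨h₃.2.1, ?_⟩, h₄.2.1, ?_⟩, ?_⟩, ?_⟩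
  · intro α hα β hβ
    exact (h₃.2.2 α hα).nc (h₃.2.2 β hβ)
  · intro α hα β hβ
    rcases hSp α hα with rfl | hα
    · exact nc_one_left _
    · exact hα.nc (h₄.2.2 β hβ)
  · intro α hα β hβ
    exact (h₂.2.2 α hα).nc (hSEp β hβ)
  · intro g hg
    rcases support_add _ _ hg with hg | hg
    · exact h₁.2.2 g hg
    · obtain ⟨α, hα, β, hβ, rfl⟩ := support_cauchy_subset _ _ hg
      exact (h₂.2.2 α hα).mul (hSEp β hβ)

theorem isPathExpr_kleene (hA : A.Typed) (hm : A.OrdPot m) (l : List S) (i j : S) :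
    IsPathExpr A m i j (kleene A.M A.lab l i j) := by
  induction l generalizing i j with
  | nil =>
    refine ⟨isMN_monomial _ _, ?_, fun g hg => ?_⟩
    · change FreeGroup.IsReduced _
      cases A.lab j <;> simp
    · have hM : A.M i j ≠ 0 := by
        intro h0
        apply hg
        change Ser.monomial (A.M i j) _ g = 0
        simp [Ser.monomial, h0]
      obtain ⟨y, hy, hi⟩ := hA i j hM
      have hg := support_monomial_subset _ _ hg
      rw [hy] at hg
      have hg : g = letter y := hg
      subst hg
      refine ⟨fun z hz => ?_, ⟨y, hy, ?_⟩, hm i j y hM hy⟩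
      · rw [nc_letter_letter]
        rintro rfl
        exact hi hz
      · rw [mul_inv_cancel]
        exact nc_one_left _
  | cons k l ih => exact (ih i j).step (ih i k) (ih k k) (ih k j)

/-- The series of the paths from `i` to `j` with intermediate states in `l`. -/
def pathSer (hA : A.Typed) (hm : A.OrdPot m) (l : List S) (i j : S) : mn K X :=
  ⟨(kleene A.M A.lab l i j).value, (isPathExpr_kleene hA hm l i j).1.isMN_value⟩

/-- State elimination solves the system `R = M + M R`. -/
theorem pathSer_system (hA : A.Typed) (hm : A.OrdPot m) (l : List S) (i j : S) :
    pathSer hA hm l i j = pathSer hA hm [] i j +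
      (l.map fun k => pathSer hA hm [] i k * pathSer hA hm l k j).sum := by
  induction l generalizing i j with
  | nil => simp
  | cons k l ih =>
    have hpos : ∀ g ∈ support (pathSer hA hm l k k).1, 1 < g := fun g hg =>
      ((isPathExpr_kleene hA hm l k k).2.2 g hg).one_lt
    let T := starMN _ hpos
    have hstep : ∀ x, pathSer hA hm (k :: l) x j =
        pathSer hA hm l x j + pathSer hA hm l x k * (T * pathSer hA hm l k j) := fun x => rfl
    have hT : T = 1 + pathSer hA hm l k k * T := starMN_eq _ hpos
    have h1 := ih i j
    have h2 := ih i k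
    simp only [List.map_cons, List.sum_cons, hstep, mul_add, List.sum_map_add]
    have h3 : (l.map fun x => pathSer hA hm [] i x * (pathSer hA hm l x k *
        (T * pathSer hA hm l k j))).sum =
        (pathSer hA hm l i k - pathSer hA hm [] i k) * (T * pathSer hA hm l k j) := by
      rw [sub_eq_iff_eq_add'.2 h2, ← List.sum_map_mul_right]
      simp only [mul_assoc]
    rw [h3, ← sub_eq_iff_eq_add'.2 h1]
    have h4 : T * pathSer hA hm l k j =
        pathSer hA hm l k j + pathSer hA hm l k k * (T * pathSer hA hm l k j) := by
      conv_lhs => rw [hT]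
      rw [add_mul, one_mul, mul_assoc]
    have h5 : pathSer hA hm [] i k * (T * pathSer hA hm l k j) =
        pathSer hA hm [] i k * pathSer hA hm l k j +
          pathSer hA hm [] i k * (pathSer hA hm l k k * (T * pathSer hA hm l k j)) := by
      conv_lhs => rw [h4]
      rw [mul_add]
    rw [sub_mul, h5]
    abel

theorem outExpr_spec (hA : A.Typed) (hm : A.OrdPot m) (full l : List S) (i : S) :
    (outExpr A.M A.lab A.γ full l i).IsMN ∧
    (outExpr A.M A.lab A.γ full l i).WithoutSimplification ∧
    (outExpr A.M A.lab A.γ full l i).value =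
      (mono (A.γ i) 1 + (l.map fun j => pathSer hA hm full i j * mono (A.γ j) 1).sum : mn K X).1 ∧
    ∀ g ∈ support (outExpr A.M A.lab A.γ full l i).value, g = 1 ∨ ∃ j, IsPath A m i j g := by
  induction l with
  | nil =>
    refine ⟨isMN_monomial _ _, FreeGroup.IsReduced.nil, ?_, fun g hg => ?_⟩
    · simp only [List.map_nil, List.sum_nil, add_zero]
      rfl
    · exact Or.inl (support_monomial_subset _ _ hg)
  | cons j l ih =>
    obtain ⟨h1, h2, h3, h4⟩ := ih
    have hk := isPathExpr_kleene hA hm full i j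
    have hmono : (RatExpr.mono (X := X) (A.γ j) []).IsMN := isMN_monomial _ _
    have hP : (RatExpr.mul (kleene A.M A.lab full i j) (.mono (A.γ j) [])).IsMN := ⟨hk.1, hmono,
      mulDefined hk.1.isMN_value hmono.isMN_value, isMN_cauchy hk.1.isMN_value hmono.isMN_value⟩
    refine ⟨⟨h1, hP, (mn K X).add_mem h1.isMN_value hP.isMN_value⟩,
      ⟨h2, hk.2.1, FreeGroup.IsReduced.nil, ?_⟩, ?_, ?_⟩
    · intro α _ β hβ
      rw [support_monomial_subset _ _ hβ]
      exact nc_one_right _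
    · change _ + (pathSer hA hm full i j * mono (A.γ j) 1).1 = _
      rw [h3, List.map_cons, List.sum_cons, ← Submodule.coe_add, add_assoc]
      congr 2
      rw [add_comm]
    · intro g hg
      rcases support_add _ _ hg with hg | hg
      · exact h4 g hg
      · obtain ⟨α, hα, β, hβ, rfl⟩ := support_cauchy_subset _ _ hg
        have hβ : β = 1 := support_monomial_subset _ _ hβ
        rw [hβ]
        simp only [mul_one]
        exact Or.inr ⟨j, hk.2.2 α hα⟩

theorem sum_list_eq [Fintype S] {B : Type*} [AddCommMonoid B] {l : List S} (hn : l.Nodup)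
    (hl : ∀ s, s ∈ l) (f : S → B) : (l.map f).sum = ∑ s, f s := by
  classical
  rw [← List.sum_toFinset f hn]
  refine Finset.sum_congr ?_ fun _ _ => rfl
  ext s
  simp [hl s]

/-- State elimination in an automaton with potentials yields an expression without simplification
for the series of each state. -/
theorem outExpr_value [Fintype S] (hA : A.Typed) (hm : A.OrdPot m) {full : List S}
    (hn : full.Nodup) (hl : ∀ s, s ∈ full) (i : S) :
    (outExpr A.M A.lab A.γ full full i).value = A.ser i := by
  let f : S → mn K X := fun i =>
    mono (A.γ i) 1 + ∑ j, pathSer hA hm full i j * mono (A.γ j) 1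
  have hf : ∀ i, (outExpr A.M A.lab A.γ full full i).value = (f i).1 := by
    intro i
    rw [(outExpr_spec hA hm full full i).2.2.1, sum_list_eq hn hl]
  have hcompat : A.Compat fun i => (f i).1 := by
    intro i y hy g hg
    dsimp only at hg
    rw [← hf] at hg
    rcases (outExpr_spec hA hm full full i).2.2.2 g hg with rfl | ⟨j, hj⟩
    · exact nc_one_right _
    · exact hj.1 y hy
  have hring : ∀ i, f i = mono (A.γ i) 1 + ∑ k, pathSer hA hm [] i k * f k := by
    intro i
    have hR : ∀ j, pathSer hA hm full i j = pathSer hA hm [] i j +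
        ∑ k, pathSer hA hm [] i k * pathSer hA hm full k j := fun j => by
      rw [← sum_list_eq hn hl]
      exact pathSer_system hA hm full i j
    simp only [f]
    congr 1
    simp only [mul_add, Finset.sum_add_distrib]
    simp_rw [hR, add_mul, Finset.sum_add_distrib, Finset.mul_sum, Finset.sum_mul]
    congr 1
    rw [Finset.sum_comm]
    simp only [mul_assoc]
  have hsys := Aut.eq_ser_of_system hcompat fun i g => by
    have hsum : ∀ s : Finset S, ((∑ k ∈ s, pathSer hA hm [] i k * f k : mn K X)).1 g =
        ∑ k ∈ s, A.M i k * A.shift k (f k).1 g := by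
      intro s
      rw [coe_sum_apply]
      refine Finset.sum_congr rfl fun k _ => ?_
      have h1 := monomial_cauchy (A.M i k) (FreeGroup.mk (A.lab k).toList) (f k).1 g
      refine h1.trans ?_
      by_cases hM : A.M i k = 0
      · rw [hM, zero_mul, zero_mul]
      · obtain ⟨y, hy, -⟩ := hA i k hM
        rw [Aut.shift_of_lab hy, hy]
        rfl
    have h0 : (f i).1 g = (mono (A.γ i) 1 : mn K X).1 g +
        (∑ k, pathSer hA hm [] i k * f k : mn K X).1 g := by
      conv_lhs => rw [hring i]
      rfl
    rw [h0, hsum]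
    rfl
  rw [hf]
  exact congrFun hsys i

theorem exists_outExpr [Fintype S] (hA : A.Typed) (hm : A.OrdPot m) (i : S) :
    ∃ F : RatExpr K X, F.IsMN ∧ F.WithoutSimplification ∧ F.value = A.ser i := by
  have h1 := outExpr_spec hA hm Finset.univ.toList Finset.univ.toList i
  exact ⟨_, h1.1, h1.2.1, outExpr_value hA hm (Finset.nodup_toList _) (by simp) i⟩

theorem isMN_ser [Fintype S] (hA : A.Typed) (hm : A.OrdPot m) (i : S) : (A.ser i).IsMN := by
  obtain ⟨F, h1, -, h2⟩ := exists_outExpr hA hm i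
  exact h2 ▸ h1.isMN_value

end Kleene

/-! ### Products of series given by automata -/

section Product

variable {K X S : Type*} [Field K] [DecidableEq X] [Fintype S] [DecidableEq S]

namespace Aut

/-- The equation for the matrix `C` of the cancelling parts: `C i t` is the sum over all words `z`
of the coefficient of `z` in the series of `i` times the weight of the paths from `b` to `t` with
label `z⁻¹`. -/
def CancelEq (A : Aut K X S) (b : S) (C : S → S → K) : Prop :=
  ∀ i t, C i t = (if t = b then A.γ i else 0) +
    ∑ j, ∑ s, if (A.lab j).map bar = A.lab t then A.M i j * C j s * A.M s t else 0

/-- The automaton for the products of the series of the states with that of the state `b`. It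
reads a word of the first factor up to the part that cancels, then switches to the remaining word
of the second factor; the matrix `C` accounts for the cancelling parts. -/
def prodAut (A : Aut K X S) (C : S → S → K) : Aut K X (S ⊕ S) where
  lab := Sum.elim A.lab A.lab
  M := Sum.elim
    (fun i => Sum.elim (A.M i)
      fun t => if A.lab i = (A.lab t).map bar then 0 else ∑ s, C i s * A.M s t)
    (fun i => Sum.elim (fun _ => 0) (A.M i))
  γ := Sum.elim (fun i => ∑ t, C i t * A.γ t) A.γ

theorem typed_prodAut {A : Aut K X S} (hA : A.Typed) (C : S → S → K) : (A.prodAut C).Typed := by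
  rintro (i | i) (j | t) h
  · exact hA i j h
  · change (if A.lab i = (A.lab t).map bar then 0 else ∑ s, C i s * A.M s t) ≠ 0 at h
    split_ifs at h with hl
    · exact absurd rfl h
    · obtain ⟨s, -, hs⟩ := Finset.exists_ne_zero_of_sum_ne_zero h
      obtain ⟨y, hy, -⟩ := hA s t (right_ne_zero_of_mul hs)
      refine ⟨y, hy, fun hi => hl ?_⟩
      rw [hy]
      exact hi
  · exact absurd rfl h
  · exact hA i t h

theorem prodAut_ser_inr (A : Aut K X S) (C : S → S → K) (i : S) :
    (A.prodAut C).ser (Sum.inr i) = A.ser i := by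
  refine congrFun (ser_unique A (f := fun i => (A.prodAut C).ser (Sum.inr i)) (fun i => ?_)
    fun i y g h => ?_) i
  · exact ser_one _ _
  · rw [ser_letter_mul _ _ h, Fintype.sum_sum_type]
    rw [Finset.sum_eq_zero, zero_add]
    · rfl
    · intro j _
      have : (A.prodAut C).M (Sum.inr i) (Sum.inl j) = 0 := rfl
      rw [this, zero_mul, ite_self]

end Aut

variable [LinearOrder (FreeGroup X)] [MulLeftMono (FreeGroup X)] [MulRightMono (FreeGroup X)]

variable {A : Aut K X S} {m : S → FreeGroup X}

/-- A family of Malcev–Neumann series vanishes if each nonzero coefficient entails another one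
at a longer word along a transition. Indeed, `(m i)⁻¹ w` does not increase along transitions; if it
takes its least value `q` at some nonzero coefficient, then it keeps this value, and arbitrarily
long words would be of the form `m i q`. -/
theorem eq_zero_of_extend (hm : A.OrdPot m) {e : S → mn K X}
    (he : ∀ i w, (e i).1 w ≠ 0 → ∃ j y, A.M i j ≠ 0 ∧ A.lab j = some y ∧
      NC (letter (bar y)) w ∧ (e j).1 (letter (bar y) * w) ≠ 0) (i : S) : e i = 0 := by
  by_contra hne
  let T : Set (FreeGroup X) := ⋃ i ∈ (Finset.univ : Finset S), ((m i)⁻¹ * ·) '' support (e i).1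
  have hT : T.IsPWO := pwo_posMonoid.1
    ((Finset.partiallyWellOrderedOn_bUnion Finset.univ).2 fun i _ =>
      (pwo_of_isMN (e i).2).image_mul_left _)
  have hTm : ∀ i w, (e i).1 w ≠ 0 → (m i)⁻¹ * w ∈ T := fun i w h => by
    simp only [T, Set.mem_iUnion]
    exact ⟨i, Finset.mem_univ i, w, h, rfl⟩
  have hTne : T.Nonempty := by
    have : (support (e i).1).Nonempty := by
      rw [support_nonempty_iff]
      exact fun h0 => hne (Subtype.ext h0)
    obtain ⟨w, hw⟩ := this
    exact ⟨_, hTm i w hw⟩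
  let q := hT.isWF.min hTne
  have hq : ∀ g ∈ T, q ≤ g := fun g hg => hT.isWF.min_le hTne hg
  have hlong : ∀ n : ℕ, ∃ i w, (e i).1 w ≠ 0 ∧ (m i)⁻¹ * w = q ∧ n ≤ w.norm := by
    intro n
    induction n with
    | zero =>
      have hqT : q ∈ T := hT.isWF.min_mem hTne
      simp only [T, Set.mem_iUnion] at hqT
      obtain ⟨i, -, w, hw, hwq⟩ := hqT
      exact ⟨i, w, hw, hwq, Nat.zero_le _⟩
    | succ n ih =>
      obtain ⟨i, w, hw, hwq, hn⟩ := ih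
      obtain ⟨j, y, hM, hy, hnc, hj⟩ := he i w hw
      refine ⟨j, _, hj, le_antisymm ?_ (hq _ (hTm j _ hj)), ?_⟩
      · rw [← hwq, letter_bar, ← mul_assoc, ← mul_inv_rev]
        exact mul_le_mul_left (inv_le_inv_iff.2 (hm i j y hM hy)) w
      · have : (letter (bar y) * w).norm = (letter (bar y)).norm + w.norm := hnc
        rw [this, norm_letter]
        omega
  obtain ⟨i, w, -, hwq, hn⟩ := hlong (Finset.univ.sup (fun i => (m i * q).norm) + 1)
  have h1 : (m i * q).norm ≤ Finset.univ.sup (fun i => (m i * q).norm) :=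
    Finset.le_sup (f := fun i => (m i * q).norm) (Finset.mem_univ i)
  rw [← hwq, mul_inv_cancel_left] at h1
  rw [hwq] at h1
  omega

/-- The series of a state as a Malcev–Neumann series. -/
def serMN (hA : A.Typed) (hm : A.OrdPot m) (i : S) : mn K X := ⟨A.ser i, isMN_ser hA hm i⟩

/-- The linear system of an automaton, multiplied on the right by a series. -/
theorem serMN_mul_apply (hA : A.Typed) (hm : A.OrdPot m) (i : S) (b : mn K X) (w : FreeGroup X) :
    (serMN hA hm i * b).1 w =
      A.γ i * b.1 w + ∑ j, A.M i j * A.shift j (serMN hA hm j * b).1 w := by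
  have h1 : serMN hA hm i = mono (A.γ i) 1 +
      ∑ j, mono (A.M i j) (FreeGroup.mk (A.lab j).toList) * serMN hA hm j := by
    ext g
    have h2 : A.ser i g = (if g = 1 then A.γ i else 0) +
        ∑ j, A.M i j * A.shift j (A.ser j) g := Aut.ser_system hA i g
    refine h2.trans ?_
    change _ = (Ser.monomial (A.γ i) 1 : Ser K X) g + (∑ j, _ : mn K X).1 g
    rw [coe_sum_apply]
    congr 1
    refine Finset.sum_congr rfl fun j _ => ?_
    have h3 := monomial_cauchy (A.M i j) (FreeGroup.mk (A.lab j).toList) (A.ser j) g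
    refine Eq.trans ?_ h3.symm
    by_cases hM : A.M i j = 0
    · rw [hM, zero_mul, zero_mul]
    · obtain ⟨y, hy, -⟩ := hA i j hM
      rw [Aut.shift_of_lab hy, hy]
      rfl
  conv_lhs => rw [h1, add_mul, Finset.sum_mul]
  change (mono (A.γ i) 1 * b).1 w + (∑ j, _ : mn K X).1 w = _
  rw [coe_sum_apply]
  congr 1
  · refine (monomial_cauchy _ _ _ _).trans ?_
    simp
  · refine Finset.sum_congr rfl fun j _ => ?_
    rw [mul_assoc]
    refine (monomial_cauchy _ _ _ _).trans ?_
    by_cases hM : A.M i j = 0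
    · rw [hM, zero_mul, zero_mul]
    · obtain ⟨y, hy, -⟩ := hA i j hM
      rw [Aut.shift_of_lab hy, hy]
      rfl

/-- The coefficients of a product of two series given by automata, decomposed according to whether
the first letter of the first factor is cancelled (or there is none), which is accounted for by `C`,
or survives. -/
theorem serMN_mul_eq (hA : A.Typed) (hm : A.OrdPot m) {b : S} {C : S → S → K}
    (hC : A.CancelEq b C) (i : S) (w : FreeGroup X) :
    (serMN hA hm i * serMN hA hm b).1 w = ∑ t, C i t * A.ser t w +
      ∑ j, A.M i j * (A.lab j).elim 0 fun y => if NC (letter (bar y)) w then 0 else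
        (serMN hA hm j * serMN hA hm b).1 (letter (bar y) * w) := by
  set u : S → mn K X := fun i => serMN hA hm i * serMN hA hm b with hu
  have hc := Aut.compat_ser hA
  -- `e i` is the difference of the two sides, written as a Malcev–Neumann series
  let e : S → mn K X := fun i => A.γ i • serMN hA hm b - ∑ t, C i t • serMN hA hm t +
    ∑ j, A.M i j • (A.lab j).elim 0 fun y => proj (bar y) (mono 1 (letter y) * u j)
  have hej : ∀ j w, ((A.lab j).elim 0 fun y => proj (bar y) (mono 1 (letter y) * u j) : mn K X).1 w
      = (A.lab j).elim 0 fun y => if NC (letter (bar y)) w then (u j).1 (letter (bar y) * w)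
        else 0 := by
    intro j w
    cases A.lab j with
    | none => rfl
    | some y =>
      simp only [Option.elim_some]
      split_ifs with h
      · rw [proj_apply_of_nc _ h]
        refine (monomial_cauchy _ _ _ _).trans ?_
        rw [one_mul, letter_bar]
      · exact proj_apply_of_not_nc _ h
  have he : ∀ i w, (e i).1 w = A.γ i * A.ser b w - ∑ t, C i t * A.ser t w +
      ∑ j, A.M i j * (A.lab j).elim 0 fun y => if NC (letter (bar y)) w then
        (u j).1 (letter (bar y) * w) else 0 := by
    intro i w
    change A.γ i * A.ser b w - (∑ t, C i t • serMN hA hm t : mn K X).1 w +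
      (∑ j, A.M i j • (A.lab j).elim 0 fun y => proj (bar y) (mono 1 (letter y) * u j) : mn K X).1 w
      = _
    rw [coe_sum_apply, coe_sum_apply]
    congr 1
    refine Finset.sum_congr rfl fun j _ => ?_
    rw [← hej]
    rfl
  have hue : ∀ i w, (u i).1 w = (e i).1 w + (∑ t, C i t * A.ser t w +
      ∑ j, A.M i j * (A.lab j).elim 0 fun y => if NC (letter (bar y)) w then 0 else
        (u j).1 (letter (bar y) * w)) := by
    intro i w
    rw [he, hu]
    dsimp only
    rw [serMN_mul_apply]
    have h1 : ∑ j, A.M i j * A.shift j (u j).1 w =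
        (∑ j, A.M i j * (A.lab j).elim 0 fun y => if NC (letter (bar y)) w then
          (u j).1 (letter (bar y) * w) else 0) +
        ∑ j, A.M i j * (A.lab j).elim 0 fun y => if NC (letter (bar y)) w then 0 else
          (u j).1 (letter (bar y) * w) := by
      rw [← Finset.sum_add_distrib]
      refine Finset.sum_congr rfl fun j _ => ?_
      rw [← mul_add, Aut.shift]
      congr 1
      cases A.lab j with
      | none => simp
      | some y =>
        simp only [Option.elim_some, letter_bar]
        split_ifs <;> simp
    change A.γ i * A.ser b w + _ = _
    rw [h1]
    ring
  -- a nonzero coefficient of `e i` at `w` comes from one of some `e j` at the longer word `y⁻¹ w`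
  have hzero : ∀ i, e i = 0 := by
    refine eq_zero_of_extend hm fun i w hne => ?_
    -- the equation `e i w = ∑ M i j e j (y⁻¹ w)`, over `j` with label `y` such that `y⁻¹ w` is
    -- free of cancellation
    have hrec : (e i).1 w = ∑ j, A.M i j * (A.lab j).elim 0 fun y =>
        if NC (letter (bar y)) w then (e j).1 (letter (bar y) * w) else 0 := by
      have h1 : ∀ j, (A.M i j * (A.lab j).elim 0 fun y => if NC (letter (bar y)) w then
          (u j).1 (letter (bar y) * w) else 0) =
          (A.M i j * (A.lab j).elim 0 fun y =>
            if NC (letter (bar y)) w then (e j).1 (letter (bar y) * w) else 0) +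
          ∑ t, ∑ s, if (A.lab j).map bar = A.lab t then
            A.M i j * C j s * A.M s t * A.ser t w else 0 := by
        intro j
        by_cases hM : A.M i j = 0
        · simp [hM]
        · obtain ⟨y, hy, -⟩ := hA i j hM
          simp only [hy, Option.elim_some, Option.map_some]
          by_cases hnc : NC (letter (bar y)) w
          · rw [if_pos hnc, if_pos hnc, hue j, mul_add]
            congr 1
            have h2 : ∑ k, (A.M j k * (A.lab k).elim 0 fun z =>
                if NC (letter (bar z)) (letter (bar y) * w) then 0 else
                (u k).1 (letter (bar z) * (letter (bar y) * w))) = 0 := by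
              refine Finset.sum_eq_zero fun k _ => ?_
              by_cases hMk : A.M j k = 0
              · rw [hMk, zero_mul]
              · obtain ⟨z, hz, hjz⟩ := hA j k hMk
                rw [hz, Option.elim_some, if_pos, mul_zero]
                rw [nc_letter_mul_iff hnc, bar_bar]
                rintro rfl
                exact hjz hy
            rw [h2, add_zero, Finset.mul_sum, Finset.sum_comm]
            refine Finset.sum_congr rfl fun s _ => ?_
            rw [A.ser_letter_mul s hnc, Finset.mul_sum, Finset.mul_sum]
            refine Finset.sum_congr rfl fun t _ => ?_
            by_cases ht : A.lab t = some (bar y)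
            · rw [if_pos ht, if_pos ht.symm]
              ring
            · rw [if_neg ht, if_neg (Ne.symm ht), mul_zero, mul_zero]
          · rw [if_neg hnc, if_neg hnc, mul_zero, zero_add]
            symm
            refine Finset.sum_eq_zero fun t _ => Finset.sum_eq_zero fun s _ => ?_
            split_ifs with ht
            · have : A.ser t w = 0 := by
                by_contra hne
                exact hnc (hc t _ ht.symm w hne)
              rw [this, mul_zero]
            · rfl
      have h3 : ∑ t, C i t * A.ser t w = A.γ i * A.ser b w + ∑ j, ∑ t, ∑ s,
          if (A.lab j).map bar = A.lab t then A.M i j * C j s * A.M s t * A.ser t w else 0 := by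
        rw [Finset.sum_comm]
        have h4 : ∀ t, C i t * A.ser t w = (if t = b then A.γ i * A.ser t w else 0) +
            ∑ j, ∑ s, if (A.lab j).map bar = A.lab t then
              A.M i j * C j s * A.M s t * A.ser t w else 0 := by
          intro t
          rw [hC i t, add_mul, ite_mul, zero_mul, Finset.sum_mul]
          congr 1
          refine Finset.sum_congr rfl fun j _ => ?_
          rw [Finset.sum_mul]
          refine Finset.sum_congr rfl fun s _ => ?_
          rw [ite_mul, zero_mul]
        rw [Finset.sum_congr rfl fun t _ => h4 t, Finset.sum_add_distrib,
          Finset.sum_ite_eq' Finset.univ b, if_pos (Finset.mem_univ _)]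
      rw [he, h3, Finset.sum_congr rfl fun j _ => h1 j, Finset.sum_add_distrib]
      ring
    rw [hrec] at hne
    obtain ⟨j, -, hj⟩ := Finset.exists_ne_zero_of_sum_ne_zero hne
    match hl : A.lab j with
    | none =>
      rw [hl] at hj
      simp at hj
    | some y =>
      rw [hl, Option.elim_some] at hj
      split_ifs at hj with hnc
      · exact ⟨j, y, left_ne_zero_of_mul hj, hl, hnc, right_ne_zero_of_mul hj⟩
      · simp at hj
  have := hue i w
  rw [hzero i] at this
  refine this.trans ?_
  change (0 : K) + _ = _
  rw [zero_add]

/-- The product automaton represents the products. -/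
theorem prodAut_ser_inl (hA : A.Typed) (hm : A.OrdPot m) {b : S}
    {C : S → S → K} (hC : A.CancelEq b C) (w : FreeGroup X) (i : S)
    (hi : ∀ y, A.lab i = some y → NC (letter y) w) :
    (A.prodAut C).ser (Sum.inl i) w = (serMN hA hm i * serMN hA hm b).1 w := by
  induction w using letter_induction generalizing i with
  | one =>
    have h0 : ∑ j, A.M i j * ((A.lab j).elim 0 fun y => if NC (letter (bar y)) 1 then 0 else
        (serMN hA hm j * serMN hA hm b).1 (letter (bar y) * 1) : K) = 0 := by
      refine Finset.sum_eq_zero fun j _ => ?_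
      cases A.lab j with
      | none => simp
      | some y => rw [Option.elim_some, if_pos (nc_one_right _), mul_zero]
    rw [Aut.ser_one, serMN_mul_eq hA hm hC, h0, add_zero]
    simp only [Aut.ser_one]
    rfl
  | mul y w hy ih =>
    rw [Aut.ser_letter_mul _ _ hy, serMN_mul_eq hA hm hC, Fintype.sum_sum_type, add_comm]
    congr 1
    · have h1 : ∀ s, C i s * A.ser s (letter y * w) =
          ∑ t, if A.lab t = some y then C i s * A.M s t * A.ser t w else 0 := by
        intro s
        rw [A.ser_letter_mul s hy, Finset.mul_sum]
        refine Finset.sum_congr rfl fun t _ => ?_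
        rw [mul_ite, mul_zero, mul_assoc]
      rw [Finset.sum_congr rfl fun s _ => h1 s, Finset.sum_comm]
      refine Finset.sum_congr rfl fun t _ => ?_
      rw [Aut.prodAut_ser_inr]
      change (if A.lab t = some y then (if A.lab i = (A.lab t).map bar then 0 else
        ∑ s, C i s * A.M s t) * A.ser t w else 0) = _
      by_cases ht : A.lab t = some y
      · simp only [ht, if_true]
        rw [if_neg, Finset.sum_mul]
        intro hib
        exact (nc_letter_mul_iff hy).1 (hi _ hib) rfl
      · simp [ht]
    · refine Finset.sum_congr rfl fun j _ => ?_
      change (if A.lab j = some y then A.M i j * (A.prodAut C).ser (Sum.inl j) w else 0) = _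
      match hl : A.lab j with
      | none => simp
      | some z =>
        rw [Option.elim_some]
        by_cases hzy : z = y
        · subst hzy
          rw [if_pos rfl, if_neg, letter_bar, inv_mul_cancel_left, ih j]
          · intro y hy'
            rw [hl] at hy'
            cases hy'
            exact hy
          · exact fun h => (nc_letter_mul_iff hy).1 h rfl
        · rw [if_neg (by simpa using hzy), if_pos, mul_zero]
          rw [nc_letter_mul_iff hy]
          intro h
          exact hzy (by simpa using congrArg bar h)

/-- The equation for the cancelling parts has a solution: it is a square linear system, and a
solution of the homogeneous system would give a family of series as in `eq_zero_of_extend`. -/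
theorem exists_cancelEq (hA : A.Typed) (hm : A.OrdPot m) (b : S) :
    ∃ C, A.CancelEq b C := by
  let Φ : (S → S → K) →ₗ[K] (S → S → K) :=
    { toFun := fun C i t => C i t -
        ∑ j, ∑ s, if (A.lab j).map bar = A.lab t then A.M i j * C j s * A.M s t else 0
      map_add' := fun C C' => by
        funext i t
        simp only [Pi.add_apply, mul_add, add_mul, Finset.sum_add_distrib, ite_add_zero]
        ring
      map_smul' := fun c C => by
        funext i t
        simp only [Pi.smul_apply, smul_eq_mul, RingHom.id_apply, mul_sub, Finset.mul_sum, mul_ite,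
          mul_zero]
        congr 1
        refine Finset.sum_congr rfl fun j _ => Finset.sum_congr rfl fun s _ => ?_
        split_ifs <;> ring }
  have hinj : Function.Injective Φ := by
    rw [injective_iff_map_eq_zero]
    intro D hD
    have hD : ∀ i t, D i t =
        ∑ j, ∑ s, if (A.lab j).map bar = A.lab t then A.M i j * D j s * A.M s t else 0 := by
      intro i t
      exact sub_eq_zero.1 (congrFun (congrFun hD i) t)
    funext i t₀
    -- the weights of the paths ending in `t₀`
    let A' : Aut K X S := ⟨A.lab, A.M, fun t => if t = t₀ then 1 else 0⟩
    have hA' : A'.Typed := hA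
    have hm' : A'.OrdPot m := hm
    have hc := Aut.compat_ser hA'
    let e : S → mn K X := fun i => ∑ t, D i t • serMN hA' hm' t
    have he : ∀ i w, (e i).1 w = ∑ t, D i t * A'.ser t w := fun i w => coe_sum_apply _ _ _
    have hzero := eq_zero_of_extend hm' (e := e) (fun i w hne => by
      rw [he] at hne
      obtain ⟨t, -, ht⟩ := Finset.exists_ne_zero_of_sum_ne_zero hne
      have hrec : (e i).1 w = ∑ j, A.M i j * (A.lab j).elim 0 fun y =>
          if NC (letter (bar y)) w then (e j).1 (letter (bar y) * w) else 0 := by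
        have h1 : ∀ j, (A.M i j * (A.lab j).elim 0 fun y =>
            if NC (letter (bar y)) w then (e j).1 (letter (bar y) * w) else 0) =
            ∑ t, ∑ s, if (A.lab j).map bar = A.lab t then
              A.M i j * D j s * A.M s t * A'.ser t w else 0 := by
          intro j
          by_cases hM : A.M i j = 0
          · simp [hM]
          · obtain ⟨y, hy, -⟩ := hA i j hM
            simp only [hy, Option.elim_some, Option.map_some]
            by_cases hnc : NC (letter (bar y)) w
            · rw [if_pos hnc, he, Finset.mul_sum, Finset.sum_comm]
              refine Finset.sum_congr rfl fun s _ => ?_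
              rw [A'.ser_letter_mul s hnc, Finset.mul_sum, Finset.mul_sum]
              refine Finset.sum_congr rfl fun t _ => ?_
              change A.M i j * (D j s * if A.lab t = some (bar y) then A.M s t * _ else 0) = _
              by_cases ht : A.lab t = some (bar y)
              · rw [if_pos ht, if_pos ht.symm]
                ring
              · rw [if_neg ht, if_neg (Ne.symm ht), mul_zero, mul_zero]
            · rw [if_neg hnc, mul_zero]
              symm
              refine Finset.sum_eq_zero fun t _ => Finset.sum_eq_zero fun s _ => ?_
              split_ifs with ht
              · have : A'.ser t w = 0 := by
                  by_contra hne
                  exact hnc (hc t _ ht.symm w hne)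
                rw [this, mul_zero]
              · rfl
        rw [Finset.sum_congr rfl fun j _ => h1 j, Finset.sum_comm, he]
        refine Finset.sum_congr rfl fun t _ => ?_
        conv_lhs => rw [hD i t]
        rw [Finset.sum_mul]
        refine Finset.sum_congr rfl fun j _ => ?_
        rw [Finset.sum_mul]
        refine Finset.sum_congr rfl fun s _ => ?_
        rw [ite_mul, zero_mul]
      rw [← he, hrec] at hne
      obtain ⟨j, -, hj⟩ := Finset.exists_ne_zero_of_sum_ne_zero hne
      match hl : A.lab j with
      | none =>
        rw [hl] at hj
        simp at hj
      | some y =>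
        rw [hl, Option.elim_some] at hj
        split_ifs at hj with hnc
        · exact ⟨j, y, left_ne_zero_of_mul hj, hl, hnc, right_ne_zero_of_mul hj⟩
        · simp at hj) i
    have h1 := he i 1
    rw [hzero] at h1
    have h2 : (0 : K) = ∑ t, D i t * A'.ser t 1 := h1
    simpa [Aut.ser_one, A'] using h2.symm
  obtain ⟨C, hC⟩ := LinearMap.injective_iff_surjective.1 hinj
    fun i t => if t = b then A.γ i else 0
  refine ⟨C, fun i t => ?_⟩
  exact sub_eq_iff_eq_add.1 (congrFun (congrFun hC i) t)

end Product

/-! ### Certificates for linear relations -/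

section Zero

variable {K X S : Type*} [Field K] [DecidableEq X] [Fintype S]

namespace Aut

/-- A certificate that the linear combination of the series of the states with the coefficients
`v` vanishes. The rows of `B` span a space of coefficient vectors all of which stop with weight `0`;
it contains `v` and is stable under the transitions, because `B`, acting on row vectors, fixes `v`
and the images of its rows under the transitions. -/
def ZeroCert (D : Aut K X S) (v : S → K) (B : S → S → K) : Prop :=
  (∀ k, ∑ i, v i * B i k = v k) ∧
  (∀ l i k, (∑ j, if D.lab j = D.lab l then (∑ h, B i h * D.M h j) * B j k else 0) =
    if D.lab k = D.lab l then ∑ h, B i h * D.M h k else 0) ∧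
  ∀ i, ∑ k, B i k * D.γ k = 0

theorem ev_cons_comb (D : Aut K X S) (v : S → K) (y : X × Bool) (w : List (X × Bool)) :
    ∑ i, v i * D.ev (y :: w) i =
      ∑ j, (if D.lab j = some y then ∑ i, v i * D.M i j else 0) * D.ev w j := by
  simp only [ev, Finset.mul_sum]
  rw [Finset.sum_comm]
  refine Finset.sum_congr rfl fun j _ => ?_
  split_ifs with h
  · rw [Finset.sum_mul]
    exact Finset.sum_congr rfl fun i _ => by ring
  · simp

theorem ZeroCert.ev {D : Aut K X S} {v : S → K} {B : S → S → K} (h : D.ZeroCert v B)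
    (w : List (X × Bool)) : ∑ i, v i * D.ev w i = 0 := by
  obtain ⟨h1, h2, h3⟩ := h
  have hB : ∀ i, ∑ k, B i k * D.ev w k = 0 := by
    induction w with
    | nil => exact h3
    | cons y w ih =>
      intro i
      rw [ev_cons_comb]
      by_cases hl : ∃ l, D.lab l = some y
      · obtain ⟨l, hl⟩ := hl
        have h4 : ∀ j, (if D.lab j = some y then ∑ h, B i h * D.M h j else 0) * D.ev w j =
            ∑ x, if D.lab x = D.lab l then (∑ h, B i h * D.M h x) * (B x j * D.ev w j) else 0 := by
          intro j
          rw [← hl, ← h2 l i j, Finset.sum_mul]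
          refine Finset.sum_congr rfl fun x _ => ?_
          rw [ite_mul, zero_mul, mul_assoc]
        rw [Finset.sum_congr rfl fun j _ => h4 j, Finset.sum_comm]
        refine Finset.sum_eq_zero fun x _ => ?_
        split_ifs
        · rw [← Finset.mul_sum, ih x, mul_zero]
        · simp
      · push Not at hl
        exact Finset.sum_eq_zero fun j _ => by rw [if_neg (hl j), zero_mul]
  have h5 : ∀ k, v k * D.ev w k = ∑ i, v i * (B i k * D.ev w k) := by
    intro k
    conv_lhs => rw [← h1 k]
    rw [Finset.sum_mul]
    exact Finset.sum_congr rfl fun i _ => mul_assoc _ _ _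
  rw [Finset.sum_congr rfl fun k _ => h5 k, Finset.sum_comm]
  exact Finset.sum_eq_zero fun i _ => by rw [← Finset.mul_sum, hB i, mul_zero]

theorem ZeroCert.ser {D : Aut K X S} {v : S → K} {B : S → S → K} (h : D.ZeroCert v B)
    (g : FreeGroup X) : ∑ i, v i * D.ser i g = 0 := h.ev g.toWord

theorem isReduced_of_ev_ne_zero {D : Aut K X S} (hD : D.Typed) {w : List (X × Bool)} {i : S}
    (h : D.ev w i ≠ 0) :
    FreeGroup.IsReduced w ∧ ∀ y, D.lab i = some y → FreeGroup.IsReduced (y :: w) := by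
  induction w generalizing i with
  | nil => simp
  | cons z w ih =>
    rw [ev] at h
    obtain ⟨j, -, hj⟩ := Finset.exists_ne_zero_of_sum_ne_zero h
    split_ifs at hj with hl
    · have hr := (ih (right_ne_zero_of_mul hj)).2 z hl
      refine ⟨hr, fun y hy => ?_⟩
      rw [FreeGroup.isReduced_cons_cons]
      refine ⟨fun h1 => ?_, hr⟩
      obtain ⟨z', hz', hi⟩ := hD i j (left_ne_zero_of_mul hj)
      rw [hl] at hz'
      cases hz'
      by_contra h2
      apply hi
      rw [hy]
      congr 1
      refine Prod.ext h1 ?_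
      simp only [bar]
      cases hy2 : y.2 <;> cases hz2 : z.2 <;> simp_all
    · exact absurd rfl hj

/-- Every linear relation has a certificate: a projection onto the space of all linear relations. -/
theorem exists_zeroCert {D : Aut K X S} (hD : D.Typed) {v : S → K}
    (h : ∀ g, ∑ i, v i * D.ser i g = 0) : ∃ B, D.ZeroCert v B := by
  classical
  have hev : ∀ w, ∑ i, v i * D.ev w i = 0 := by
    intro w
    by_cases hw : FreeGroup.IsReduced w
    · have := h (FreeGroup.mk w)
      simpa [Aut.ser, hw.reduce_eq] using this
    · refine Finset.sum_eq_zero fun i _ => ?_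
      have : D.ev w i = 0 := by
        by_contra hne
        exact hw (isReduced_of_ev_ne_zero hD hne).1
      rw [this, mul_zero]
  let W : Submodule K (S → K) :=
    { carrier := {v | ∀ w, ∑ i, v i * D.ev w i = 0}
      zero_mem' := fun w => by simp
      add_mem' := fun {a b} ha hb w => by
        simp only [Pi.add_apply, add_mul, Finset.sum_add_distrib, ha w, hb w, add_zero]
      smul_mem' := fun c a ha w => by
        simp only [Pi.smul_apply, smul_eq_mul, mul_assoc, ← Finset.mul_sum, ha w, mul_zero] }
  obtain ⟨p, hp⟩ := LinearMap.exists_leftInverse_of_injective W.subtype (by simp)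
  let B : S → S → K := fun i k => (p (Pi.single i 1)).1 k
  have hpv : ∀ u k, ∑ i, u i * B i k = (p u).1 k := by
    intro u k
    have : u = ∑ i, u i • Pi.single (M := fun _ => K) i 1 := by
      funext j
      simp [Finset.sum_apply, Pi.single_apply]
    conv_rhs => rw [this, map_sum]
    rw [AddSubmonoidClass.coe_finsetSum, Finset.sum_apply]
    refine Finset.sum_congr rfl fun i _ => ?_
    rw [map_smul]
    rfl
  have hpW : ∀ u ∈ W, ∀ k, ∑ i, u i * B i k = u k := by
    intro u hu k
    rw [hpv]
    have := congrArg (fun f => f ⟨u, hu⟩) hp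
    exact congrFun (congrArg Subtype.val this) k
  refine ⟨B, hpW v hev, fun l i k => ?_, fun i => (p (Pi.single i 1)).2 []⟩
  have hrow : (fun j => if D.lab j = D.lab l then ∑ h, B i h * D.M h j else 0) ∈ W := by
    intro w
    match hl : D.lab l with
    | none =>
      refine Finset.sum_eq_zero fun j _ => ?_
      dsimp only
      split_ifs with hj
      · rw [Finset.sum_eq_zero, zero_mul]
        intro x _
        have : D.M x j = 0 := by
          by_contra hne
          obtain ⟨y, hy, -⟩ := hD x j hne
          rw [hj] at hy
          cases hy
        rw [this, mul_zero]
      · rw [zero_mul]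
    | some y =>
      rw [← ev_cons_comb]
      exact (p (Pi.single i 1)).2 (y :: w)
  rw [← hpW _ hrow k]
  refine Finset.sum_congr rfl fun j _ => ?_
  rw [ite_mul, zero_mul]

end Aut

end Zero

/-! ### Automata for rational series -/

section Rational

variable {K X : Type*} [Field K] [DecidableEq X]

theorem deriv_one (f : Ser K X) : deriv 1 f = f := by
  funext w
  rw [deriv, if_pos (nc_one_left w), one_mul]

theorem deriv_letter_deriv (z : X × Bool) (g : FreeGroup X) (f : Ser K X) :
    deriv (letter z) (deriv g f) = if NC g (letter z) then deriv (g * letter z) f else 0 := by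
  funext w
  by_cases h : NC g (letter z)
  · rw [if_pos h]
    by_cases hw : NC (letter z) w
    · have h1 := nc_overlap h hw (letter_ne_one z)
      have hgz : (g * letter z).norm = g.norm + (letter z).norm := h
      have h2 : NC (g * letter z) w := by
        rw [NC, h1, hgz]
      have h3 : NC g (letter z * w) := h2.assoc h
      simp only [deriv]
      rw [if_pos hw, if_pos h2, if_pos h3, mul_assoc]
    · have h2 : ¬ NC (g * letter z) w := fun h2 => hw (h2.of_mul_left h)
      simp only [deriv]
      rw [if_neg hw, if_neg h2]
  · rw [if_neg h]
    simp only [deriv]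
    split_ifs with hw h2
    · exact absurd (h2.of_mul_right hw) h
    · rfl
    · rfl

theorem deriv_letter_add (z : X × Bool) (f g : Ser K X) :
    deriv (letter z) (f + g) = deriv (letter z) f + deriv (letter z) g := by
  funext w
  simp only [deriv, Pi.add_apply]
  split_ifs <;> simp

theorem deriv_letter_smul (z : X × Bool) (c : K) (f : Ser K X) :
    deriv (letter z) (c • f) = c • deriv (letter z) f := by
  funext w
  simp only [deriv, Pi.smul_apply]
  split_ifs <;> simp

theorem support_deriv_subset (g : FreeGroup X) (f : Ser K X) :
    support (deriv g f) ⊆ (g⁻¹ * ·) '' support f := by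
  intro w hw
  rw [mem_support, deriv] at hw
  split_ifs at hw
  · exact ⟨g * w, hw, inv_mul_cancel_left _ _⟩
  · exact absurd rfl hw

theorem PWO.union {G : Type*} [Group G] {N : Submonoid G} {s t : Set G} (hs : PWO N s)
    (ht : PWO N t) : PWO N (s ∪ t) :=
  Set.PartiallyWellOrderedOn.union hs ht

variable [LinearOrder (FreeGroup X)] [MulLeftMono (FreeGroup X)] [MulRightMono (FreeGroup X)]

/-- A series whose right multiplication commutes with the projections up to finite rank is given by
an automaton. -/
theorem exists_aut_of_finComm [Finite X] {c : mn K X} (hc : FinComm c)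
    {N : Submonoid (FreeGroup X)} (hP : PWO N (support c.1)) :
    ∃ (n : ℕ) (A : Aut K X (Fin n)) (P : Fin n → Finset (FreeGroup X)) (i : Fin n),
      A.Typed ∧ A.Pot N P ∧ A.lab i = none ∧ A.ser i = c.1 := by
  have := finite_span_deriv hc
  refine exists_aut_of_finite (V := Submodule.span K (Set.range fun g => deriv g c.1))
    (fun f hf => ?_) (fun y f hf => ?_) (Submodule.subset_span ⟨1, deriv_one c.1⟩)
  · induction hf using Submodule.span_induction with
    | mem f hf =>
      obtain ⟨g, rfl⟩ := hf
      exact (hP.image_mul_left g⁻¹).mono (support_deriv_subset g c.1)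
    | zero => simp [PWO]
    | add f g _ _ hf hg => exact (hf.union hg).mono (support_add f g)
    | smul a f _ hf => exact hf.mono (support_const_smul_subset a f)
  · induction hf using Submodule.span_induction with
    | mem f hf =>
      obtain ⟨g, rfl⟩ := hf
      dsimp only
      rw [deriv_letter_deriv]
      split_ifs
      · exact Submodule.subset_span ⟨_, rfl⟩
      · exact Submodule.zero_mem _
    | zero =>
      have : deriv (letter y) (0 : Ser K X) = 0 := by
        funext w
        simp [deriv]
      rw [this]
      exact Submodule.zero_mem _
    | add f g _ _ hf hg => rw [deriv_letter_add]; exact Submodule.add_mem _ hf hg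
    | smul a f _ hf => rw [deriv_letter_smul]; exact Submodule.smul_mem _ a hf

theorem RatExpr.IsMN.finComm [Finite X] {E : RatExpr K X} (h : E.IsMN) :
    FinComm (⟨E.value, h.isMN_value⟩ : mn K X) := by
  induction E with
  | mono c w => exact finComm_mono c _
  | add E F ihE ihF =>
    have e : (⟨(add E F).value, h.isMN_value⟩ : mn K X) =
      ⟨E.value, h.1.isMN_value⟩ + ⟨F.value, h.2.1.isMN_value⟩ := rfl
    rw [e]
    exact (ihE h.1).add (ihF h.2.1)
  | mul E F ihE ihF =>
    have e : (⟨(mul E F).value, h.isMN_value⟩ : mn K X) =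
      ⟨E.value, h.1.isMN_value⟩ * ⟨F.value, h.2.1.isMN_value⟩ := rfl
    rw [e]
    exact (ihE h.1).mul (ihF h.2.1)
  | star E ih =>
    have e : (⟨(star E).value, h.isMN_value⟩ : mn K X) =
      starMN ⟨E.value, h.1.isMN_value⟩ h.pos := rfl
    rw [e]
    exact finComm_starMN _ (ih h.1)

/-- The value of a rational expression is given by an automaton with potentials relative to any
submonoid that partially well-orders its support. -/
theorem RatExpr.IsMN.exists_aut [Finite X] {E : RatExpr K X} (h : E.IsMN)
    {N : Submonoid (FreeGroup X)} (hP : PWO N (support E.value)) :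
    ∃ (n : ℕ) (A : Aut K X (Fin n)) (P : Fin n → Finset (FreeGroup X)) (i : Fin n),
      A.Typed ∧ A.Pot N P ∧ A.lab i = none ∧ A.ser i = E.value :=
  exists_aut_of_finComm h.finComm hP

/-- Every rational Malcev–Neumann expression is equivalent to one without simplification. -/
theorem RatExpr.IsMN.exists_withoutSimplification [Finite X] {E : RatExpr K X} (h : E.IsMN) :
    ∃ F : RatExpr K X, F.IsMN ∧ F.WithoutSimplification ∧ F.value = E.value := by
  obtain ⟨n, A, P, i, hA, hP, -, hi⟩ := h.exists_aut (pwo_of_isMN h.isMN_value)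
  obtain ⟨m, hm⟩ := hP.exists_ordPot le_rfl
  obtain ⟨F, h1, h2, h3⟩ := exists_outExpr hA hm i
  exact ⟨F, h1, h2, h3.trans hi⟩

end Rational

/-! ### Computable functions and decidable predicates -/

attribute [fun_prop] Computable

/-- A predicate that is decided by a computable function. -/
@[fun_prop]
def Decides {α : Type*} [Primcodable α] (p : α → Prop) : Prop :=
  ∃ f : α → Bool, Computable f ∧ ∀ a, p a ↔ f a = true

namespace Comp

variable {α β γ σ : Type*} [Primcodable α] [Primcodable β] [Primcodable γ] [Primcodable σ]

@[fun_prop] theorem id : Computable fun x : α => x := Computable.id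

@[fun_prop] theorem const (b : β) : Computable fun _ : α => b := Computable.const b

@[fun_prop] theorem comp {f : β → γ} {g : α → β} (hf : Computable f) (hg : Computable g) :
    Computable fun x => f (g x) := hf.comp hg

@[fun_prop] theorem fst {f : α → β × γ} (hf : Computable f) : Computable fun x => (f x).1 :=
  Computable.fst.comp hf

@[fun_prop] theorem snd {f : α → β × γ} (hf : Computable f) : Computable fun x => (f x).2 :=
  Computable.snd.comp hf

@[fun_prop] theorem mk {f : α → β} {g : α → γ} (hf : Computable f) (hg : Computable g) :
    Computable fun x => (f x, g x) := hf.pair hg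

@[fun_prop] theorem inl {f : α → β} (hf : Computable f) :
    Computable fun x => (Sum.inl (f x) : β ⊕ γ) := Computable.sumInl.comp hf

@[fun_prop] theorem inr {f : α → γ} (hf : Computable f) :
    Computable fun x => (Sum.inr (f x) : β ⊕ γ) := Computable.sumInr.comp hf

@[fun_prop] theorem some {f : α → β} (hf : Computable f) :
    Computable fun x => Option.some (f x) := Computable.option_some.comp hf

@[fun_prop] theorem cons {f : α → β} {g : α → List β} (hf : Computable f) (hg : Computable g) :
    Computable fun x => f x :: g x := Computable.list_cons.comp hf hg

@[fun_prop] theorem append {f g : α → List β} (hf : Computable f) (hg : Computable g) :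
    Computable fun x => f x ++ g x := Computable.list_append.comp hf hg

@[fun_prop] theorem reverse {f : α → List β} (hf : Computable f) :
    Computable fun x => (f x).reverse := Computable.list_reverse.comp hf

@[fun_prop] theorem length {f : α → List β} (hf : Computable f) :
    Computable fun x => (f x).length := Computable.list_length.comp hf

@[fun_prop] theorem range {f : α → ℕ} (hf : Computable f) :
    Computable fun x => List.range (f x) := Primrec.list_range.to_comp.comp hf

@[fun_prop] theorem toList {f : α → Option β} (hf : Computable f) :
    Computable fun x => (f x).toList := Primrec.optionToList.to_comp.comp hf

@[fun_prop] theorem bnot {f : α → Bool} (hf : Computable f) :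
    Computable fun x => !f x := Primrec.not.to_comp.comp hf

@[fun_prop] theorem nat_add {f g : α → ℕ} (hf : Computable f) (hg : Computable g) :
    Computable fun x => f x + g x := Primrec.nat_add.to_comp.comp hf hg

@[fun_prop] theorem getD {f : α → List β} {g : α → ℕ} {d : α → β} (hf : Computable f)
    (hg : Computable g) (hd : Computable d) : Computable fun x => (f x).getD (g x) (d x) := by
  simp only [List.getD_eq_getElem?_getD]
  exact Computable.option_getD (Computable.list_getElem?.comp hf hg) hd

@[fun_prop] theorem option_elim {f : α → Option β} {d : α → σ} {g : α → β → σ}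
    (hf : Computable f) (hd : Computable d) (hg : Computable fun x : α × β => g x.1 x.2) :
    Computable fun x => (f x).elim (d x) (g x) :=
  (Computable.option_casesOn hf hd hg.to₂).of_eq fun x => by cases f x <;> rfl

@[fun_prop] theorem nat_rec {n : α → ℕ} {z : α → σ} {s : α → ℕ → σ → σ} (hn : Computable n)
    (hz : Computable z) (hs : Computable fun x : α × ℕ × σ => s x.1 x.2.1 x.2.2) :
    Computable fun x => Nat.rec (motive := fun _ => σ) (z x) (s x) (n x) :=
  Computable.nat_rec hn hz hs.to₂

@[fun_prop] theorem foldr {l : α → List β} {z : α → σ} {s : α → β → σ → σ} (hl : Computable l)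
    (hz : Computable z) (hs : Computable fun x : α × β × σ => s x.1 x.2.1 x.2.2) :
    Computable fun x => (l x).foldr (s x) (z x) := by
  have h : Computable fun x => Nat.rec (motive := fun _ => σ) (z x)
      (fun k t => ((l x).reverse[k]?).elim t fun b => s x b t) (l x).length := by
    refine nat_rec (length hl) hz (option_elim ?_ (by fun_prop) ?_)
    · exact Computable.list_getElem?.comp (by fun_prop) (by fun_prop)
    · exact hs.comp (f := fun x => s x.1 x.2.1 x.2.2)
        (g := fun x : (α × ℕ × σ) × β => (x.1.1, x.2, x.1.2.2)) (by fun_prop)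
  refine h.of_eq fun x => ?_
  have key : ∀ r m : List β, Nat.rec (motive := fun _ => σ) (z x)
      (fun k t => ((m.reverse ++ r)[k]?).elim t fun b => s x b t) m.length =
      m.foldr (s x) (z x) := by
    intro r m
    induction m generalizing r with
    | nil => rfl
    | cons b m ih =>
      simp only [List.length_cons, List.foldr_cons, List.reverse_cons, List.append_assoc]
      rw [ih, List.getElem?_append_right (by simp)]
      simp
  simpa using key [] (l x)

@[fun_prop] theorem map {l : α → List β} {s : α → β → σ} (hl : Computable l)
    (hs : Computable fun x : α × β => s x.1 x.2) : Computable fun x => (l x).map (s x) := by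
  have h : Computable fun x => (l x).foldr (fun b t => s x b :: t) [] :=
    foldr hl (const _) (cons (hs.comp (f := fun x => s x.1 x.2)
      (g := fun x : α × β × List σ => (x.1, x.2.1)) (by fun_prop)) (by fun_prop))
  exact h.of_eq fun x => by simp

@[fun_prop] theorem ite {p : α → Prop} [∀ x, Decidable (p x)] {f g : α → β} (hp : Decides p)
    (hf : Computable f) (hg : Computable g) : Computable fun x => if p x then f x else g x := by
  obtain ⟨t, ht, hpt⟩ := hp
  refine (Computable.cond ht hf hg).of_eq fun x => ?_
  by_cases h : p x
  · simp [h, (hpt x).1 h]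
  · simp [h, Bool.eq_false_iff.2 fun h' => h ((hpt x).2 h')]

@[fun_prop] theorem eq {f g : α → β} (hf : Computable f) (hg : Computable g) :
    Decides fun x => f x = g x := by
  refine ⟨fun x => Encodable.encode (f x) == Encodable.encode (g x), ?_, fun x => by simp⟩
  exact Primrec.beq.to_comp.comp (Computable.encode.comp hf) (Computable.encode.comp hg)

@[fun_prop] theorem not {p : α → Prop} (hp : Decides p) : Decides fun x => ¬ p x := by
  obtain ⟨f, hf, hp⟩ := hp
  exact ⟨fun x => !f x, by fun_prop, fun x => by simp [hp]⟩

@[fun_prop] theorem ne {f g : α → β} (hf : Computable f) (hg : Computable g) :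
    Decides fun x => f x ≠ g x := not (eq hf hg)

@[fun_prop] theorem and {p q : α → Prop} (hp : Decides p) (hq : Decides q) :
    Decides fun x => p x ∧ q x := by
  obtain ⟨f, hf, hp⟩ := hp
  obtain ⟨g, hg, hq⟩ := hq
  exact ⟨fun x => f x && g x, Primrec.and.to_comp.comp hf hg, fun x => by simp [hp, hq]⟩

@[fun_prop] theorem imp {p q : α → Prop} (hp : Decides p) (hq : Decides q) :
    Decides fun x => p x → q x := by
  obtain ⟨f, hf, hp⟩ := hp
  obtain ⟨g, hg, hq⟩ := hq
  refine ⟨fun x => !f x || g x, Primrec.or.to_comp.comp (by fun_prop) hg, fun x => ?_⟩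
  simp only [hp, hq, Bool.or_eq_true, Bool.not_eq_true']
  cases f x <;> simp

@[fun_prop] theorem forall_mem {l : α → List β} {p : α → β → Prop} (hl : Computable l)
    (hp : Decides fun x : α × β => p x.1 x.2) : Decides fun x => ∀ b ∈ l x, p x b := by
  obtain ⟨f, hf, hp⟩ := hp
  refine ⟨fun x => (l x).foldr (fun b t => f (x, b) && t) true, ?_, fun x => ?_⟩
  · refine foldr hl (const _) (Primrec.and.to_comp.comp ?_ ?_) <;> fun_prop
  · beta_reduce
    generalize l x = m
    induction m <;> simp_all

@[fun_prop] theorem exists_mem {l : α → List β} {p : α → β → Prop} (hl : Computable l)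
    (hp : Decides fun x : α × β => p x.1 x.2) : Decides fun x => ∃ b ∈ l x, p x b := by
  obtain ⟨f, hf, h⟩ := not (forall_mem (p := fun x b => ¬ p x b) hl (not hp))
  exact ⟨f, hf, fun x => by simpa using h x⟩

@[fun_prop] theorem mem {l : α → List β} {f : α → β} (hl : Computable l) (hf : Computable f) :
    Decides fun x => f x ∈ l x := by
  obtain ⟨t, ht, h⟩ : Decides fun x => ∃ b ∈ l x, b = f x := by fun_prop
  exact ⟨t, ht, fun x => by simpa using h x⟩

@[fun_prop] theorem forall_lt {n : α → ℕ} {p : α → ℕ → Prop} (hn : Computable n)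
    (hp : Decides fun x : α × ℕ => p x.1 x.2) : Decides fun x => ∀ i < n x, p x i := by
  obtain ⟨f, hf, h⟩ := forall_mem (range hn) hp
  exact ⟨f, hf, fun x => by simpa using h x⟩

@[fun_prop] theorem lt {f g : α → ℕ} (hf : Computable f) (hg : Computable g) :
    Decides fun x => f x < g x := by
  obtain ⟨t, ht, h⟩ := mem (range hg) hf
  exact ⟨t, ht, fun x => by simpa using h x⟩

@[fun_prop] theorem reduce {X : Type*} [Primcodable X] [DecidableEq X]
    {f : α → List (X × Bool)} (hf : Computable f) : Computable fun x => FreeGroup.reduce (f x) := by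
  have h : Computable fun x => (f x).foldr (fun y t => t.head?.elim [y] fun z =>
      if y.1 = z.1 ∧ y.2 = !z.2 then t.tail else y :: t) [] := by
    refine foldr hf (const _) (option_elim ?_ (by fun_prop) (ite (by fun_prop) ?_ (by fun_prop)))
    · exact Primrec.list_head?.to_comp.comp (by fun_prop)
    · exact Primrec.list_tail.to_comp.comp (by fun_prop)
  refine h.of_eq fun x => ?_
  induction f x with
  | nil => rfl
  | cons y w ih =>
    rw [List.foldr_cons, ih, FreeGroup.reduce.cons]
    cases FreeGroup.reduce w <;> rfl

section Field

variable {K : Type*} [Field K] [Primcodable K] [hK : Fact (IsComputableField K)]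

@[fun_prop] theorem add {f g : α → K} (hf : Computable f) (hg : Computable g) :
    Computable fun x => f x + g x := hK.out.add.comp hf hg

@[fun_prop] theorem mul {f g : α → K} (hf : Computable f) (hg : Computable g) :
    Computable fun x => f x * g x := hK.out.mul.comp hf hg

@[fun_prop] theorem sub {f g : α → K} (hf : Computable f) (hg : Computable g) :
    Computable fun x => f x - g x := by
  have h : Computable fun x => f x + (-1) * g x := by fun_prop
  exact h.of_eq fun x => by ring

@[fun_prop] theorem sum_range {n : α → ℕ} {f : α → ℕ → K} (hn : Computable n)
    (hf : Computable fun x : α × ℕ => f x.1 x.2) :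
    Computable fun x => ∑ i ∈ Finset.range (n x), f x i := by
  have h : Computable fun x => Nat.rec (motive := fun _ => K) 0 (fun k t => t + f x k) (n x) := by
    refine nat_rec hn (const _) (add (by fun_prop) ?_)
    exact hf.comp (f := fun x => f x.1 x.2) (g := fun x : α × ℕ × K => (x.1, x.2.1)) (by fun_prop)
  refine h.of_eq fun x => ?_
  induction n x with
  | zero => simp
  | succ n ih => rw [Finset.sum_range_succ, ← ih]

end Field

end Comp

/-! ### Inference systems -/

section Inference

variable {J Θ : Type*} [Primcodable J] [Primcodable Θ]

/-- The rule with premises `prem θ` and conclusion `concl θ`, for the parameters `θ` such that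
`ok θ`. A rule is encoded as the function that takes the code of the parameters to the instance
of the rule. -/
noncomputable def ruleOf (prem : Θ → List J) (concl : Θ → J) (ok : Θ → Prop) :
    ℕ → Option (List J × J) :=
  open scoped Classical in
  fun n => (Encodable.decode (α := Θ) n).elim none fun θ =>
    if ok θ then some (prem θ, concl θ) else none

open scoped Classical in
theorem computable_ruleOf {prem : Θ → List J} {concl : Θ → J} {ok : Θ → Prop}
    (h1 : Computable prem) (h2 : Computable concl) (h3 : Decides ok) :
    Computable (ruleOf prem concl ok) := by
  refine Comp.option_elim (f := fun n => Encodable.decode (α := Θ) n) Computable.decode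
    (by fun_prop) (Comp.ite ?_ (by fun_prop) (by fun_prop))
  obtain ⟨f, hf, h⟩ := h3
  exact ⟨fun x : ℕ × Θ => f x.2, by fun_prop, fun x => h x.2⟩

/-- The system consisting of finitely many rules. -/
def systemOf : List (ℕ → Option (List J × J)) → ℕ → Option (List J × J)
  | [], _ => none
  | r :: R, n => if n.unpair.1 = 0 then r n.unpair.2 else systemOf R n.unpair.2

theorem computable_systemOf {R : List (ℕ → Option (List J × J))} (h : ∀ r ∈ R, Computable r) :
    Computable (systemOf R) := by
  induction R with
  | nil => exact Comp.const _
  | cons r R ih =>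
    have h1 := h r List.mem_cons_self
    have h2 := ih fun r hr => h r (List.mem_cons_of_mem _ hr)
    have h3 : Computable fun n : ℕ => n.unpair := Computable.unpair
    exact Comp.ite (p := fun n : ℕ => n.unpair.1 = 0) (Comp.eq (Comp.fst h3) (Comp.const 0))
      (h1.comp (Comp.snd h3)) (h2.comp (Comp.snd h3))

theorem exists_systemOf {R : List (ℕ → Option (List J × J))} {r : ℕ → Option (List J × J)}
    (hr : r ∈ R) (n : ℕ) : ∃ m, systemOf R m = r n := by
  induction R with
  | nil => simp at hr
  | cons s R ih =>
    rcases List.mem_cons.1 hr with rfl | hr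
    · exact ⟨Nat.pair 0 n, by simp [systemOf]⟩
    · obtain ⟨m, hm⟩ := ih hr
      exact ⟨Nat.pair 1 m, by simpa [systemOf] using hm⟩

/-- Derivability in a system of rules. -/
inductive Derivable (ρ : ℕ → Option (List J × J)) : J → Prop
  | step {n : ℕ} {L : List J} {j : J} (h : ρ n = some (L, j)) (hL : ∀ x ∈ L, Derivable ρ x) :
    Derivable ρ j

theorem derivable_of_rule {R : List (ℕ → Option (List J × J))} {prem : Θ → List J}
    {concl : Θ → J} {ok : Θ → Prop} (hr : ruleOf prem concl ok ∈ R) (θ : Θ) (hok : ok θ)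
    (hL : ∀ x ∈ prem θ, Derivable (systemOf R) x) : Derivable (systemOf R) (concl θ) := by
  obtain ⟨m, hm⟩ := exists_systemOf hr (Encodable.encode θ)
  refine Derivable.step (hm.trans ?_) hL
  simp [ruleOf, hok]

/-- The rule `r` preserves the property `P`. -/
def Preserves (P : J → Prop) (r : ℕ → Option (List J × J)) : Prop :=
  ∀ n L j, r n = some (L, j) → (∀ x ∈ L, P x) → P j

theorem preserves_ruleOf {P : J → Prop} {prem : Θ → List J} {concl : Θ → J} {ok : Θ → Prop}
    (h : ∀ θ, ok θ → (∀ x ∈ prem θ, P x) → P (concl θ)) : Preserves P (ruleOf prem concl ok) := by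
  intro n L j hn hL
  rw [ruleOf] at hn
  cases hd : Encodable.decode (α := Θ) n with
  | none => simp [hd] at hn
  | some θ =>
    rw [hd, Option.elim_some] at hn
    split_ifs at hn with hok
    obtain ⟨rfl, rfl⟩ := Prod.mk.inj (Option.some.inj hn)
    exact h θ hok hL

theorem Derivable.sound {P : J → Prop} {R : List (ℕ → Option (List J × J))}
    (hR : ∀ r ∈ R, Preserves P r) {j : J} (h : Derivable (systemOf R) j) : P j := by
  have key : ∀ R : List (ℕ → Option (List J × J)), (∀ r ∈ R, Preserves P r) →
      Preserves P (systemOf R) := by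
    intro R hR
    induction R with
    | nil =>
      intro n L j h
      simp [systemOf] at h
    | cons r R ih =>
      intro n L j h hL
      rw [systemOf] at h
      split_ifs at h
      · exact hR r List.mem_cons_self _ _ _ h hL
      · exact ih (fun r hr => hR r (List.mem_cons_of_mem _ hr)) _ _ _ h hL
  induction h with
  | step h _ ih => exact key R hR _ _ _ h ih

/-- The conclusions of those instances of rules in a list whose premises are among the conclusions
of later members of the list. -/
noncomputable def derived (ρ : ℕ → Option (List J × J)) (l : List ℕ) : List J :=
  open scoped Classical in
  l.foldr (fun n D => (ρ n).elim D fun r => if ∀ x ∈ r.1, x ∈ D then r.2 :: D else D) []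

open scoped Classical in
theorem computable_derived {ρ : ℕ → Option (List J × J)} (h : Computable ρ) :
    Computable (derived ρ) :=
  Comp.foldr Comp.id (Comp.const _) (Comp.option_elim (by fun_prop) (by fun_prop)
    (Comp.ite (by fun_prop) (by fun_prop) (by fun_prop)))

theorem derived_cons_subset (ρ : ℕ → Option (List J × J)) (n : ℕ) (l : List ℕ) :
    derived ρ l ⊆ derived ρ (n :: l) := by
  intro j hj
  rw [derived, List.foldr_cons, ← derived]
  cases ρ n with
  | none => exact hj
  | some r =>
    rw [Option.elim_some]
    split_ifs
    · exact List.mem_cons_of_mem _ hj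
    · exact hj

theorem mem_derived_cons {ρ : ℕ → Option (List J × J)} {n : ℕ} {L : List J} {j : J} {l : List ℕ}
    (h : ρ n = some (L, j)) (hL : ∀ x ∈ L, x ∈ derived ρ l) : j ∈ derived ρ (n :: l) := by
  rw [derived, List.foldr_cons, ← derived, h, Option.elim_some, if_pos hL]
  exact List.mem_cons_self

theorem derivable_of_mem_derived {ρ : ℕ → Option (List J × J)} {l : List ℕ} {j : J}
    (h : j ∈ derived ρ l) : Derivable ρ j := by
  induction l generalizing j with
  | nil => simp [derived] at h
  | cons n l ih =>
    rw [derived, List.foldr_cons, ← derived] at h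
    cases hn : ρ n with
    | none =>
      rw [hn, Option.elim_none] at h
      exact ih h
    | some r =>
      rw [hn, Option.elim_some] at h
      split_ifs at h with hr
      · rcases List.mem_cons.1 h with rfl | h
        · exact .step hn fun x hx => ih (hr x hx)
        · exact ih h
      · exact ih h

theorem derived_append_subset_left (ρ : ℕ → Option (List J × J)) (l l' : List ℕ) :
    derived ρ l ⊆ derived ρ (l ++ l') := by
  induction l with
  | nil => simp [derived]
  | cons n l ih =>
    intro j h
    rw [derived, List.foldr_cons, ← derived] at h
    cases hn : ρ n with
    | none =>
      rw [hn, Option.elim_none] at h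
      exact derived_cons_subset ρ n _ (ih h)
    | some r =>
      rw [hn, Option.elim_some] at h
      split_ifs at h with hr
      · rcases List.mem_cons.1 h with rfl | h
        · exact mem_derived_cons hn fun x hx => ih (hr x hx)
        · exact derived_cons_subset ρ n _ (ih h)
      · exact derived_cons_subset ρ n _ (ih h)

theorem derived_append_subset_right (ρ : ℕ → Option (List J × J)) (l l' : List ℕ) :
    derived ρ l' ⊆ derived ρ (l ++ l') := by
  induction l with
  | nil => exact fun _ h => h
  | cons n l ih => exact fun j h => derived_cons_subset ρ n _ (ih h)

theorem exists_subset_derived {ρ : ℕ → Option (List J × J)} {L : List J}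
    (h : ∀ j ∈ L, ∃ l, j ∈ derived ρ l) : ∃ l, L ⊆ derived ρ l := by
  induction L with
  | nil => exact ⟨[], List.nil_subset _⟩
  | cons j L ih =>
    obtain ⟨l, hl⟩ := h j List.mem_cons_self
    obtain ⟨l', hl'⟩ := ih fun x hx => h x (List.mem_cons_of_mem _ hx)
    refine ⟨l ++ l', fun x hx => ?_⟩
    rcases List.mem_cons.1 hx with rfl | hx
    · exact derived_append_subset_left ρ l l' hl
    · exact derived_append_subset_right ρ l l' (hl' hx)

theorem Derivable.exists_derived {ρ : ℕ → Option (List J × J)} {j : J} (h : Derivable ρ j) :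
    ∃ l, j ∈ derived ρ l := by
  induction h with
  | step h _ ih =>
    obtain ⟨l, hl⟩ := exists_subset_derived ih
    exact ⟨_ :: l, mem_derived_cons h hl⟩

end Inference

/-! ### Homomorphisms, unions and chains of automata -/

namespace Aut

section Hom

variable {K X S S' S'' : Type*} [Field K] [DecidableEq X] [Fintype S] [Fintype S'] [Fintype S'']
  [DecidableEq S] [DecidableEq S']

/-- A map of states that preserves labels and final weights, and adds up transition weights. -/
def IsHom (φ : S' → S) (A' : Aut K X S') (A : Aut K X S) : Prop :=
  ∀ i, A.lab (φ i) = A'.lab i ∧ A.γ (φ i) = A'.γ i ∧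
    ∀ j, A.M (φ i) j = ∑ j', if φ j' = j then A'.M i j' else 0

theorem IsHom.ser_eq {φ : S' → S} {A' : Aut K X S'} {A : Aut K X S} (h : IsHom φ A' A) (i : S') :
    A.ser (φ i) = A'.ser i := by
  refine congrFun (ser_unique A' (f := fun i => A.ser (φ i)) (fun i => ?_) fun i y g hg => ?_) i
  · rw [ser_one]
    exact (h i).2.1
  · rw [ser_letter_mul _ _ hg]
    have h1 : ∀ j, (if A.lab j = some y then A.M (φ i) j * A.ser j g else 0) =
        ∑ j', if φ j' = j then (if A.lab j = some y then A'.M i j' * A.ser j g else 0) else 0 := by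
      intro j
      split_ifs with hl
      · rw [(h i).2.2 j, Finset.sum_mul]
        exact Finset.sum_congr rfl fun j' _ => by rw [ite_mul, zero_mul]
      · simp
    rw [Finset.sum_congr rfl fun j _ => h1 j, Finset.sum_comm]
    refine Finset.sum_congr rfl fun j' _ => ?_
    rw [Finset.sum_ite_eq, if_pos (Finset.mem_univ _), (h j').1]

/-- The disjoint union of two automata. -/
def union (A : Aut K X S) (B : Aut K X S') : Aut K X (S ⊕ S') where
  lab := Sum.elim A.lab B.lab
  M := Sum.elim (fun i => Sum.elim (A.M i) fun _ => 0) fun i => Sum.elim (fun _ => 0) (B.M i)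
  γ := Sum.elim A.γ B.γ

/-- Two automata with potentials embed into a common one. -/
theorem exists_union {N : Submonoid (FreeGroup X)} {n n' : ℕ} {A : Aut K X (Fin n)}
    {B : Aut K X (Fin n')} {P : Fin n → Finset (FreeGroup X)} {Q : Fin n' → Finset (FreeGroup X)}
    (hA : A.Typed) (hB : B.Typed) (hP : A.Pot N P) (hQ : B.Pot N Q) :
    ∃ (m : ℕ) (D : Aut K X (Fin m)) (R : Fin m → Finset (FreeGroup X)) (φ : Fin n → Fin m)
      (ψ : Fin n' → Fin m), D.Typed ∧ D.Pot N R ∧ IsHom φ A D ∧ IsHom ψ B D := by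
  let e : Fin (n + n') ≃ Fin n ⊕ Fin n' := finSumFinEquiv.symm
  refine ⟨n + n', (A.union B).reindex e, fun i => Sum.elim P Q (e i), fun i => e.symm (.inl i),
    fun i => e.symm (.inr i), ?_, ⟨?_, ?_⟩, fun i => ⟨?_, ?_, fun j => ?_⟩,
    fun i => ⟨?_, ?_, fun j => ?_⟩⟩
  · intro i j h
    change (A.union B).M (e i) (e j) ≠ 0 at h
    change ∃ y, (A.union B).lab (e j) = some y ∧ (A.union B).lab (e i) ≠ some (bar y)
    generalize e i = i at *
    generalize e j = j at *
    rcases i with i | i <;> rcases j with j | j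
    · exact hA i j h
    · exact absurd rfl h
    · exact absurd rfl h
    · exact hB i j h
  · intro i
    dsimp only
    generalize e i = i
    rcases i with i | i
    · exact hP.1 i
    · exact hQ.1 i
  · intro i j y h hy
    change (A.union B).M (e i) (e j) ≠ 0 at h
    change (A.union B).lab (e j) = some y at hy
    dsimp only
    generalize e i = i at *
    generalize e j = j at *
    rcases i with i | i <;> rcases j with j | j
    · exact hP.2 i j y h hy
    · exact absurd rfl h
    · exact absurd rfl h
    · exact hQ.2 i j y h hy
  · simp [reindex, union]
  · simp [reindex, union]
  · obtain ⟨j, rfl⟩ := e.symm.surjective j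
    rcases j with j | j <;> simp [reindex, union]
  · simp [reindex, union]
  · simp [reindex, union]
  · obtain ⟨j, rfl⟩ := e.symm.surjective j
    rcases j with j | j <;> simp [reindex, union]

end Hom

section Chain

variable {K X : Type*} [Field K] [DecidableEq X]

/-- The automaton that reads the word `W` only, with weight `a`. -/
def chain (a : K) (W : List (X × Bool)) : Aut K X (Fin (W.length + 1)) where
  lab i := (none :: W.map some).getD i none
  M i j := if (j : ℕ) = i + 1 then 1 else 0
  γ i := if (i : ℕ) = W.length then a else 0

theorem getD_chain_succ (W : List (X × Bool)) (i : ℕ) :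
    (none :: W.map some).getD (i + 1) none = W[i]? := by
  rw [List.getD_cons_succ, List.getD_eq_getElem?_getD, List.getElem?_map]
  cases W[i]? <;> rfl

theorem ev_chain (a : K) (W v : List (X × Bool)) (i : Fin (W.length + 1)) :
    (chain a W).ev v i = if v = W.drop i then a else 0 := by
  induction v generalizing i with
  | nil =>
    change (if (i : ℕ) = W.length then a else 0) = _
    have : ([] = W.drop i) ↔ (i : ℕ) = W.length := by
      rw [eq_comm, List.drop_eq_nil_iff]
      omega
    simp only [this]
  | cons y v ih =>
    rw [ev]
    by_cases hi : (i : ℕ) < W.length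
    · rw [Finset.sum_eq_single (⟨i + 1, by omega⟩ : Fin (W.length + 1))]
      · have h1 : (chain a W).lab ⟨i + 1, by omega⟩ = some W[(i : ℕ)] :=
          (getD_chain_succ W i).trans (List.getElem?_eq_getElem hi)
        have h2 : (chain a W).M i ⟨i + 1, by omega⟩ = 1 := if_pos rfl
        rw [h1, h2, ih, one_mul, List.drop_eq_getElem_cons hi]
        by_cases hy : W[(i : ℕ)] = y
        · rw [hy, if_pos rfl]
          simp only [List.cons.injEq, true_and]
        · rw [if_neg (by simpa using hy), if_neg]
          exact fun h => hy (List.cons.inj h).1.symm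
      · intro j _ hj
        have : (chain a W).M i j = 0 := if_neg fun h => hj (Fin.ext h)
        rw [this, zero_mul, ite_self]
      · simp
    · rw [List.drop_eq_nil_of_le (by omega), if_neg (by simp)]
      refine Finset.sum_eq_zero fun j _ => ?_
      have : (chain a W).M i j = 0 := if_neg (by omega)
      rw [this, zero_mul, ite_self]

theorem ser_chain (a : K) {W : List (X × Bool)} (hW : FreeGroup.IsReduced W) :
    (chain a W).ser 0 = Ser.monomial a (FreeGroup.mk W) := by
  funext g
  rw [ser, ev_chain, Ser.monomial]
  have : g.toWord = W.drop ((0 : Fin (W.length + 1)) : ℕ) ↔ g = FreeGroup.mk W := by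
    rw [Fin.val_zero, List.drop_zero]
    constructor
    · rintro rfl
      exact FreeGroup.mk_toWord.symm
    · rintro rfl
      exact hW.reduce_eq
  simp only [this]

theorem typed_chain (a : K) {W : List (X × Bool)} (hW : FreeGroup.IsReduced W) :
    (chain a W).Typed := by
  intro i j h
  have hj : (j : ℕ) = i + 1 := by
    by_contra hne
    exact h (if_neg hne)
  have hi : (i : ℕ) < W.length := by omega
  refine ⟨W[(i : ℕ)], ?_, ?_⟩
  · change (none :: W.map some).getD (j : ℕ) none = _
    rw [hj, getD_chain_succ, List.getElem?_eq_getElem hi]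
  · change (none :: W.map some).getD (i : ℕ) none ≠ _
    have key : ∀ k (hk : k < W.length), (none :: W.map some).getD k none ≠ some (bar W[k]) := by
      rintro (_ | k) hk
      · simp
      · rw [getD_chain_succ, List.getElem?_eq_getElem (by omega)]
        have h1 := List.isChain_iff_getElem.1 hW k (by omega)
        intro h2
        have h2 := Option.some.inj h2
        rw [h2] at h1
        simpa [bar] using h1 rfl
    exact key i hi

theorem pot_chain (a : K) (W : List (X × Bool)) (N : Submonoid (FreeGroup X)) :
    (chain a W).Pot N fun i => {FreeGroup.mk (W.drop i)} := by
  refine ⟨fun i => Finset.singleton_nonempty _, fun i j y h hy q hq => ?_⟩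
  have hj : (j : ℕ) = i + 1 := by
    by_contra hne
    exact h (if_neg hne)
  have hi : (i : ℕ) < W.length := by omega
  rw [Finset.mem_singleton] at hq
  subst hq
  refine ⟨_, Finset.mem_singleton_self _, ?_⟩
  have hy : (none :: W.map some).getD (j : ℕ) none = some y := hy
  rw [hj, getD_chain_succ, List.getElem?_eq_getElem hi] at hy
  rw [List.drop_eq_getElem_cons hi, Option.some.inj hy, hj, mk_cons]
  exact rel_refl _

end Chain

end Aut

/-! ### Tables -/

/-- Finite automata as finite objects: the number of states, the labels, the rows of the transition
matrix, and the final weights. Missing entries count as `none` or `0`. -/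
abbrev Table (K X : Type*) := ℕ × List (Option (X × Bool)) × List (List K) × List K

section Table

variable {K X : Type*} [Field K] [DecidableEq X]

/-- The entries of a matrix given by the list of its rows; missing entries are `0`. -/
def mat (B : List (List K)) (i j : ℕ) : K := (B.getD i []).getD j 0

/-- The list of the rows of a matrix. -/
def rows {n m : ℕ} (B : Fin n → Fin m → K) : List (List K) :=
  List.ofFn fun i => List.ofFn (B i)

theorem getD_ofFn {α : Type*} {n : ℕ} (f : Fin n → α) (d : α) (i : Fin n) :
    (List.ofFn f).getD i d = f i := by
  simp [List.getD_eq_getElem?_getD]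

@[simp]
theorem mat_rows {n m : ℕ} (B : Fin n → Fin m → K) (i : Fin n) (j : Fin m) :
    mat (rows B) i j = B i j := by
  rw [mat, rows, getD_ofFn, getD_ofFn]

namespace Table

/-- The labels of a table. -/
def lab (T : Table K X) (i : ℕ) : Option (X × Bool) := T.2.1.getD i none

/-- The transition weights of a table. -/
def M (T : Table K X) (i j : ℕ) : K := mat T.2.2.1 i j

/-- The final weights of a table. -/
def γ (T : Table K X) (i : ℕ) : K := T.2.2.2.getD i 0

/-- The automaton of a table. -/
def aut (T : Table K X) : Aut K X (Fin T.1) where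
  lab i := T.lab i
  M i j := T.M i j
  γ i := T.γ i

end Table

/-- The table of an automaton. -/
def Aut.table {n : ℕ} (A : Aut K X (Fin n)) : Table K X :=
  (n, List.ofFn A.lab, rows A.M, List.ofFn A.γ)

@[simp]
theorem Aut.lab_table {n : ℕ} (A : Aut K X (Fin n)) (i : Fin n) : A.table.lab i = A.lab i :=
  getD_ofFn A.lab none i

@[simp]
theorem Aut.M_table {n : ℕ} (A : Aut K X (Fin n)) (i j : Fin n) : A.table.M i j = A.M i j :=
  mat_rows A.M i j

@[simp]
theorem Aut.γ_table {n : ℕ} (A : Aut K X (Fin n)) (i : Fin n) : A.table.γ i = A.γ i :=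
  getD_ofFn A.γ 0 i

theorem Aut.ext' {S : Type*} {A B : Aut K X S} (h1 : ∀ i, A.lab i = B.lab i)
    (h2 : ∀ i j, A.M i j = B.M i j) (h3 : ∀ i, A.γ i = B.γ i) : A = B := by
  obtain ⟨l, M, γ⟩ := A
  obtain ⟨l', M', γ'⟩ := B
  obtain rfl : l = l' := funext h1
  obtain rfl : M = M' := funext fun i => funext (h2 i)
  obtain rfl : γ = γ' := funext h3
  rfl

theorem Aut.aut_table {n : ℕ} (A : Aut K X (Fin n)) : A.table.aut = A :=
  Aut.ext' A.lab_table A.M_table A.γ_table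

namespace Table

/-- The automaton of the table `T` is typed. -/
def Typed (T : Table K X) : Prop :=
  ∀ i < T.1, ∀ j < T.1, T.M i j ≠ 0 → ∃ y ∈ (T.lab j).toList, T.lab i ≠ some (bar y)

theorem typed_iff (T : Table K X) : T.Typed ↔ T.aut.Typed := by
  simp [Typed, Aut.Typed, aut, Fin.forall_iff]

/-- The matrix `C` solves the equation for the cancelling parts in products with the series of
the state `b`. -/
def CancelEq (T : Table K X) (b : ℕ) (C : List (List K)) : Prop :=
  ∀ i < T.1, ∀ t < T.1, mat C i t = (if t = b then T.γ i else 0) +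
    ∑ j ∈ Finset.range T.1, ∑ s ∈ Finset.range T.1,
      if (T.lab j).map bar = T.lab t then T.M i j * mat C j s * T.M s t else 0

theorem cancelEq_iff (T : Table K X) (b : Fin T.1) (C : List (List K)) :
    T.CancelEq b C ↔ T.aut.CancelEq b fun i j => mat C i j := by
  simp only [CancelEq, Aut.CancelEq, aut, Fin.forall_iff, Finset.sum_range, Fin.ext_iff]
  refine forall₄_congr fun i _ t _ => ?_
  split_ifs <;> rfl

/-- The matrix `B` certifies that the linear combination of the series of the states with the
coefficients `v` vanishes. -/
def ZeroCert (T : Table K X) (v : ℕ → K) (B : List (List K)) : Prop :=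
  (∀ k < T.1, ∑ i ∈ Finset.range T.1, v i * mat B i k = v k) ∧
  (∀ l < T.1, ∀ i < T.1, ∀ k < T.1, (∑ j ∈ Finset.range T.1, if T.lab j = T.lab l then
      (∑ h ∈ Finset.range T.1, mat B i h * T.M h j) * mat B j k else 0) =
    if T.lab k = T.lab l then ∑ h ∈ Finset.range T.1, mat B i h * T.M h k else 0) ∧
  ∀ i < T.1, ∑ k ∈ Finset.range T.1, mat B i k * T.γ k = 0

theorem zeroCert_iff (T : Table K X) (v : ℕ → K) (B : List (List K)) :
    T.ZeroCert v B ↔ T.aut.ZeroCert (fun i => v i) fun i j => mat B i j := by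
  simp [ZeroCert, Aut.ZeroCert, aut, Fin.forall_iff, Finset.sum_range]

/-- The list `φ` represents a homomorphism between the automata of two tables. -/
def IsHom (φ : List ℕ) (T' T : Table K X) : Prop :=
  ∀ i < T'.1, φ.getD i 0 < T.1 ∧ T.lab (φ.getD i 0) = T'.lab i ∧ T.γ (φ.getD i 0) = T'.γ i ∧
    ∀ j < T.1, T.M (φ.getD i 0) j =
      ∑ j' ∈ Finset.range T'.1, if φ.getD j' 0 = j then T'.M i j' else 0

theorem IsHom.ser_eq {φ : List ℕ} {T' T : Table K X} (h : IsHom φ T' T) (i : Fin T'.1) :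
    T.aut.ser ⟨φ.getD i 0, (h i i.2).1⟩ = T'.aut.ser i := by
  refine Aut.IsHom.ser_eq (φ := fun i : Fin T'.1 => (⟨φ.getD i 0, (h i i.2).1⟩ : Fin T.1))
    (A' := T'.aut) (A := T.aut) (fun i => ⟨(h i i.2).2.1, (h i i.2).2.2.1, fun j => ?_⟩) i
  refine ((h i i.2).2.2.2 j j.2).trans ?_
  rw [Finset.sum_range]
  simp only [Fin.ext_iff]
  rfl

theorem isHom_table {n n' : ℕ} {A' : Aut K X (Fin n')} {A : Aut K X (Fin n)} {φ : Fin n' → Fin n}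
    (h : Aut.IsHom φ A' A) : IsHom (List.ofFn fun i => (φ i : ℕ)) A'.table A.table := by
  intro i hi
  obtain ⟨i, rfl⟩ : ∃ k : Fin n', (k : ℕ) = i := ⟨⟨i, hi⟩, rfl⟩
  rw [getD_ofFn]
  refine ⟨(φ i).2, by simpa using (h i).1, by simpa using (h i).2.1, fun j hj => ?_⟩
  obtain ⟨j, rfl⟩ : ∃ k : Fin n, (k : ℕ) = j := ⟨⟨j, hj⟩, rfl⟩
  rw [Aut.M_table, (h i).2.2 j, Finset.sum_range]
  refine Finset.sum_congr rfl fun (j' : Fin n') _ => ?_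
  rw [getD_ofFn, Aut.M_table]
  simp only [Fin.ext_iff]

/-- The table `D` describes the product automaton. -/
def IsProd (T : Table K X) (C : List (List K)) (D : Table K X) : Prop :=
  D.1 = T.1 + T.1 ∧ ∀ i < T.1, D.lab i = T.lab i ∧ D.lab (T.1 + i) = T.lab i ∧
    D.γ i = ∑ t ∈ Finset.range T.1, mat C i t * T.γ t ∧ D.γ (T.1 + i) = T.γ i ∧
    ∀ j < T.1, D.M i j = T.M i j ∧ D.M (T.1 + i) j = 0 ∧ D.M (T.1 + i) (T.1 + j) = T.M i j ∧
      D.M i (T.1 + j) = if T.lab i = (T.lab j).map bar then 0 else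
        ∑ s ∈ Finset.range T.1, mat C i s * T.M s j

theorem IsProd.exists_equiv {T D : Table K X} {C : List (List K)} (h : IsProd T C D) :
    ∃ e : Fin T.1 ⊕ Fin T.1 ≃ Fin D.1, (∀ i, (e (.inl i) : ℕ) = i) ∧
      (∀ i, (e (.inr i) : ℕ) = T.1 + i) ∧
      D.aut.reindex e = T.aut.prodAut fun i j => mat C i j := by
  obtain ⟨m, D⟩ := D
  obtain ⟨hm, h⟩ := h
  obtain rfl : m = T.1 + T.1 := hm
  refine ⟨finSumFinEquiv, fun i => rfl, fun i => rfl, Aut.ext' ?_ ?_ ?_⟩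
  · rintro (i | i)
    · exact (h i i.2).1
    · exact (h i i.2).2.1
  · rintro (i | i) (j | j)
    · exact ((h i i.2).2.2.2.2 j j.2).1
    · refine ((h i i.2).2.2.2.2 j j.2).2.2.2.trans ?_
      rw [Finset.sum_range]
      rfl
    · exact ((h i i.2).2.2.2.2 j j.2).2.1
    · exact ((h i i.2).2.2.2.2 j j.2).2.2.1
  · rintro (i | i)
    · refine (h i i.2).2.2.1.trans ?_
      rw [Finset.sum_range]
      rfl
    · exact (h i i.2).2.2.2.1

theorem isProd_table {n : ℕ} (A : Aut K X (Fin n)) (C : Fin n → Fin n → K) :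
    IsProd A.table (rows C) ((A.prodAut C).reindex finSumFinEquiv.symm).table := by
  let D := (A.prodAut C).reindex finSumFinEquiv.symm
  have hl : ∀ i : Fin n, finSumFinEquiv.symm (Fin.castAdd n i) = .inl i :=
    finSumFinEquiv_symm_apply_castAdd
  have hr : ∀ i : Fin n, finSumFinEquiv.symm (Fin.natAdd n i) = .inr i :=
    finSumFinEquiv_symm_apply_natAdd
  refine ⟨rfl, fun i hi => ?_⟩
  obtain ⟨i, rfl⟩ : ∃ k : Fin n, (k : ℕ) = i := ⟨⟨i, hi⟩, rfl⟩
  refine ⟨(D.lab_table (Fin.castAdd n i)).trans ?_, (D.lab_table (Fin.natAdd n i)).trans ?_,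
    (D.γ_table (Fin.castAdd n i)).trans ?_, (D.γ_table (Fin.natAdd n i)).trans ?_, fun j hj => ?_⟩
  · rw [A.lab_table]
    exact congrArg (A.prodAut C).lab (hl i)
  · rw [A.lab_table]
    exact congrArg (A.prodAut C).lab (hr i)
  · refine (congrArg (A.prodAut C).γ (hl i)).trans ?_
    rw [Finset.sum_range]
    change (∑ t, C i t * A.γ t) = _
    exact Finset.sum_congr rfl fun t _ => congrArg₂ _ (mat_rows C i t).symm (A.γ_table t).symm
  · rw [A.γ_table]
    exact congrArg (A.prodAut C).γ (hr i)
  · obtain ⟨j, rfl⟩ : ∃ k : Fin n, (k : ℕ) = j := ⟨⟨j, hj⟩, rfl⟩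
    refine ⟨(D.M_table (Fin.castAdd n i) (Fin.castAdd n j)).trans ?_,
      (D.M_table (Fin.natAdd n i) (Fin.castAdd n j)).trans ?_,
      (D.M_table (Fin.natAdd n i) (Fin.natAdd n j)).trans ?_,
      (D.M_table (Fin.castAdd n i) (Fin.natAdd n j)).trans ?_⟩
    · rw [A.M_table]
      exact congrArg₂ (A.prodAut C).M (hl i) (hl j)
    · exact congrArg₂ (A.prodAut C).M (hr i) (hl j)
    · rw [A.M_table]
      exact congrArg₂ (A.prodAut C).M (hr i) (hr j)
    · refine (congrArg₂ (A.prodAut C).M (hl i) (hr j)).trans ?_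
      rw [A.lab_table, A.lab_table, Finset.sum_range]
      change (if A.lab i = (A.lab j).map bar then 0 else ∑ s, C i s * A.M s j) = _
      congr 1
      exact Finset.sum_congr rfl fun t _ => congrArg₂ _ (mat_rows C i t).symm (A.M_table t j).symm

/-- The table `T` describes the automaton that reads the word `W` only. -/
def IsChain (a : K) (W : List (X × Bool)) (T : Table K X) : Prop :=
  T.1 = W.length + 1 ∧ ∀ i < T.1, T.lab i = (none :: W.map some).getD i none ∧
    T.γ i = (if i = W.length then a else 0) ∧ ∀ j < T.1, T.M i j = if j = i + 1 then 1 else 0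

theorem IsChain.ser_eq {a : K} {W : List (X × Bool)} {T : Table K X} (h : IsChain a W T)
    (hW : FreeGroup.IsReduced W) :
    ∃ h : 0 < T.1, T.aut.ser ⟨0, h⟩ = Ser.monomial a (FreeGroup.mk W) := by
  obtain ⟨m, T⟩ := T
  obtain ⟨hm, h⟩ := h
  obtain rfl : m = W.length + 1 := hm
  refine ⟨Nat.succ_pos _, ?_⟩
  rw [← Aut.ser_chain a hW]
  congr 1
  exact Aut.ext' (fun i => (h i i.2).1) (fun i j => (h i i.2).2.2 j j.2) fun i => (h i i.2).2.1

theorem isChain_table (a : K) (W : List (X × Bool)) : IsChain a W (Aut.chain a W).table := by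
  refine ⟨rfl, fun i hi => ?_⟩
  obtain ⟨i, rfl⟩ : ∃ k : Fin (W.length + 1), (k : ℕ) = i := ⟨⟨i, hi⟩, rfl⟩
  refine ⟨by simp [Aut.chain], by simp [Aut.chain], fun j hj => ?_⟩
  obtain ⟨j, rfl⟩ : ∃ k : Fin (W.length + 1), (k : ℕ) = j := ⟨⟨j, hj⟩, rfl⟩
  simp [Aut.chain]

end Table

end Table

/-! ### Decidability of the conditions on tables -/

namespace Comp

variable {α β σ : Type*} [Primcodable α] [Primcodable β] [Primcodable σ]

@[fun_prop] theorem option_map {f : α → Option β} {g : α → β → σ} (hf : Computable f)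
    (hg : Computable fun x : α × β => g x.1 x.2) : Computable fun x => (f x).map (g x) :=
  Computable.option_map hf hg.to₂

@[fun_prop] theorem bar {X : Type*} [Primcodable X] {f : α → X × Bool} (hf : Computable f) :
    Computable fun x => bar (f x) := by
  unfold MalcevNeumann.bar
  fun_prop

variable {K X : Type*} [Field K] [Primcodable K] [Primcodable X]

@[fun_prop] theorem mat {B : α → List (List K)} {i j : α → ℕ} (hB : Computable B)
    (hi : Computable i) (hj : Computable j) : Computable fun x => mat (B x) (i x) (j x) := by
  unfold MalcevNeumann.mat
  fun_prop

@[fun_prop] theorem lab {T : α → Table K X} {i : α → ℕ} (hT : Computable T) (hi : Computable i) :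
    Computable fun x => (T x).lab (i x) := by
  unfold Table.lab
  fun_prop

@[fun_prop] theorem M {T : α → Table K X} {i j : α → ℕ} (hT : Computable T) (hi : Computable i)
    (hj : Computable j) : Computable fun x => (T x).M (i x) (j x) := by
  unfold Table.M
  fun_prop

@[fun_prop] theorem gam {T : α → Table K X} {i : α → ℕ} (hT : Computable T) (hi : Computable i) :
    Computable fun x => (T x).γ (i x) := by
  unfold Table.γ
  fun_prop

@[fun_prop] theorem typed {T : α → Table K X} (hT : Computable T) :
    Decides fun x => (T x).Typed := by
  unfold Table.Typed
  fun_prop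

@[fun_prop] theorem isChain {a : α → K} {W : α → List (X × Bool)} {T : α → Table K X}
    (ha : Computable a) (hW : Computable W) (hT : Computable T) :
    Decides fun x => (T x).IsChain (a x) (W x) := by
  unfold Table.IsChain
  fun_prop

variable [Fact (IsComputableField K)]

@[fun_prop] theorem cancelEq [DecidableEq X] {T : α → Table K X} {b : α → ℕ}
    {C : α → List (List K)} (hT : Computable T) (hb : Computable b) (hC : Computable C) :
    Decides fun x => (T x).CancelEq (b x) (C x) := by
  unfold Table.CancelEq
  fun_prop

@[fun_prop] theorem zeroCert [DecidableEq X] {T : α → Table K X} {v : α → ℕ → K}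
    {B : α → List (List K)} (hT : Computable T) (hv : Computable fun x : α × ℕ => v x.1 x.2)
    (hB : Computable B) : Decides fun x => (T x).ZeroCert (v x) (B x) := by
  unfold Table.ZeroCert
  fun_prop

@[fun_prop] theorem isHom [DecidableEq X] {T T' : α → Table K X} {φ : α → List ℕ}
    (hφ : Computable φ) (hT' : Computable T') (hT : Computable T) :
    Decides fun x => Table.IsHom (φ x) (T' x) (T x) := by
  unfold Table.IsHom
  fun_prop

@[fun_prop] theorem isProd [DecidableEq X] {T D : α → Table K X} {C : α → List (List K)}
    (hT : Computable T) (hC : Computable C) (hD : Computable D) :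
    Decides fun x => (T x).IsProd (C x) (D x) := by
  unfold Table.IsProd
  fun_prop

end Comp

/-! ### The inference system -/

section System

variable {K X : Type*} [Field K] [DecidableEq X]

namespace Table

/-- The weights of a word read from the states of a table. -/
def evs (T : Table K X) (w : List (X × Bool)) : List K :=
  w.foldr (fun y v => (List.range T.1).map fun i => ∑ j ∈ Finset.range T.1,
    if T.lab j = some y then T.M i j * v.getD j 0 else 0) ((List.range T.1).map T.γ)

theorem getD_map_range (n : ℕ) (f : ℕ → K) {i : ℕ} (hi : i < n) :
    ((List.range n).map f).getD i 0 = f i := by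
  simp [List.getD_eq_getElem?_getD, hi]

theorem getD_evs (T : Table K X) (w : List (X × Bool)) (i : Fin T.1) :
    (T.evs w).getD i 0 = T.aut.ev w i := by
  induction w generalizing i with
  | nil => exact getD_map_range _ _ i.2
  | cons y w ih =>
    refine (getD_map_range _ _ i.2).trans ?_
    rw [Finset.sum_range]
    exact Finset.sum_congr rfl fun j _ => by rw [← evs, ih]; rfl

/-- The condition under which the positivity of the words in the list `L` ensures that the list
`P` of lists of words gives potentials for the table `T`. -/
def PotCert (T : Table K X) (P : List (List (List (X × Bool)))) (L : List (List (X × Bool))) :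
    Prop :=
  (∀ i < T.1, P.getD i [] ≠ []) ∧ ∀ i < T.1, ∀ j < T.1, T.M i j ≠ 0 → ∀ y ∈ (T.lab j).toList,
    ∀ q ∈ P.getD j [], ∃ p ∈ P.getD i [], FreeGroup.invRev p ++ y :: q ∈ L

end Table

/-- The coefficients of a linear relation between the series of at most three states. -/
def relVec (i : ℕ) (j : Option ℕ) (k l : ℕ) : K :=
  (if l = i then 1 else 0) + (if some l = j then 1 else 0) - if l = k then 1 else 0

/-- The condition under which, for a typed automaton with potentials, the series of the state `k` is
the product of the series of the states `i` and `b`, plus that of the state `j` if there is one. -/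
def Table.MulCert (T D : Table K X) (C B : List (List K)) (i b : ℕ) (j : Option ℕ) (k : ℕ) : Prop :=
  k < T.1 ∧ T.lab i = none ∧ T.CancelEq b C ∧ T.IsProd C D ∧
    D.ZeroCert (relVec i (j.map (T.1 + ·)) (T.1 + k)) B

/-- The judgements of the inference system on an expression, given by its string of symbols: for a
word, that the word represents a positive element; for a table, that it satisfies the conditions on
automata; for a table and a state, that the series of the state is the value of the expression. All
judgements are relative to the assumption that the expression is a rational Malcev–Neumann
expression. -/
abbrev Judgement (K X : Type*) :=
  List (Token K X) × (List (X × Bool) ⊕ Table K X × Option ℕ)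

section Rules

variable (K X) [Primcodable K] [Primcodable X]

/-- The empty word is positive for each monomial. -/
def posAtom : ℕ → Option (List (Judgement K X) × Judgement K X) :=
  ruleOf (Θ := K × List (X × Bool)) (fun _ => []) (fun θ => ([.inl θ], .inl [])) fun _ => True

/-- Products of positive words for two expressions are positive for their sum and product. The
symbols `0`, `1` and `2` stand for the sum, the product and the star. -/
def posBin : ℕ → Option (List (Judgement K X) × Judgement K X) :=
  ruleOf (Θ := Fin 3 × (List (Token K X) × List (X × Bool)) × List (Token K X) × List (X × Bool))
    (fun θ => [(θ.2.1.1, .inl θ.2.1.2), (θ.2.2.1, .inl θ.2.2.2)])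
    (fun θ => (.inr θ.1 :: (θ.2.1.1 ++ θ.2.2.1), .inl (θ.2.1.2 ++ θ.2.2.2)))
    fun θ => θ.1 ≠ 2

/-- Positive words for an expression are positive for its star. -/
def posStar : ℕ → Option (List (Judgement K X) × Judgement K X) :=
  ruleOf (Θ := List (Token K X) × List (X × Bool)) (fun θ => [(θ.1, .inl θ.2)])
    (fun θ => (.inr 2 :: θ.1, .inl θ.2)) fun _ => True

/-- The support of the body of a star is positive. -/
def posBody : ℕ → Option (List (Judgement K X) × Judgement K X) :=
  ruleOf (Θ := List (Token K X) × Table K X × ℕ × List (X × Bool))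
    (fun θ => [(θ.1, .inr (θ.2.1, some θ.2.2.1))])
    (fun θ => (.inr 2 :: θ.1, .inl θ.2.2.2))
    fun θ => (θ.2.1.evs (FreeGroup.reduce θ.2.2.2)).getD θ.2.2.1 0 ≠ 0

/-- Inserting a positive word into a positive word results in a positive word. -/
def posIns : ℕ → Option (List (Judgement K X) × Judgement K X) :=
  ruleOf (Θ := List (Token K X) × List (X × Bool) × List (X × Bool) × List (X × Bool))
    (fun θ => [(θ.1, .inl (θ.2.1 ++ θ.2.2.2)), (θ.1, .inl θ.2.2.1)])
    (fun θ => (θ.1, .inl (θ.2.1 ++ θ.2.2.1 ++ θ.2.2.2))) fun _ => True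

/-- Words that represent the same element are positive together. -/
def posRed : ℕ → Option (List (Judgement K X) × Judgement K X) :=
  ruleOf (Θ := List (Token K X) × List (X × Bool) × List (X × Bool))
    (fun θ => [(θ.1, .inl θ.2.1)]) (fun θ => (θ.1, .inl θ.2.2))
    fun θ => FreeGroup.reduce θ.2.1 = FreeGroup.reduce θ.2.2

/-- A typed automaton with potentials. The premise on the empty word ensures that the conclusion is
about an expression. -/
def potRule : ℕ → Option (List (Judgement K X) × Judgement K X) :=
  ruleOf (Θ := List (Token K X) × Table K X × List (List (List (X × Bool))) ×
      List (List (X × Bool)))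
    (fun θ => (θ.1, .inl []) :: θ.2.2.2.map fun w => (θ.1, .inl w))
    (fun θ => (θ.1, .inr (θ.2.1, none)))
    fun θ => θ.2.1.Typed ∧ θ.2.1.PotCert θ.2.2.1 θ.2.2.2

/-- The series of a monomial. The word is reduced in its automaton. -/
def valMono : ℕ → Option (List (Judgement K X) × Judgement K X) :=
  ruleOf (Θ := (K × List (X × Bool)) × Table K X) (fun _ => [])
    (fun θ => ([.inl θ.1], .inr (θ.2, some 0)))
    fun θ => θ.2.IsChain θ.1.1 (FreeGroup.reduce θ.1.2)

/-- Transfer of series along homomorphisms. -/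
def valHom : ℕ → Option (List (Judgement K X) × Judgement K X) :=
  ruleOf (Θ := List (Token K X) × Table K X × Table K X × List ℕ × ℕ)
    (fun θ => [(θ.1, .inr (θ.2.1, some θ.2.2.2.2))])
    (fun θ => (θ.1, .inr (θ.2.2.1, some (θ.2.2.2.1.getD θ.2.2.2.2 0))))
    fun θ => Table.IsHom θ.2.2.2.1 θ.2.1 θ.2.2.1

/-- The series of a sum. -/
def valAdd : ℕ → Option (List (Judgement K X) × Judgement K X) :=
  ruleOf (Θ := (List (Token K X) × ℕ) × (List (Token K X) × ℕ) × ℕ × Table K X × List (List K))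
    (fun θ => [(θ.1.1, .inr (θ.2.2.2.1, some θ.1.2)), (θ.2.1.1, .inr (θ.2.2.2.1, some θ.2.1.2))])
    (fun θ => (.inr 0 :: (θ.1.1 ++ θ.2.1.1), .inr (θ.2.2.2.1, some θ.2.2.1)))
    fun θ => θ.2.2.1 < θ.2.2.2.1.1 ∧
      θ.2.2.2.1.ZeroCert (relVec θ.1.2 (some θ.2.1.2) θ.2.2.1) θ.2.2.2.2

/-- The series of a product. -/
def valMul : ℕ → Option (List (Judgement K X) × Judgement K X) :=
  ruleOf (Θ := (List (Token K X) × ℕ) × (List (Token K X) × ℕ) × ℕ × Table K X × Table K X ×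
      List (List K) × List (List K))
    (fun θ => [(θ.1.1, .inr (θ.2.2.2.1, some θ.1.2)), (θ.2.1.1, .inr (θ.2.2.2.1, some θ.2.1.2)),
      (.inr 1 :: (θ.1.1 ++ θ.2.1.1), .inr (θ.2.2.2.1, none))])
    (fun θ => (.inr 1 :: (θ.1.1 ++ θ.2.1.1), .inr (θ.2.2.2.1, some θ.2.2.1)))
    fun θ => θ.2.2.2.1.MulCert θ.2.2.2.2.1 θ.2.2.2.2.2.1 θ.2.2.2.2.2.2 θ.1.2 θ.2.1.2 none θ.2.2.1

/-- The series of a star, as the solution `k` of the equation `k = i k + o`, where `o` represents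
the monomial `1`. -/
def valStar : ℕ → Option (List (Judgement K X) × Judgement K X) :=
  ruleOf (Θ := (List (Token K X) × ℕ) × ℕ × ℕ × Table K X × Table K X × List (List K) ×
      List (List K))
    (fun θ => [(θ.1.1, .inr (θ.2.2.2.1, some θ.1.2)),
      ([.inl (1, [])], .inr (θ.2.2.2.1, some θ.2.1)),
      (.inr 2 :: θ.1.1, .inr (θ.2.2.2.1, none))])
    (fun θ => (.inr 2 :: θ.1.1, .inr (θ.2.2.2.1, some θ.2.2.1)))
    fun θ => θ.2.2.2.1.MulCert θ.2.2.2.2.1 θ.2.2.2.2.2.1 θ.2.2.2.2.2.2 θ.1.2 θ.2.2.1 (some θ.2.1)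
      θ.2.2.1

/-- The rules of the inference system. -/
def rules : List (ℕ → Option (List (Judgement K X) × Judgement K X)) :=
  [posAtom K X, posBin K X, posStar K X, posBody K X, posIns K X, posRed K X, potRule K X,
    valMono K X, valHom K X, valAdd K X, valMul K X, valStar K X]

end Rules

/-! ### Computability of the rules -/

section Computability

variable [Primcodable K] [Primcodable X] [Fact (IsComputableField K)]

@[fun_prop] theorem Comp.evs {α : Type*} [Primcodable α] {T : α → Table K X}
    {w : α → List (X × Bool)} (hT : Computable T) (hw : Computable w) :
    Computable fun x => (T x).evs (w x) := by
  unfold Table.evs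
  fun_prop

@[fun_prop] theorem Comp.invRev {α : Type*} [Primcodable α] {w : α → List (X × Bool)}
    (hw : Computable w) : Computable fun x => FreeGroup.invRev (w x) := by
  unfold FreeGroup.invRev
  fun_prop

@[fun_prop] theorem Comp.potCert {α : Type*} [Primcodable α] {T : α → Table K X}
    {P : α → List (List (List (X × Bool)))} {L : α → List (List (X × Bool))}
    (hT : Computable T) (hP : Computable P) (hL : Computable L) :
    Decides fun x => (T x).PotCert (P x) (L x) := by
  unfold Table.PotCert
  fun_prop

@[fun_prop] theorem Comp.relVec {α : Type*} [Primcodable α] {i k l : α → ℕ} {j : α → Option ℕ}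
    (hi : Computable i) (hj : Computable j) (hk : Computable k) (hl : Computable l) :
    Computable fun x => (relVec (i x) (j x) (k x) (l x) : K) := by
  unfold MalcevNeumann.relVec
  fun_prop

@[fun_prop] theorem Comp.mulCert {α : Type*} [Primcodable α] {T D : α → Table K X}
    {C B : α → List (List K)} {i b k : α → ℕ} {j : α → Option ℕ} (hT : Computable T)
    (hD : Computable D) (hC : Computable C) (hB : Computable B) (hi : Computable i)
    (hb : Computable b) (hj : Computable j) (hk : Computable k) :
    Decides fun x => (T x).MulCert (D x) (C x) (B x) (i x) (b x) (j x) (k x) := by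
  unfold Table.MulCert
  fun_prop

@[fun_prop] theorem Comp.true {α : Type*} [Primcodable α] : Decides fun _ : α => True :=
  ⟨fun _ => Bool.true, by fun_prop, fun _ => by simp⟩

theorem computable_posAtom : Computable (posAtom K X) :=
  computable_ruleOf (by fun_prop) (by fun_prop) (by fun_prop)

theorem computable_posBin : Computable (posBin K X) :=
  computable_ruleOf (by fun_prop) (by fun_prop) (by fun_prop)

theorem computable_posStar : Computable (posStar K X) :=
  computable_ruleOf (by fun_prop) (by fun_prop) (by fun_prop)

theorem computable_posBody : Computable (posBody K X) :=
  computable_ruleOf (by fun_prop) (by fun_prop) (by fun_prop)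

theorem computable_posIns : Computable (posIns K X) :=
  computable_ruleOf (by fun_prop) (by fun_prop) (by fun_prop)

theorem computable_posRed : Computable (posRed K X) :=
  computable_ruleOf (by fun_prop) (by fun_prop) (by fun_prop)

theorem computable_potRule : Computable (potRule K X) :=
  computable_ruleOf (by fun_prop) (by fun_prop) (by fun_prop)

theorem computable_valMono : Computable (valMono K X) :=
  computable_ruleOf (by fun_prop) (by fun_prop) (by fun_prop)

theorem computable_valHom : Computable (valHom K X) :=
  computable_ruleOf (by fun_prop) (by fun_prop) (by fun_prop)

theorem computable_valAdd : Computable (valAdd K X) :=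
  computable_ruleOf (by fun_prop) (by fun_prop) (by fun_prop)

theorem computable_valMul : Computable (valMul K X) :=
  computable_ruleOf (by fun_prop) (by fun_prop) (by fun_prop)

theorem computable_valStar : Computable (valStar K X) :=
  computable_ruleOf (by fun_prop) (by fun_prop) (by fun_prop)

theorem computable_rules : ∀ r ∈ rules K X, Computable r := by
  simp only [rules, List.forall_mem_cons, List.not_mem_nil, false_imp_iff, implies_true, and_true]
  exact ⟨computable_posAtom, computable_posBin, computable_posStar, computable_posBody,
    computable_posIns, computable_posRed, computable_potRule, computable_valMono,
    computable_valHom, computable_valAdd, computable_valMul, computable_valStar⟩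

end Computability

end System

/-! ### Soundness of the inference system -/

section Soundness

variable {K X : Type*} [Field K] [DecidableEq X]

theorem sum_relVec {n : ℕ} (i k : Fin n) (j : Option (Fin n)) (f : Fin n → K) :
    ∑ l : Fin n, relVec i (j.map Fin.val) k l * f l = f i + j.elim 0 f - f k := by
  have h1 : ∀ l : Fin n, relVec i (j.map Fin.val) k l * f l =
      (if l = i then f l else 0) + (if some l = j then f l else 0) - if l = k then f l else 0 := by
    intro l
    have : (some (l : ℕ) = j.map Fin.val) ↔ some l = j := by
      cases j <;> simp [Fin.ext_iff]
    simp only [relVec, this, Fin.ext_iff]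
    split_ifs <;> ring
  rw [Finset.sum_congr rfl fun l _ => h1 l, Finset.sum_sub_distrib, Finset.sum_add_distrib,
    Finset.sum_ite_eq', Finset.sum_ite_eq', if_pos (Finset.mem_univ _),
    if_pos (Finset.mem_univ _)]
  congr 2
  cases j with
  | none => simp
  | some j => simp

variable [LinearOrder (FreeGroup X)] [MulLeftMono (FreeGroup X)] [MulRightMono (FreeGroup X)]

theorem Table.MulCert.mul_eq {T D : Table K X} {C B : List (List K)} {i b k : Fin T.1}
    {j : Option (Fin T.1)} (h : T.MulCert D C B i b (j.map Fin.val) k) (hT : T.aut.Typed)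
    {m : Fin T.1 → FreeGroup X} (hm : T.aut.OrdPot m) (g : FreeGroup X) :
    (serMN hT hm i * serMN hT hm b).1 g + j.elim 0 (fun j => T.aut.ser j g) = T.aut.ser k g := by
  obtain ⟨-, hi, hC, hD, hB⟩ := h
  obtain ⟨e, hl, hr, he⟩ := hD.exists_equiv
  have hz := ((Table.zeroCert_iff _ _ _).1 hB).ser g
  have h1 : (i : ℕ) = (e (.inl i) : ℕ) := (hl i).symm
  have h2 : T.1 + (k : ℕ) = (e (.inr k) : ℕ) := (hr k).symm
  have h3 : ((j.map Fin.val).map (T.1 + ·)) = (j.map fun j => e (.inr j)).map Fin.val := by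
    cases j with
    | none => rfl
    | some j => exact congrArg some (hr j).symm
  rw [h3, h1, h2, sum_relVec, ← Aut.ser_reindex D.aut e, ← Aut.ser_reindex D.aut e, he,
    Aut.prodAut_ser_inr, sub_eq_zero] at hz
  rw [← hz, prodAut_ser_inl hT hm ((T.cancelEq_iff b C).1 hC)]
  · congr 1
    cases j with
    | none => rfl
    | some j =>
      simp only [Option.elim_some, Option.map_some]
      rw [← Aut.ser_reindex D.aut e, he, Aut.prodAut_ser_inr]
  · intro y hy
    exact absurd (hi.symm.trans hy) (by simp)

/-- The meaning of a judgement on the expression `G`. -/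
def Holds (G : RatExpr K X) : List (X × Bool) ⊕ Table K X × Option ℕ → Prop
  | .inl w => 1 ≤ FreeGroup.mk w
  | .inr (T, none) => T.aut.Typed ∧ ∃ m, T.aut.OrdPot m
  | .inr (T, some i) => ∃ h : i < T.1, T.aut.ser ⟨i, h⟩ = G.value

/-- The correctness of a judgement. -/
def Correct (j : Judgement K X) : Prop := ∃ G : RatExpr K X, G.code = j.1 ∧ (G.IsMN → Holds G j.2)

theorem Correct.holds {G : RatExpr K X} {c : List (X × Bool) ⊕ Table K X × Option ℕ}
    (h : Correct (G.code, c)) (hG : G.IsMN) : Holds G c := by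
  obtain ⟨G', hc, h⟩ := h
  obtain rfl := RatExpr.code_injective hc
  exact h hG

variable [Primcodable K] [Primcodable X]

theorem preserves_posAtom : Preserves Correct (posAtom K X) :=
  preserves_ruleOf fun θ _ _ => ⟨.mono θ.1 θ.2, rfl, fun _ => le_rfl⟩

theorem preserves_posBin : Preserves Correct (posBin K X) := by
  refine preserves_ruleOf fun θ hθ hL => ?_
  obtain ⟨o, ⟨c, w⟩, c', w'⟩ := θ
  obtain ⟨E, rfl, hE⟩ := hL (c, .inl w) (by simp)
  obtain ⟨F, rfl, hF⟩ := hL (c', .inl w') (by simp)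
  have key : E.IsMN → F.IsMN → 1 ≤ FreeGroup.mk (w ++ w') := fun h h' => by
    rw [← FreeGroup.mul_mk]
    exact one_le_mul (hE h) (hF h')
  match o with
  | 0 => exact ⟨.add E F, rfl, fun h => key h.1 h.2.1⟩
  | 1 => exact ⟨.mul E F, rfl, fun h => key h.1 h.2.1⟩
  | 2 => exact absurd rfl hθ

theorem preserves_posStar : Preserves Correct (posStar K X) := by
  refine preserves_ruleOf fun θ _ hL => ?_
  obtain ⟨c, w⟩ := θ
  obtain ⟨E, rfl, hE⟩ := hL (c, .inl w) (by simp)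
  exact ⟨.star E, rfl, fun h => hE h.1⟩

theorem preserves_posBody : Preserves Correct (posBody K X) := by
  refine preserves_ruleOf fun θ hθ hL => ?_
  obtain ⟨c, T, i, w⟩ := θ
  obtain ⟨E, rfl, hE⟩ := hL (c, .inr (T, some i)) (by simp)
  refine ⟨.star E, rfl, fun h => ?_⟩
  obtain ⟨hi, hs⟩ := hE h.1
  refine (h.pos (FreeGroup.mk w) ?_).le
  rw [mem_support, ← hs]
  have := Table.getD_evs T (FreeGroup.reduce w) ⟨i, hi⟩
  dsimp only at hθ this
  rw [this] at hθ
  exact hθ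

theorem preserves_posIns : Preserves Correct (posIns K X) := by
  refine preserves_ruleOf fun θ _ hL => ?_
  obtain ⟨c, u, w, v⟩ := θ
  obtain ⟨E, rfl, hE⟩ := hL (c, .inl (u ++ v)) (by simp)
  have hw := hL (E.code, .inl w) (by simp)
  refine ⟨E, rfl, fun h => ?_⟩
  have h1 : 1 ≤ FreeGroup.mk (u ++ v) := hE h
  have h2 : 1 ≤ FreeGroup.mk w := hw.holds h
  change 1 ≤ FreeGroup.mk (u ++ w ++ v)
  rw [← FreeGroup.mul_mk] at h1 ⊢
  rw [← FreeGroup.mul_mk]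
  calc 1 ≤ FreeGroup.mk u * FreeGroup.mk v := h1
    _ = FreeGroup.mk u * 1 * FreeGroup.mk v := by rw [mul_one]
    _ ≤ FreeGroup.mk u * FreeGroup.mk w * FreeGroup.mk v := by gcongr

theorem preserves_posRed : Preserves Correct (posRed K X) := by
  refine preserves_ruleOf fun θ hθ hL => ?_
  obtain ⟨c, w, w'⟩ := θ
  obtain ⟨E, rfl, hE⟩ := hL (c, .inl w) (by simp)
  refine ⟨E, rfl, fun h => ?_⟩
  have h1 : FreeGroup.mk w = FreeGroup.mk w' := FreeGroup.reduce.exact hθ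
  have h2 : 1 ≤ FreeGroup.mk w := hE h
  rwa [h1] at h2

theorem preserves_potRule : Preserves Correct (potRule K X) := by
  refine preserves_ruleOf fun θ hθ hL => ?_
  obtain ⟨c, T, P, L⟩ := θ
  obtain ⟨E, rfl, -⟩ := hL (c, .inl []) (by simp)
  obtain ⟨ht, hne, hp⟩ := hθ
  refine ⟨E, rfl, fun h => ⟨T.typed_iff.1 ht, ?_⟩⟩
  have hpot : T.aut.Pot (posMonoid _) fun i => ((P.getD i []).map FreeGroup.mk).toFinset := by
    refine ⟨fun i => ?_, fun i j y hM hy q hq => ?_⟩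
    · obtain ⟨p, hp⟩ := List.exists_mem_of_ne_nil _ (hne i i.2)
      exact ⟨FreeGroup.mk p, by simpa using ⟨p, hp, rfl⟩⟩
    · rw [List.mem_toFinset, List.mem_map] at hq
      obtain ⟨q, hq, rfl⟩ := hq
      have hy : T.lab j = some y := hy
      obtain ⟨p, hp, hw⟩ := hp i i.2 j j.2 hM y (by simp [hy]) q hq
      refine ⟨FreeGroup.mk p, by simpa using ⟨p, hp, rfl⟩, ?_⟩
      have h1 : 1 ≤ FreeGroup.mk (FreeGroup.invRev p ++ y :: q) :=
        (hL (E.code, .inl (FreeGroup.invRev p ++ y :: q))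
          (List.mem_cons_of_mem _ (List.mem_map.2 ⟨_, hw, rfl⟩))).holds h
      rw [← FreeGroup.mul_mk, ← FreeGroup.inv_mk, mk_cons] at h1
      exact h1
  exact hpot.exists_ordPot le_rfl

theorem preserves_valMono : Preserves Correct (valMono K X) := by
  refine preserves_ruleOf fun θ hθ _ => ⟨.mono θ.1.1 θ.1.2, rfl, fun _ => ?_⟩
  obtain ⟨h, hs⟩ := hθ.ser_eq (FreeGroup.isReduced_iff_reduce_eq.2 FreeGroup.reduce.idem)
  refine ⟨h, hs.trans ?_⟩
  rw [FreeGroup.reduce.self]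
  rfl

theorem preserves_valHom : Preserves Correct (valHom K X) := by
  refine preserves_ruleOf fun θ hθ hL => ?_
  obtain ⟨c, T', T, φ, i⟩ := θ
  obtain ⟨E, rfl, hE⟩ := hL (c, .inr (T', some i)) (by simp)
  refine ⟨E, rfl, fun h => ?_⟩
  obtain ⟨hi, hs⟩ := hE h
  exact ⟨(hθ i hi).1, (hθ.ser_eq ⟨i, hi⟩).trans hs⟩

theorem preserves_valAdd : Preserves Correct (valAdd K X) := by
  refine preserves_ruleOf fun θ hθ hL => ?_
  obtain ⟨⟨c, i⟩, ⟨c', j⟩, k, T, B⟩ := θ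
  obtain ⟨E, rfl, hE⟩ := hL (c, .inr (T, some i)) (by simp)
  obtain ⟨F, rfl, hF⟩ := hL (c', .inr (T, some j)) (by simp)
  obtain ⟨hk, hB⟩ := hθ
  refine ⟨.add E F, rfl, fun h => ⟨hk, ?_⟩⟩
  obtain ⟨hi, hs⟩ := hE h.1
  obtain ⟨hj, ht⟩ := hF h.2.1
  funext g
  have hz := ((Table.zeroCert_iff _ _ _).1 hB).ser g
  have h1 := sum_relVec ⟨i, hi⟩ ⟨k, hk⟩ (some ⟨j, hj⟩) fun l => T.aut.ser l g
  have h2 := h1.symm.trans hz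
  rw [sub_eq_zero] at h2
  refine h2.symm.trans ?_
  rw [Option.elim_some, hs, ht]
  rfl

theorem preserves_valMul : Preserves Correct (valMul K X) := by
  refine preserves_ruleOf fun θ hθ hL => ?_
  obtain ⟨⟨c, i⟩, ⟨c', b⟩, k, T, D, C, B⟩ := θ
  obtain ⟨E, rfl, hE⟩ := hL (c, .inr (T, some i)) (by simp)
  obtain ⟨F, rfl, hF⟩ := hL (c', .inr (T, some b)) (by simp)
  have hT := hL (.inr 1 :: (E.code ++ F.code), .inr (T, none)) (by simp)
  refine ⟨.mul E F, rfl, fun h => ⟨hθ.1, ?_⟩⟩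
  obtain ⟨hi, hs⟩ := hE h.1
  obtain ⟨hb, ht⟩ := hF h.2.1
  obtain ⟨hA, m, hm⟩ := Correct.holds (G := .mul E F) hT h
  funext g
  have h1 := Table.MulCert.mul_eq (i := ⟨i, hi⟩) (b := ⟨b, hb⟩) (k := ⟨k, hθ.1⟩) (j := none) hθ hA
    hm g
  refine h1.symm.trans ?_
  rw [Option.elim_none, add_zero]
  change Ser.cauchy (T.aut.ser ⟨i, hi⟩) (T.aut.ser ⟨b, hb⟩) g = _
  rw [hs, ht]
  rfl

theorem preserves_valStar : Preserves Correct (valStar K X) := by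
  refine preserves_ruleOf fun θ hθ hL => ?_
  obtain ⟨⟨c, i⟩, o, k, T, D, C, B⟩ := θ
  obtain ⟨E, rfl, hE⟩ := hL (c, .inr (T, some i)) (by simp)
  have ho := hL ([.inl (1, [])], .inr (T, some o)) (by simp)
  have hT := hL (.inr 2 :: E.code, .inr (T, none)) (by simp)
  refine ⟨.star E, rfl, fun h => ⟨hθ.1, ?_⟩⟩
  obtain ⟨hi, hs⟩ := hE h.1
  obtain ⟨ho, ht⟩ := Correct.holds (G := .mono 1 []) ho (isMN_monomial _ _)
  obtain ⟨hA, m, hm⟩ := Correct.holds (G := .star E) hT h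
  -- the series of `k` solves the equation that determines the star
  let a : mn K X := ⟨E.value, h.1.isMN_value⟩
  have ha : serMN hA hm ⟨i, hi⟩ = a := Subtype.ext hs
  have h1 : a * serMN hA hm ⟨k, hθ.1⟩ + 1 = serMN hA hm ⟨k, hθ.1⟩ := by
    refine Subtype.ext (funext fun g => ?_)
    have h2 := Table.MulCert.mul_eq (i := ⟨i, hi⟩) (b := ⟨k, hθ.1⟩) (k := ⟨k, hθ.1⟩)
      (j := some ⟨o, ho⟩) hθ hA hm g
    rw [ha, Option.elim_some, ht] at h2
    exact h2
  have h3 : serMN hA hm ⟨k, hθ.1⟩ - starMN a h.pos = 0 := by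
    refine eq_zero_of_eq_mul (a := a) h.pos ?_
    rw [mul_sub]
    conv_lhs => rw [← h1, starMN_eq a h.pos]
    abel
  exact congrArg Subtype.val (sub_eq_zero.1 h3)

theorem preserves_rules : ∀ r ∈ rules K X, Preserves Correct r := by
  simp only [rules, List.forall_mem_cons, List.not_mem_nil, false_imp_iff, implies_true, and_true]
  exact ⟨preserves_posAtom, preserves_posBin, preserves_posStar, preserves_posBody,
    preserves_posIns, preserves_posRed, preserves_potRule, preserves_valMono, preserves_valHom,
    preserves_valAdd, preserves_valMul, preserves_valStar⟩

end Soundness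

/-! ### Completeness of the inference system -/

section Completeness

variable {K X : Type*} [Field K] [DecidableEq X]

namespace Aut

theorem IsHom.comp {S S' S'' : Type*} [Fintype S] [Fintype S'] [Fintype S''] [DecidableEq S]
    [DecidableEq S'] {φ : S'' → S'} {ψ : S' → S} {A'' : Aut K X S''} {A' : Aut K X S'}
    {A : Aut K X S} (hψ : IsHom ψ A' A) (hφ : IsHom φ A'' A') : IsHom (fun i => ψ (φ i)) A'' A := by
  refine fun i => ⟨(hψ _).1.trans (hφ i).1, (hψ _).2.1.trans (hφ i).2.1, fun j => ?_⟩
  rw [(hψ _).2.2 j]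
  have h1 : ∀ j', (if ψ j' = j then A'.M (φ i) j' else 0) =
      ∑ j'', if φ j'' = j' then (if ψ j' = j then A''.M i j'' else 0) else 0 := by
    intro j'
    split_ifs
    · exact (hφ i).2.2 j'
    · simp
  rw [Finset.sum_congr rfl fun j' _ => h1 j', Finset.sum_comm]
  exact Finset.sum_congr rfl fun j'' _ => by rw [Finset.sum_ite_eq, if_pos (Finset.mem_univ _)]

theorem Typed.reindex {S S' : Type*} {A : Aut K X S} (h : A.Typed) (e : S' ≃ S) :
    (A.reindex e).Typed := fun i j => h (e i) (e j)

theorem exists_zeroCert_table {n : ℕ} {A : Aut K X (Fin n)} (hA : A.Typed) {i k : Fin n}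
    {j : Option (Fin n)} (h : ∀ g, A.ser i g + j.elim 0 (fun j => A.ser j g) = A.ser k g) :
    ∃ B, A.table.ZeroCert (relVec i (j.map Fin.val) k) B := by
  obtain ⟨B, hB⟩ := exists_zeroCert hA (v := fun l : Fin n => relVec i (j.map Fin.val) k l)
    fun g => by rw [sum_relVec, h, sub_self]
  have h1 : A.ZeroCert (fun l => relVec i (j.map Fin.val) k l) fun i j => mat (rows B) i j := by
    simpa only [mat_rows] using hB
  exact ⟨rows B, (Table.zeroCert_iff _ _ _).2 ((congrArg (fun A' : Aut K X (Fin n) =>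
    A'.ZeroCert (fun l => relVec i (j.map Fin.val) k l) fun i j => mat (rows B) i j)
      A.aut_table).mpr h1)⟩

variable [LinearOrder (FreeGroup X)] [MulLeftMono (FreeGroup X)] [MulRightMono (FreeGroup X)]

theorem exists_mulCert {n : ℕ} {A : Aut K X (Fin n)} (hA : A.Typed) {m : Fin n → FreeGroup X}
    (hm : A.OrdPot m) {i b k : Fin n} {j : Option (Fin n)} (hi : A.lab i = none)
    (h : ∀ g, (serMN hA hm i * serMN hA hm b).1 g + j.elim 0 (fun j => A.ser j g) = A.ser k g) :
    ∃ D C B, A.table.MulCert D C B i b (j.map Fin.val) k := by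
  obtain ⟨C, hC⟩ := exists_cancelEq hA hm b
  let D := (A.prodAut C).reindex finSumFinEquiv.symm
  have hl : ∀ i : Fin n, D.ser (Fin.castAdd n i) = (A.prodAut C).ser (.inl i) := fun i => by
    rw [ser_reindex, finSumFinEquiv_symm_apply_castAdd]
  have hr : ∀ i : Fin n, D.ser (Fin.natAdd n i) = A.ser i := fun i => by
    rw [ser_reindex, finSumFinEquiv_symm_apply_natAdd, prodAut_ser_inr]
  obtain ⟨B, hB⟩ := exists_zeroCert_table (A := D) ((typed_prodAut hA C).reindex _)
    (i := Fin.castAdd n i) (k := Fin.natAdd n k) (j := j.map (Fin.natAdd n)) (fun g => by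
      rw [hl, hr, prodAut_ser_inl hA hm hC g i fun y hy => by simp [hi] at hy, ← h]
      congr 1
      cases j with
      | none => rfl
      | some j => exact congrFun (hr j) g)
  have hC' : A.CancelEq b fun i j => mat (rows C) i j := by
    simpa only [mat_rows] using hC
  refine ⟨D.table, rows C, B, k.2, (A.lab_table i).trans hi, ?_, Table.isProd_table A C, ?_⟩
  · exact (Table.cancelEq_iff A.table b _).2 ((congrArg (fun A' : Aut K X (Fin n) =>
      A'.CancelEq b fun i j => mat (rows C) i j) A.aut_table).mpr hC')
  · have hj : (j.map (Fin.natAdd n)).map Fin.val = (j.map Fin.val).map (n + ·) := by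
      cases j <;> rfl
    rw [hj] at hB
    exact hB

end Aut

variable [Primcodable K] [Primcodable X]

/-- Derivability in the inference system. -/
abbrev Der (j : Judgement K X) : Prop := Derivable (systemOf (rules K X)) j

theorem Der.red {c : List (Token K X)} {w w' : List (X × Bool)} (h : Der (c, .inl w))
    (hw : FreeGroup.mk w = FreeGroup.mk w') : Der (c, .inl w') :=
  derivable_of_rule (show posRed K X ∈ _ by simp [rules]) (c, w, w')
    (congrArg FreeGroup.toWord hw) (by simpa using h)

theorem Der.ins {c : List (Token K X)} {u v w : List (X × Bool)} (h : Der (c, .inl (u ++ v)))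
    (hw : Der (c, .inl w)) : Der (c, .inl (u ++ w ++ v)) :=
  derivable_of_rule (show posIns K X ∈ _ by simp [rules]) (c, u, w, v) trivial
    (by simpa using ⟨h, hw⟩)

theorem Der.add {c c' : List (Token K X)} {w w' : List (X × Bool)} (h : Der (c, .inl w))
    (h' : Der (c', .inl w')) : Der (.inr 0 :: (c ++ c'), .inl (w ++ w')) :=
  derivable_of_rule (show posBin K X ∈ _ by simp [rules]) (0, (c, w), c', w')
    (show (0 : Fin 3) ≠ 2 by decide) (by simpa using ⟨h, h'⟩)

theorem Der.mul {c c' : List (Token K X)} {w w' : List (X × Bool)} (h : Der (c, .inl w))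
    (h' : Der (c', .inl w')) : Der (.inr 1 :: (c ++ c'), .inl (w ++ w')) :=
  derivable_of_rule (show posBin K X ∈ _ by simp [rules]) (1, (c, w), c', w')
    (show (1 : Fin 3) ≠ 2 by decide) (by simpa using ⟨h, h'⟩)

theorem Der.star {c : List (Token K X)} {w : List (X × Bool)} (h : Der (c, .inl w)) :
    Der (.inr 2 :: c, .inl w) :=
  derivable_of_rule (show posStar K X ∈ _ by simp [rules]) (c, w) trivial (by simpa using h)

theorem der_nil (G : RatExpr K X) : Der (G.code, .inl []) := by
  induction G with
  | mono c w =>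
    exact derivable_of_rule (show posAtom K X ∈ _ by simp [rules]) (c, w) trivial (by simp)
  | add E F hE hF => exact hE.add hF
  | mul E F hE hF => exact hE.mul hF
  | star E hE => exact hE.star

/-- The elements that are provably positive for an expression. -/
def derMonoid (G : RatExpr K X) : Submonoid (FreeGroup X) where
  carrier := {g | Der (G.code, .inl g.toWord)}
  one_mem' := by simpa using der_nil G
  mul_mem' {a b} ha hb := by
    have h1 : Der (G.code, .inl (a.toWord ++ [])) := by simpa using ha
    refine (h1.ins hb).red ?_
    rw [List.append_nil, ← FreeGroup.mul_mk]
    simp only [FreeGroup.mk_toWord]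

theorem mem_derMonoid {G : RatExpr K X} {g : FreeGroup X} :
    g ∈ derMonoid G ↔ Der (G.code, .inl g.toWord) := Iff.rfl

theorem isNormal_derMonoid (G : RatExpr K X) : IsNormal (derMonoid G) := by
  intro g a ha
  have h1 : Der (G.code, .inl (g.toWord ++ g⁻¹.toWord)) := by
    refine (der_nil G).red ?_
    rw [← FreeGroup.mul_mk]
    simp only [FreeGroup.mk_toWord, mul_inv_cancel]
    rfl
  refine (h1.ins (mem_derMonoid.1 ha)).red ?_
  rw [← FreeGroup.mul_mk, ← FreeGroup.mul_mk]
  simp only [FreeGroup.mk_toWord]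

theorem derMonoid_le_add_left (E F : RatExpr K X) : derMonoid E ≤ derMonoid (E.add F) :=
  fun g hg => by
    have h := (mem_derMonoid.1 hg).add (der_nil F)
    rwa [List.append_nil] at h

theorem derMonoid_le_add_right (E F : RatExpr K X) : derMonoid F ≤ derMonoid (E.add F) :=
  fun _ hg => (der_nil E).add (mem_derMonoid.1 hg)

theorem derMonoid_le_mul_left (E F : RatExpr K X) : derMonoid E ≤ derMonoid (E.mul F) :=
  fun g hg => by
    have h := (mem_derMonoid.1 hg).mul (der_nil F)
    rwa [List.append_nil] at h

theorem derMonoid_le_mul_right (E F : RatExpr K X) : derMonoid F ≤ derMonoid (E.mul F) :=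
  fun _ hg => (der_nil E).mul (mem_derMonoid.1 hg)

theorem derMonoid_le_star (E : RatExpr K X) : derMonoid E ≤ derMonoid E.star :=
  fun _ hg => (mem_derMonoid.1 hg).star

theorem Der.hom {c : List (Token K X)} {n n' : ℕ} {A' : Aut K X (Fin n')} {A : Aut K X (Fin n)}
    {φ : Fin n' → Fin n} (hφ : Aut.IsHom φ A' A) {i : Fin n'}
    (h : Der (c, .inr (A'.table, some (i : ℕ)))) : Der (c, .inr (A.table, some (φ i : ℕ))) := by
  have := derivable_of_rule (show valHom K X ∈ _ by simp [rules])
    (c, A'.table, A.table, List.ofFn fun i => (φ i : ℕ), (i : ℕ)) (Table.isHom_table hφ)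
    fun x hx => List.mem_singleton.1 hx ▸ h
  dsimp only at this
  rwa [getD_ofFn] at this

/-- Potentials relative to the provably positive elements are provable. -/
theorem der_pot {G : RatExpr K X} {n : ℕ} {A : Aut K X (Fin n)} (hA : A.Typed)
    {P : Fin n → Finset (FreeGroup X)} (hP : A.Pot (derMonoid G) P) :
    Der (G.code, .inr (A.table, none)) := by
  classical
  let Q : List (List (List (X × Bool))) :=
    List.ofFn fun i => (P i).toList.map FreeGroup.toWord
  have hQ : ∀ i : Fin n, Q.getD i [] = (P i).toList.map FreeGroup.toWord :=
    fun i => getD_ofFn _ _ i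
  -- all products of words as in the definition of potentials that are provably positive
  let L : List (List (X × Bool)) :=
    ((List.finRange n).flatMap fun i => (List.finRange n).flatMap fun j =>
      (A.lab j).toList.flatMap fun y => (P j).toList.flatMap fun q => (P i).toList.map fun p =>
        FreeGroup.invRev p.toWord ++ y :: q.toWord).filter fun w => Der (G.code, .inl w)
  refine derivable_of_rule (show potRule K X ∈ _ by simp [rules]) (G.code, A.table, Q, L)
    ⟨(Table.typed_iff _).2 ((congrArg (fun A' : Aut K X (Fin n) => A'.Typed) A.aut_table).mpr hA),
      ?_, ?_⟩ ?_
  · intro i hi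
    obtain ⟨i, rfl⟩ : ∃ k : Fin n, (k : ℕ) = i := ⟨⟨i, hi⟩, rfl⟩
    rw [hQ]
    simpa using (hP.1 i).ne_empty
  · intro i hi j hj hM y hy q hq
    obtain ⟨i, rfl⟩ : ∃ k : Fin n, (k : ℕ) = i := ⟨⟨i, hi⟩, rfl⟩
    obtain ⟨j, rfl⟩ : ∃ k : Fin n, (k : ℕ) = j := ⟨⟨j, hj⟩, rfl⟩
    dsimp only at hM hy hq ⊢
    rw [A.M_table] at hM
    rw [A.lab_table] at hy
    rw [hQ, List.mem_map] at hq
    obtain ⟨q, hq, rfl⟩ := hq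
    obtain ⟨p, hp, hr⟩ := hP.2 i j y hM (by simpa using hy) q (Finset.mem_toList.1 hq)
    refine ⟨p.toWord, ?_, ?_⟩
    · rw [hQ]
      exact List.mem_map.2 ⟨p, Finset.mem_toList.2 hp, rfl⟩
    · rw [List.mem_filter]
      refine ⟨?_, ?_⟩
      · simp only [List.mem_flatMap, List.mem_map, List.mem_finRange, true_and]
        exact ⟨i, j, y, hy, q, hq, p, Finset.mem_toList.2 hp, rfl⟩
      · rw [decide_eq_true_iff]
        refine (mem_derMonoid.1 hr).red ?_
        rw [FreeGroup.mk_toWord, ← FreeGroup.mul_mk, mk_cons, ← FreeGroup.inv_mk]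
        simp only [FreeGroup.mk_toWord]
  · intro x hx
    dsimp only at hx
    rcases List.mem_cons.1 hx with rfl | hx
    · exact der_nil G
    · obtain ⟨w, hw, rfl⟩ := List.mem_map.1 hx
      exact of_decide_eq_true (List.mem_filter.1 hw).2

variable [LinearOrder (FreeGroup X)] [MulLeftMono (FreeGroup X)] [MulRightMono (FreeGroup X)]

theorem Der.holds {G : RatExpr K X} (hG : G.IsMN) {j : List (X × Bool) ⊕ Table K X × Option ℕ}
    (h : Der (G.code, j)) : Holds G j :=
  (Derivable.sound preserves_rules h).holds hG

theorem derMonoid_le {G : RatExpr K X} (hG : G.IsMN) : derMonoid G ≤ posMonoid _ := by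
  intro g hg
  have h1 : 1 ≤ FreeGroup.mk g.toWord := (mem_derMonoid.1 hg).holds hG
  rwa [FreeGroup.mk_toWord] at h1

theorem Der.ser_eq {G : RatExpr K X} (hG : G.IsMN) {n : ℕ} {A : Aut K X (Fin n)} {i : Fin n}
    (h : Der (G.code, .inr (A.table, some (i : ℕ)))) : A.ser i = G.value := by
  obtain ⟨hi, hs⟩ := h.holds hG
  exact (congrFun (congrArg Aut.ser A.aut_table) i).symm.trans hs

/-- The value of `G` is provably given by an automaton with potentials relative to `N`. -/
def HasAut (N : Submonoid (FreeGroup X)) (G : RatExpr K X) : Prop :=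
  ∃ (n : ℕ) (A : Aut K X (Fin n)) (P : Fin n → Finset (FreeGroup X)) (i : Fin n),
    A.Typed ∧ A.Pot N P ∧ A.lab i = none ∧ Der (G.code, .inr (A.table, some (i : ℕ)))

theorem HasAut.mono_left {N N' : Submonoid (FreeGroup X)} {G : RatExpr K X} (h : HasAut N G)
    (hN : N ≤ N') : HasAut N' G := by
  obtain ⟨n, A, P, i, h1, h2, h3⟩ := h
  exact ⟨n, A, P, i, h1, h2.mono hN, h3⟩

theorem hasAut_mono (N : Submonoid (FreeGroup X)) (a : K) (w : List (X × Bool)) :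
    HasAut N (RatExpr.mono a w) := by
  have hW : FreeGroup.IsReduced (FreeGroup.reduce w) :=
    FreeGroup.isReduced_iff_reduce_eq.2 FreeGroup.reduce.idem
  refine ⟨_, Aut.chain a (FreeGroup.reduce w), _, 0, Aut.typed_chain a hW, Aut.pot_chain a _ _,
    rfl, ?_⟩
  exact derivable_of_rule (show valMono K X ∈ _ by simp [rules]) ((a, w), _)
      (Table.isChain_table a _) (fun x hx => absurd hx List.not_mem_nil)

/-- If the values of two expressions are provably given by automata, then they are so by a common
automaton, which moreover has a state for the value of a third expression. -/
theorem exists_common [Finite X] {N : Submonoid (FreeGroup X)} {E F G : RatExpr K X}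
    (hE : HasAut N E) (hF : HasAut N F) (hG : G.IsMN) (hP : PWO N (support G.value)) :
    ∃ (n : ℕ) (A : Aut K X (Fin n)) (P : Fin n → Finset (FreeGroup X)) (i j k : Fin n),
      A.Typed ∧ A.Pot N P ∧ A.lab i = none ∧ A.lab k = none ∧ A.ser k = G.value ∧
      Der (E.code, .inr (A.table, some (i : ℕ))) ∧ Der (F.code, .inr (A.table, some (j : ℕ))) := by
  obtain ⟨n₁, A₁, P₁, i₁, t₁, p₁, l₁, d₁⟩ := hE
  obtain ⟨n₂, A₂, P₂, i₂, t₂, p₂, l₂, d₂⟩ := hF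
  obtain ⟨n₃, A₃, P₃, i₃, t₃, p₃, l₃, s₃⟩ := hG.exists_aut hP
  obtain ⟨n, A, P, φ₁, φ₂, t, p, h₁, h₂⟩ := Aut.exists_union t₁ t₂ p₁ p₂
  obtain ⟨n', A', P', ψ, φ₃, t', p', h', h₃⟩ := Aut.exists_union t t₃ p p₃
  refine ⟨n', A', P', ψ (φ₁ i₁), ψ (φ₂ i₂), φ₃ i₃, t', p', ?_, ?_, ?_, d₁.hom (h'.comp h₁),
    d₂.hom (h'.comp h₂)⟩
  · rw [((h'.comp h₁) i₁).1, l₁]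
  · rw [(h₃ i₃).1, l₃]
  · rw [h₃.ser_eq, s₃]

theorem hasAut_add [Finite X] {E F : RatExpr K X} (h : (E.add F).IsMN)
    (hE : HasAut (derMonoid (E.add F)) E) (hF : HasAut (derMonoid (E.add F)) F)
    (hP : PWO (derMonoid (E.add F)) (support (E.add F).value)) :
    HasAut (derMonoid (E.add F)) (E.add F) := by
  obtain ⟨n, A, P, i, j, k, ht, hp, -, hk, hs, hi, hj⟩ := exists_common hE hF h hP
  refine ⟨n, A, P, k, ht, hp, hk, ?_⟩
  obtain ⟨B, hB⟩ := Aut.exists_zeroCert_table ht (i := i) (j := some j) (k := k) fun g => by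
    rw [Option.elim_some, hi.ser_eq h.1, hj.ser_eq h.2.1, hs]
    rfl
  exact derivable_of_rule (show valAdd K X ∈ _ by simp [rules])
    ((E.code, (i : ℕ)), (F.code, (j : ℕ)), (k : ℕ), A.table, B) ⟨k.2, hB⟩ (by simpa using ⟨hi, hj⟩)

theorem hasAut_mul [Finite X] {E F : RatExpr K X} (h : (E.mul F).IsMN)
    (hE : HasAut (derMonoid (E.mul F)) E) (hF : HasAut (derMonoid (E.mul F)) F)
    (hP : PWO (derMonoid (E.mul F)) (support (E.mul F).value)) :
    HasAut (derMonoid (E.mul F)) (E.mul F) := by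
  obtain ⟨n, A, P, i, j, k, ht, hp, hl, hk, hs, hi, hj⟩ := exists_common hE hF h hP
  refine ⟨n, A, P, k, ht, hp, hk, ?_⟩
  obtain ⟨m, hm⟩ := hp.exists_ordPot (derMonoid_le h)
  obtain ⟨D, C, B, hB⟩ := Aut.exists_mulCert ht hm (i := i) (b := j) (j := none) (k := k) hl
    fun g => by
      rw [Option.elim_none, add_zero, hs]
      change Ser.cauchy (A.ser i) (A.ser j) g = _
      rw [hi.ser_eq h.1, hj.ser_eq h.2.1]
      rfl
  have hpot := der_pot ht hp
  exact derivable_of_rule (show valMul K X ∈ _ by simp [rules])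
    ((E.code, (i : ℕ)), (F.code, (j : ℕ)), (k : ℕ), A.table, D, C, B) hB
    (by simpa using ⟨hi, hj, hpot⟩)

theorem hasAut_star [Finite X] {E : RatExpr K X} (h : E.star.IsMN)
    (hE : HasAut (derMonoid E.star) E)
    (hP : PWO (derMonoid E.star) (support E.star.value)) : HasAut (derMonoid E.star) E.star := by
  obtain ⟨n, A, P, i, j, k, ht, hp, hl, hk, hs, hi, hj⟩ := exists_common hE
    (hasAut_mono _ 1 []) h hP
  refine ⟨n, A, P, k, ht, hp, hk, ?_⟩
  obtain ⟨m, hm⟩ := hp.exists_ordPot (derMonoid_le h)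
  obtain ⟨D, C, B, hB⟩ := Aut.exists_mulCert ht hm (i := i) (b := k) (j := some j) (k := k) hl
    fun g => by
      have h1 : serMN ht hm i = ⟨E.value, h.1.isMN_value⟩ := Subtype.ext (hi.ser_eq h.1)
      have h2 : serMN ht hm k = starMN ⟨E.value, h.1.isMN_value⟩ h.pos := Subtype.ext hs
      have h3 : A.ser k g = (serMN ht hm k).1 g := rfl
      rw [h3, h1, h2, Option.elim_some, hj.ser_eq (G := .mono 1 []) (isMN_monomial _ _)]
      conv_rhs => rw [starMN_eq]
      exact add_comm _ _
  have hpot := der_pot ht hp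
  exact derivable_of_rule (show valStar K X ∈ _ by simp [rules])
    ((E.code, (i : ℕ)), (j : ℕ), (k : ℕ), A.table, D, C, B) hB
    (by simpa using ⟨hi, hj, hpot⟩)

/-- The support of the body of a star is provably positive. -/
theorem support_subset_derMonoid_star {E : RatExpr K X} {N : Submonoid (FreeGroup X)}
    (h : E.IsMN) (hE : HasAut N E) :
    support E.value ⊆ derMonoid E.star := by
  obtain ⟨n, A, P, i, -, -, -, hi⟩ := hE
  intro g hg
  refine derivable_of_rule (show posBody K X ∈ _ by simp [rules])
    (E.code, A.table, (i : ℕ), g.toWord) ?_ (by simpa using hi)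
  have h1 := Table.getD_evs A.table (FreeGroup.reduce g.toWord) i
  have h2 : A.table.aut.ser i g = E.value g :=
    congrFun ((congrFun (congrArg Aut.ser A.aut_table) i).trans (hi.ser_eq h)) g
  rw [FreeGroup.reduce_toWord] at h1
  dsimp only
  rw [FreeGroup.reduce_toWord]
  intro h0
  exact hg (h2.symm.trans (h1.symm.trans h0))

/-- Completeness: the value of a rational Malcev–Neumann expression is provably given by an
automaton with potentials, relative to the provably positive elements. Its support is partially well-ordered
by them, as they form a normal submonoid that contains the supports of the bodies of all stars. -/
theorem pwo_and_hasAut [Finite X] {G : RatExpr K X} (h : G.IsMN) :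
    PWO (derMonoid G) (support G.value) ∧ HasAut (derMonoid G) G := by
  induction G with
  | mono c w =>
    exact ⟨((Set.finite_singleton _).subset
      (support_monomial_subset c (FreeGroup.mk w))).partiallyWellOrderedOn, hasAut_mono _ c w⟩
  | add E F hE hF =>
    obtain ⟨hE, hE'⟩ := hE h.1
    obtain ⟨hF, hF'⟩ := hF h.2.1
    have hP : PWO (derMonoid (E.add F)) (support (E.add F).value) :=
      ((hE.mono_rel (derMonoid_le_add_left E F)).union
        (hF.mono_rel (derMonoid_le_add_right E F))).mono (support_add _ _)
    exact ⟨hP, hasAut_add h (hE'.mono_left (derMonoid_le_add_left E F))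
      (hF'.mono_left (derMonoid_le_add_right E F)) hP⟩
  | mul E F hE hF =>
    obtain ⟨hE, hE'⟩ := hE h.1
    obtain ⟨hF, hF'⟩ := hF h.2.1
    have hP : PWO (derMonoid (E.mul F)) (support (E.mul F).value) :=
      (PWO.image2_mul (isNormal_derMonoid _) (hE.mono_rel (derMonoid_le_mul_left E F))
        (hF.mono_rel (derMonoid_le_mul_right E F))).mono (support_cauchy_subset _ _)
    exact ⟨hP, hasAut_mul h (hE'.mono_left (derMonoid_le_mul_left E F))
      (hF'.mono_left (derMonoid_le_mul_right E F)) hP⟩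
  | star E hE =>
    obtain ⟨hE, hE'⟩ := hE h.1
    have hP : PWO (derMonoid E.star) (support E.star.value) :=
      (PWO.list_prod (isNormal_derMonoid _) (hE.mono_rel (derMonoid_le_star E))
        (support_subset_derMonoid_star h.1 hE')).mono (support_kstar_subset _)
    exact ⟨hP, hasAut_star h (hE'.mono_left (derMonoid_le_star E)) hP⟩

end Completeness

/-! ### Computing the expression of a table -/

section Output

variable {K X : Type*} [Field K]

namespace Table

/-- The codes of the expressions obtained from a table by the elimination of the first `m`
states. -/
def kleeneCodes (T : Table K X) (m : ℕ) : List (List (List (Token K X))) :=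
  Nat.rec (motive := fun _ => List (List (List (Token K X))))
    ((List.range T.1).map fun i => (List.range T.1).map fun j =>
      [.inl (T.M i j, (T.lab j).toList)])
    (fun k C => (List.range T.1).map fun i => (List.range T.1).map fun j =>
      .inr 0 :: ((C.getD i []).getD j [] ++ .inr 1 :: ((C.getD i []).getD k [] ++
        .inr 1 :: (.inr 2 :: (C.getD k []).getD k [] ++ (C.getD k []).getD j [])))) m

/-- The code of the expression for the series of the state `i`, for paths which stop in one of the
first `m` states. -/
def outCode (T : Table K X) (i m : ℕ) : List (Token K X) :=
  Nat.rec (motive := fun _ => List (Token K X)) [.inl (T.γ i, [])]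
    (fun k C => .inr 0 :: (C ++ .inr 1 :: (((T.kleeneCodes T.1).getD i []).getD k [] ++
      [.inl (T.γ k, [])]))) m

theorem getD_getD_map_range {α : Type*} {n : ℕ} (f : ℕ → ℕ → List α) {i j : ℕ} (hi : i < n)
    (hj : j < n) : ((((List.range n).map fun i => (List.range n).map fun j => f i j).getD i
      []).getD j []) = f i j := by
  simp [List.getD_eq_getElem?_getD, hi, hj]

theorem kleeneCodes_spec (T : Table K X) {m : ℕ} (hm : m ≤ T.1) {i j : ℕ} (hi : i < T.1)
    (hj : j < T.1) : ((T.kleeneCodes m).getD i []).getD j [] =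
      (kleene T.M T.lab (List.range m).reverse i j).code := by
  induction m generalizing i j with
  | zero => exact getD_getD_map_range _ hi hj
  | succ k ih =>
    have hk : k < T.1 := by omega
    refine (getD_getD_map_range _ hi hj).trans ?_
    rw [List.range_succ, List.reverse_append]
    simp only [List.reverse_cons, List.reverse_nil, List.nil_append, List.cons_append, kleene,
      RatExpr.code, ← ih (by omega) hi hj, ← ih (by omega) hi hk, ← ih (by omega) hk hk,
      ← ih (by omega) hk hj]
    rfl

theorem outCode_spec (T : Table K X) {i m : ℕ} (hi : i < T.1) (hm : m ≤ T.1) :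
    T.outCode i m =
      (outExpr T.M T.lab T.γ (List.range T.1).reverse (List.range m).reverse i).code := by
  induction m with
  | zero => rfl
  | succ k ih =>
    rw [List.range_succ, List.reverse_append]
    simp only [List.reverse_cons, List.reverse_nil, List.nil_append, List.cons_append, outExpr,
      RatExpr.code, ← ih (by omega), ← kleeneCodes_spec T le_rfl hi (show k < T.1 by omega)]
    rfl

theorem kleene_map (T : Table K X) (l : List (Fin T.1)) (i j : Fin T.1) :
    kleene T.M T.lab (l.map Fin.val) i j = kleene T.aut.M T.aut.lab l i j := by
  induction l generalizing i j with
  | nil => rfl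
  | cons k l ih => simp only [List.map_cons, kleene, ih]

theorem outExpr_map (T : Table K X) (full l : List (Fin T.1)) (i : Fin T.1) :
    outExpr T.M T.lab T.γ (full.map Fin.val) (l.map Fin.val) i =
      outExpr T.aut.M T.aut.lab T.aut.γ full l i := by
  induction l with
  | nil => rfl
  | cons k l ih =>
    simp only [List.map_cons, outExpr, ih, kleene_map]
    rfl

theorem outCode_eq (T : Table K X) (i : Fin T.1) : T.outCode i T.1 =
    (outExpr T.aut.M T.aut.lab T.aut.γ (List.finRange T.1).reverse
      (List.finRange T.1).reverse i).code := by
  rw [outCode_spec T i.2 le_rfl, ← outExpr_map, List.map_reverse, List.map_coe_finRange_eq_range]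

end Table

@[fun_prop] theorem Comp.kleeneCodes [Primcodable K] [Primcodable X] {α : Type*} [Primcodable α]
    {T : α → Table K X} {m : α → ℕ} (hT : Computable T) (hm : Computable m) :
    Computable fun x => (T x).kleeneCodes (m x) := by
  unfold Table.kleeneCodes
  fun_prop

@[fun_prop] theorem Comp.outCode [Primcodable K] [Primcodable X] {α : Type*} [Primcodable α]
    {T : α → Table K X} {i m : α → ℕ} (hT : Computable T) (hi : Computable i)
    (hm : Computable m) : Computable fun x => (T x).outCode (i x) (m x) := by
  unfold Table.outCode
  fun_prop

end Output

/-! ### The algorithm -/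

section Algorithm

variable {K X : Type*} [Field K] [DecidableEq X] [Primcodable K] [Primcodable X]

/-- One step of the search: `m` is the code of a list of instances of rules, of a table, and of a
state. If these prove that the series of the state is the value of the expression with the string
of symbols `c` and that the table has potentials, the expression of the table is the result. -/
def searchStep (c : List (Token K X)) (m : ℕ) : Option (List (Token K X)) :=
  open scoped Classical in
  (Encodable.decode (α := List ℕ × Table K X × ℕ) m).elim none fun x =>
    if (c, .inr (x.2.1, none)) ∈ derived (systemOf (rules K X)) x.1 ∧
      (c, .inr (x.2.1, some x.2.2)) ∈ derived (systemOf (rules K X)) x.1 then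
    some (x.2.1.outCode x.2.2 x.2.1.1) else none

open scoped Classical in
theorem computable_searchStep [Fact (IsComputableField K)] :
    Computable₂ (searchStep (K := K) (X := X)) := by
  have h1 := computable_derived (computable_systemOf (computable_rules (K := K) (X := X)))
  have h2 : Computable fun m => Encodable.decode (α := List ℕ × Table K X × ℕ) m :=
    Computable.decode
  have h3 : Computable fun p : List (Token K X) × ℕ => searchStep p.1 p.2 := by
    unfold searchStep
    refine Comp.option_elim (h2.comp Computable.snd) (by fun_prop)
      (Comp.ite (Comp.and (Comp.mem (h1.comp ?_) ?_) (Comp.mem (h1.comp ?_) ?_)) ?_ ?_) <;> fun_prop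
  exact h3

/-- The algorithm: search for an automaton and a proof that it has potentials and represents the
value of the given expression, and eliminate its states. -/
def simplify (c : List (Token K X)) : Part (List (Token K X)) := Nat.rfindOpt (searchStep c)

theorem partrec_simplify [Fact (IsComputableField K)] : Partrec (simplify (K := K) (X := X)) :=
  Partrec.rfindOpt computable_searchStep

variable [LinearOrder (FreeGroup X)] [MulLeftMono (FreeGroup X)] [MulRightMono (FreeGroup X)]

theorem searchStep_sound {E : RatExpr K X} (h : E.IsMN) {m : ℕ} {d : List (Token K X)}
    (hd : searchStep E.code m = some d) : ∃ F : RatExpr K X, F.code = d ∧ F.IsMN ∧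
      F.WithoutSimplification ∧ F.value = E.value := by
  rw [searchStep] at hd
  cases hx : Encodable.decode (α := List ℕ × Table K X × ℕ) m with
  | none =>
    rw [hx] at hd
    exact absurd hd (by simp)
  | some x =>
    rw [hx, Option.elim_some] at hd
    split_ifs at hd with hc
    obtain ⟨l, T, i⟩ := x
    obtain ⟨hA, m, hm⟩ := Der.holds h (derivable_of_mem_derived hc.1)
    obtain ⟨hi, hs⟩ := Der.holds h (derivable_of_mem_derived hc.2)
    have h1 := outExpr_spec hA hm (List.finRange T.1).reverse (List.finRange T.1).reverse ⟨i, hi⟩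
    refine ⟨_, (T.outCode_eq ⟨i, hi⟩).symm.trans (Option.some.inj hd), h1.1, h1.2.1, ?_⟩
    rw [outExpr_value hA hm (List.nodup_reverse.2 (List.nodup_finRange _)) (by simp), hs]

theorem exists_mem_simplify [Finite X] {E : RatExpr K X} (h : E.IsMN) :
    ∃ F : RatExpr K X, F.code ∈ simplify E.code ∧ F.IsMN ∧ F.WithoutSimplification ∧
      F.value = E.value := by
  obtain ⟨-, n, A, P, i, hA, hP, -, hi⟩ := pwo_and_hasAut h
  obtain ⟨l, hl⟩ := exists_subset_derived (ρ := systemOf (rules K X))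
    (L := [(E.code, .inr (A.table, none)), (E.code, .inr (A.table, some (i : ℕ)))]) (by
      simpa using ⟨(der_pot hA hP).exists_derived, hi.exists_derived⟩)
  have hdom : (simplify E.code).Dom := by
    rw [simplify, Nat.rfindOpt_dom]
    refine ⟨Encodable.encode (l, A.table, (i : ℕ)), A.table.outCode i n, ?_⟩
    rw [searchStep, Encodable.encodek, Option.elim_some,
      if_pos ⟨hl (by simp), hl (by simp)⟩]
    rfl
  obtain ⟨d, hd⟩ := Part.dom_iff_mem.1 hdom
  obtain ⟨m, hm⟩ := Nat.rfindOpt_spec hd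
  obtain ⟨F, rfl, hF⟩ := searchStep_sound h hm
  exact ⟨F, hd, hF⟩

end Algorithm

end

end MalcevNeumann

theorem mainTheorem4 (K : Type*) [Field K] (X : Type*) [Finite X] [DecidableEq X]
    [LinearOrder (FreeGroup X)] [MulLeftMono (FreeGroup X)] [MulRightMono (FreeGroup X)] :
    (∀ a : MalcevNeumann.Ser K X, a.IsRationalMN →
      ∃ F : MalcevNeumann.RatExpr K X, F.IsMN ∧ F.WithoutSimplification ∧ F.value = a) ∧
    (∀ [Primcodable X] [Primcodable K], MalcevNeumann.IsComputableField K →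
      ∃ f : List (MalcevNeumann.Token K X) →. List (MalcevNeumann.Token K X), Partrec f ∧
        ∀ E : MalcevNeumann.RatExpr K X, E.IsMN →
          ∃ F : MalcevNeumann.RatExpr K X, F.code ∈ f E.code ∧
            F.IsMN ∧ F.WithoutSimplification ∧ F.value = E.value) := by
  refine ⟨?_, fun hK => ?_⟩
  · rintro _ ⟨E, hE, rfl⟩
    exact hE.exists_withoutSimplification
  · have : Fact (MalcevNeumann.IsComputableField K) := ⟨hK⟩
    exact ⟨MalcevNeumann.simplify, MalcevNeumann.partrec_simplify, fun E hE =>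
      MalcevNeumann.exists_mem_simplify hE⟩
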